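/- **Setting.** Let $X=\mathbb C^N$ and let $\mathcal C$ be a finite set of affine hyperplanes in $X$. The vertices $\alpha\in I(\Gamma)$ are the nonempty intersections $\overline X_\alpha$ of hyperplanes of $\mathcal C$ (the empty intersection being $X$); the stratum $X_\alpha$ is the complement in $\overline X_\alpha$ of all $\overline X_\beta\subsetneq\overline X_\alpha$; $l(\alpha)=\operatorname{codim}_X X_\alpha$. Write $\alpha\succ\beta$ if $\overline X_\alpha\supset\overline X_\beta$ and $l(\beta)=l(\alpha)+1$; $\alpha,\beta$ are adjacent if $\alpha\succ\beta$ or $\beta\succ\alpha$. Let $F_\alpha$ be the space of affine functions on $X$ vanishing on $X_\alpha$, $T_\alpha$ the space of constant vector fields parallel to $X_\alpha$, and $\overline\Omega_\alpha$ the line of translation-invariant top forms on $\overline X_\alpha$, i.e. of top exterior forms on $T_\alpha$. Fix a non-degenerate bilinear form on $\mathbb C^N$, and let $T'_\alpha$ be the space of constant vector fields orthogonal to $T_\alpha$. A *quiver* $\mathcal V$ of $\Gamma$ consists of finite dimensional complex vector spaces $V_\alpha$ and linear maps $A_{\alpha,\beta}:V_\beta\to V_\alpha$ ($\alpha,\beta\in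 I(\Gamma)$) such that (a) $A_{\alpha,\beta}=0$ if $\alpha,\beta$ are not adjacent; (b) $\sum_\beta A_{\alpha,\beta}A_{\beta,\gamma}=0$ if $|l(\alpha)-l(\gamma)|=2$; (c) $\sum_\beta A_{\alpha,\beta}A_{\beta,\gamma}=0$ if $l(\alpha)=l(\gamma)$, $\alpha\ne\gamma$ and there is $\delta$ with $\alpha\succ\delta$, $\gamma\succ\delta$. An *edge framing* is a choice, for every $\alpha\succ\beta$, of $f_{\beta,\alpha}\in F_\beta\setminus F_\alpha$ and $\xi_{\alpha,\beta}\in T_\alpha\setminus T_\beta$. It determines isomorphisms $\pi_{\beta,\alpha}:\overline\Omega_\alpha\to\overline\Omega_\beta$ for adjacent $\alpha,\beta$: $\pi_{\beta,\alpha}(\omega_\alpha)=\omega_\beta$ iff $df_{\beta,\alpha}\wedge\omega_\beta=\omega_\alpha$ when $\alpha\succ\beta$, and iff $(i_{\xi_{\beta,\alpha}}\omega_\beta)|_{T_\alpha}=\omega_\alpha$ when $\beta\succ\alpha$. Let $D_X$ be the ring of algebraic differential operators on $X$, and $D_X^k$ the operators of order at most $k$ ($D^k_X=0$ for $k<0$).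 Since $X$ is affine, we identify a quasi-coherent sheaf on $X$ with its module of global sections. The *quiver $D$-module* $E\mathcal V$ is the quotient of the free $D_X$-module $D_X\otimes_{\mathbb C}\bigoplus_\alpha\overline\Omega_\alpha\otimes V_\alpha$ by the submodule generated by $$u\xi\otimes\omega_\alpha\otimes v_\alpha-\sum_{\beta:\ \alpha\succ\beta}\langle\xi,f_{\beta,\alpha}\rangle\,u\otimes\pi_{\beta,\alpha}(\omega_\alpha)\otimes A_{\beta,\alpha}v_\alpha\qquad(\xi\in T_\alpha),$$ $$uf\otimes\omega_\alpha\otimes v_\alpha-\sum_{\beta:\ \beta\succ\alpha}\langle\xi_{\beta,\alpha},f\rangle\,u\otimes\pi_{\beta,\alpha}(\omega_\alpha)\otimes A_{\beta,\alpha}v_\alpha\qquad(f\in F_\alpha),$$ where $u\in D_X$, $\omega_\alpha\in\overline\Omega_\alpha$, $v_\alpha\in V_\alpha$ and $\langle\xi,f\rangle=i_\xi(df)$. Let $\overline V_k\subset E\mathcal V$ be the image of $\bigoplus_{l(\alpha)=k}\overline\Omega_\alpha\otimes V_\alpha$. The *principal filtration* is $F_p^mE\mathcal V=\sum_{k=0}^N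 D_X^{m-k}\,\overline V_k$, $m\in\mathbb Z$. An increasing, exhaustive filtration $(M^m)_{m\in\mathbb Z}$ of a $D_X$-module $M$ by $\mathcal O_X$-submodules, with $M^m=0$ for $m\ll0$, is *good* if $D_X^kM^l\subset M^{k+l}$ for all $k,l$; there is $l_0$ with $D_X^kM^l=M^{k+l}$ for all $l\ge l_0$, $k\ge0$; and every $M^m$ is a finitely generated $\mathcal O_X$-module. The characteristic variety of $M$, with respect to a good filtration, is the zero set in $T^*X$ of the annihilator of $\bigoplus_m M^m/M^{m-1}$ in $\operatorname{gr}D_X\simeq\mathbb C[T^*X]$. The module $M$ is *holonomic* if it is coherent and its characteristic variety (for every good filtration) is Lagrangian, i.e. involutive with all irreducible components of dimension $N$. It is *smooth along the stratification* $\{X_\alpha\}$ if it is holonomic and its characteristic variety (for every good filtration) is contained in $\bigcup_\alpha T^*_{X_\alpha}X$, the union of the conormal bundles of the strata. **Proposition.** For every arrangement, edge framing, quiver $\mathcal V$ and non-degenerate bilinear form as above: (i) The principal filtration of $E\mathcal V$ is good. (ii) The associated graded module $\bigoplus_m F_p^mE\mathcal V/F_p^{m-1}E\mathcal V$ is isomorphic,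 as an $\mathcal O_X$-module, to $$\bigoplus_{\alpha\in I(\Gamma)}\mathcal O_{\overline X_\alpha}\otimes_{\mathbb C}\bigl(S(T'_\alpha)\otimes_{\mathbb C}\overline\Omega_\alpha\otimes_{\mathbb C}V_\alpha\bigr),$$ where $S$ denotes the symmetric algebra. (iii) $E\mathcal V$ is holonomic and smooth along the stratification $\{X_\alpha\}$. -/

import Mathlib

open scoped TensorProduct DirectSum

noncomputable section

namespace QuiverDMod

/-! ## Differential operators on affine space -/

/-- The ring `𝒪(X)` of regular functions on `X = ℂ^N`. -/
abbrev OX (N : ℕ) : Type := MvPolynomial (Fin N) ℂ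

/-- The ring `D_X` of algebraic differential operators on `X = ℂ^N`: the algebra of
endomorphisms of `𝒪(X)` generated by the multiplications and the partial derivatives. -/
def weyl (N : ℕ) : Subalgebra ℂ (Module.End ℂ (OX N)) :=
  Algebra.adjoin ℂ
    (Set.range (fun p : OX N => LinearMap.mulLeft ℂ p) ∪
      Set.range (fun i : Fin N => (MvPolynomial.pderiv (R := ℂ) i).toLinearMap))

/-- `D_X` as a type. -/
def DX (N : ℕ) : Type := weyl N

instance (N : ℕ) : Ring (DX N) := inferInstanceAs (Ring (weyl N))

instance (N : ℕ) : Algebra ℂ (DX N) := inferInstanceAs (Algebra ℂ (weyl N))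

/-- The action of a differential operator on regular functions. -/
def toEnd (N : ℕ) : DX N →ₐ[ℂ] Module.End ℂ (OX N) := (weyl N).val

lemma toEnd_injective (N : ℕ) : Function.Injective (toEnd N) := Subtype.val_injective

/-- The inclusion `𝒪(X) → D_X`. -/
def mulOp (N : ℕ) : OX N →+* DX N where
  toFun p := (⟨LinearMap.mulLeft ℂ p, Algebra.subset_adjoin (Or.inl ⟨p, rfl⟩)⟩ : weyl N)
  map_one' := toEnd_injective N (LinearMap.ext fun x => one_mul x)
  map_mul' p q := toEnd_injective N (LinearMap.ext fun x => mul_assoc p q x)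
  map_zero' := toEnd_injective N (LinearMap.ext fun x => zero_mul x)
  map_add' p q := toEnd_injective N (LinearMap.ext fun x => add_mul p q x)

/-- The partial derivative `∂/∂z_i` as an element of `D_X`. -/
def partialOp {N : ℕ} (i : Fin N) : DX N :=
  (⟨(MvPolynomial.pderiv (R := ℂ) i).toLinearMap, Algebra.subset_adjoin (Or.inr ⟨i, rfl⟩)⟩ : weyl N)

lemma toEnd_mulOp {N : ℕ} (p x : OX N) : toEnd N (mulOp N p) x = p * x := rfl

lemma toEnd_partialOp {N : ℕ} (i : Fin N) (x : OX N) :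
    toEnd N (partialOp i) x = MvPolynomial.pderiv i x := rfl

/-- `D_X` is an `𝒪(X)`-module by left multiplication. -/
instance instModulePolyDX (N : ℕ) : Module (OX N) (DX N) := Module.compHom (DX N) (mulOp N)

lemma poly_smul_def {N : ℕ} (p : OX N) (P : DX N) : p • P = mulOp N p * P := rfl

instance (N : ℕ) : IsScalarTower (OX N) (DX N) (DX N) where
  smul_assoc p P Q := by simp [poly_smul_def, mul_assoc]

instance (N : ℕ) : SMulCommClass (OX N) ℂ (DX N) where
  smul_comm p c P := by simp [poly_smul_def]

instance (N : ℕ) : SMulCommClass ℂ (OX N) (DX N) := SMulCommClass.symm _ _ _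

lemma mulOp_smul {N : ℕ} {M : Type*} [AddCommGroup M] [Module (DX N) M] [Module (OX N) M]
    [IsScalarTower (OX N) (DX N) M] (p : OX N) (u : M) : mulOp N p • u = p • u := by
  have := smul_assoc p (1 : DX N) u
  rwa [poly_smul_def, mul_one, one_smul] at this

/-- `∂_i f = f ∂_i + ∂f/∂z_i` in `D_X`. -/
lemma partialOp_mul_mulOp {N : ℕ} (i : Fin N) (p : OX N) :
    partialOp i * mulOp N p = mulOp N p * partialOp i + mulOp N (MvPolynomial.pderiv i p) := by
  refine toEnd_injective N (LinearMap.ext fun x => ?_)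
  simp [toEnd_mulOp, toEnd_partialOp, mul_comm]

lemma partialOp_comm {N : ℕ} (i j : Fin N) :
    partialOp i * partialOp j = partialOp j * partialOp i := by
  have h : ∀ x : OX N, MvPolynomial.pderiv i (MvPolynomial.pderiv j x)
      = MvPolynomial.pderiv j (MvPolynomial.pderiv i x) := by
    have : ⁅MvPolynomial.pderiv (R := ℂ) i, MvPolynomial.pderiv (R := ℂ) j⁆ = 0 := by
      apply MvPolynomial.derivation_ext
      intro k
      simp [Derivation.commutator_apply, MvPolynomial.pderiv_X, Pi.single_apply, apply_ite]
    intro x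
    have h2 := congrArg (fun d => d x) this
    simpa [Derivation.commutator_apply, sub_eq_zero] using h2
  refine toEnd_injective N (LinearMap.ext fun x => ?_)
  simpa [toEnd_partialOp] using h x

/-- The `𝒪(X)`-submodule `D_X^k` of operators of order at most `k`, i.e. of the
`𝒪(X)`-combinations of products of at most `k` partial derivatives; it is `0` for `k < 0`. -/
def ordLE (N : ℕ) (k : ℤ) : Submodule (OX N) (DX N) :=
  Submodule.span (OX N)
    {P | ∃ w : List (Fin N), (w.length : ℤ) ≤ k ∧ P = (w.map partialOp).prod}

lemma partialOp_mem {N : ℕ} (i : Fin N) : partialOp i ∈ ordLE N 1 :=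
  Submodule.subset_span ⟨[i], by simp⟩

/-! ## Good filtrations, associated graded modules, characteristic varieties -/

section Filtrations

variable {N : ℕ} {M : Type*} [AddCommGroup M] [Module (DX N) M] [Module (OX N) M]

/-- The increasing filtration `F` of the `D_X`-module `M` is good. As usual, filtrations are
exhaustive and vanish in sufficiently negative degrees. -/
structure IsGoodFiltration (F : ℤ → Submodule (OX N) M) : Prop where
  mono : Monotone F
  eventually_zero : ∃ m₀ : ℤ, ∀ m ≤ m₀, F m = ⊥
  exhaustive : ∀ u : M, ∃ m, u ∈ F m
  smul_mem : ∀ (k l : ℤ) (P : DX N) (u : M), P ∈ ordLE N k → u ∈ F l → P • u ∈ F (k + l)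
  stable : ∃ l₀ : ℤ, ∀ l ≥ l₀, ∀ k ≥ (0 : ℤ),
    F (k + l) = Submodule.span (OX N) {x | ∃ P ∈ ordLE N k, ∃ u ∈ F l, x = P • u}
  fg : ∀ m, (F m).FG

/-- `F^m / F^{m-1}`. -/
abbrev GrPiece (F : ℤ → Submodule (OX N) M) (m : ℤ) : Type _ :=
  F m ⧸ (F (m - 1)).submoduleOf (F m)

/-- The associated graded module `⊕_m F^m / F^{m-1}`, as an `𝒪(X)`-module. -/
abbrev Gr (F : ℤ → Submodule (OX N) M) : Type _ := ⨁ m : ℤ, GrPiece F m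

variable {F : ℤ → Submodule (OX N) M}

lemma IsGoodFiltration.partial_mem (hF : IsGoodFiltration F) (i : Fin N) {m : ℤ} {u : M}
    (hu : u ∈ F m) : partialOp i • u ∈ F (m + 1) := by
  rw [add_comm]
  exact hF.smul_mem 1 m _ u (partialOp_mem i) hu

variable [IsScalarTower (OX N) (DX N) M]

/-- The map `F^m → F^{m+1} / F^m`, `u ↦ [∂_i u]`. -/
def symbolPre (hF : IsGoodFiltration F) (i : Fin N) (m : ℤ) : F m →ₗ[OX N] GrPiece F (m + 1) where
  toFun u := Submodule.Quotient.mk ⟨partialOp i • (u : M), hF.partial_mem i u.2⟩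
  map_add' u v := by
    rw [← Submodule.Quotient.mk_add]
    congr 1
    ext
    simp
  map_smul' p u := by
    rw [RingHom.id_apply, ← Submodule.Quotient.mk_smul, Submodule.Quotient.eq]
    have h : partialOp i • (p • (u : M)) - p • (partialOp i • (u : M))
        = MvPolynomial.pderiv i p • (u : M) := by
      rw [← mulOp_smul p (u : M), ← mulOp_smul p (partialOp i • (u : M)), ← mul_smul, ← mul_smul,
        partialOp_mul_mulOp, add_smul, add_sub_cancel_left, mulOp_smul]
    change partialOp i • (p • (u : M)) - p • (partialOp i • (u : M)) ∈ F (m + 1 - 1)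
    rw [h, add_sub_cancel_right]
    exact (F m).smul_mem _ u.2

/-- The map `F^m / F^{m-1} → F^{m+1} / F^m` induced by `∂_i`. -/
def symbolPiece (hF : IsGoodFiltration F) (i : Fin N) (m : ℤ) :
    GrPiece F m →ₗ[OX N] GrPiece F (m + 1) :=
  Submodule.liftQ _ (symbolPre hF i m) (by
    intro u hu
    rw [LinearMap.mem_ker]
    refine (Submodule.Quotient.mk_eq_zero _).2 ?_
    change partialOp i • (u : M) ∈ F (m + 1 - 1)
    have h := hF.partial_mem i (show (u : M) ∈ F (m - 1) from hu)
    rwa [show m + 1 - 1 = m - 1 + 1 by ring])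

/-- The action on the associated graded module of the class of `∂_i` in `D_X^1 / D_X^0`. -/
def symbolOp (hF : IsGoodFiltration F) (i : Fin N) : Module.End (OX N) (Gr F) :=
  DirectSum.toModule (OX N) ℤ (Gr F)
    (fun m => (DirectSum.lof (OX N) ℤ (GrPiece F) (m + 1)).comp (symbolPiece hF i m))

lemma symbolOp_lof (hF : IsGoodFiltration F) (i : Fin N) (m : ℤ) (u : F m) :
    symbolOp hF i (DirectSum.lof (OX N) ℤ (GrPiece F) m (Submodule.Quotient.mk u))
      = DirectSum.lof (OX N) ℤ (GrPiece F) (m + 1)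
          (Submodule.Quotient.mk ⟨partialOp i • (u : M), hF.partial_mem i u.2⟩) := by
  rw [symbolOp, DirectSum.toModule_lof]
  rfl

lemma symbolOp_comm (hF : IsGoodFiltration F) (i j : Fin N) :
    symbolOp hF i * symbolOp hF j = symbolOp hF j * symbolOp hF i := by
  refine DirectSum.linearMap_ext _ fun m => LinearMap.ext fun u => ?_
  obtain ⟨u, rfl⟩ := Submodule.Quotient.mk_surjective _ u
  simp only [LinearMap.comp_apply, Module.End.mul_apply, symbolOp_lof]
  have h : partialOp i • partialOp j • (u : M) = partialOp j • partialOp i • (u : M) := by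
    rw [← mul_smul, ← mul_smul, partialOp_comm i j]
  simp only [h]

/-- The subalgebra of endomorphisms of the associated graded module generated over `𝒪(X)` by the
classes of the `∂_i`. -/
abbrev symbolAlg (hF : IsGoodFiltration F) : Subalgebra (OX N) (Module.End (OX N) (Gr F)) :=
  Algebra.adjoin (OX N) (Set.range (symbolOp hF))

instance (hF : IsGoodFiltration F) : IsMulCommutative (symbolAlg hF) :=
  Algebra.isMulCommutative_adjoin (OX N) (by
    rintro _ ⟨i, rfl⟩ _ ⟨j, rfl⟩
    exact symbolOp_comm hF i j)

open scoped IsMulCommutative in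
/-- The action of `𝒪(X)[ξ_1, …, ξ_N] ≅ gr D_X` on the associated graded module, with `ξ_i` acting
as the class of `∂_i`. -/
def symbolAction (hF : IsGoodFiltration F) :
    MvPolynomial (Fin N) (OX N) →ₐ[OX N] Module.End (OX N) (Gr F) :=
  (symbolAlg hF).val.comp
    (MvPolynomial.aeval fun i =>
      (⟨symbolOp hF i, Algebra.subset_adjoin ⟨i, rfl⟩⟩ : symbolAlg hF))

end Filtrations

/-- The ring `ℂ[T^*X]` of polynomial functions on the cotangent bundle of `X = ℂ^N`; the variable
`Sum.inl i` is the coordinate `x_i` of the base, `Sum.inr i` the coordinate `ξ_i` of the fibre. -/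
abbrev CotPoly (N : ℕ) : Type := MvPolynomial (Fin N ⊕ Fin N) ℂ

/-- The cotangent bundle `T^*X = X × X^*` in the coordinates `(x, ξ)`. -/
abbrev Cot (N : ℕ) : Type := Fin N ⊕ Fin N → ℂ

/-- The identification `ℂ[T^*X] = 𝒪(X)[ξ_1, …, ξ_N]`. -/
def cotHom (N : ℕ) : CotPoly N →ₐ[ℂ] MvPolynomial (Fin N) (OX N) :=
  MvPolynomial.aeval
    (Sum.elim (fun i => MvPolynomial.C (MvPolynomial.X i)) (fun i => MvPolynomial.X i))

/-- The annihilator in `ℂ[T^*X] ≅ gr D_X` of the associated graded module of a good filtration. -/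
def charIdeal {N : ℕ} {M : Type*} [AddCommGroup M] [Module (DX N) M] [Module (OX N) M]
    [IsScalarTower (OX N) (DX N) M] {F : ℤ → Submodule (OX N) M} (hF : IsGoodFiltration F) :
    Ideal (CotPoly N) :=
  (RingHom.ker (symbolAction hF)).comap (cotHom N)

/-- The characteristic variety (singular support), computed by a good filtration. -/
def charVariety {N : ℕ} {M : Type*} [AddCommGroup M] [Module (DX N) M] [Module (OX N) M]
    [IsScalarTower (OX N) (DX N) M] {F : ℤ → Submodule (OX N) M} (hF : IsGoodFiltration F) :
    Set (Cot N) :=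
  MvPolynomial.zeroLocus ℂ (charIdeal hF)

/-- The Poisson bracket of polynomial functions on `T^*X`. -/
def poisson {N : ℕ} (p q : CotPoly N) : CotPoly N :=
  ∑ i : Fin N,
    (MvPolynomial.pderiv (Sum.inr i) p * MvPolynomial.pderiv (Sum.inl i) q -
      MvPolynomial.pderiv (Sum.inl i) p * MvPolynomial.pderiv (Sum.inr i) q)

/-- `Z ⊆ T^*X` is a Lagrangian subvariety: it is Zariski closed, involutive (its ideal is closed
under the Poisson bracket), and all its irreducible components have dimension `N`. -/
structure IsLagrangian {N : ℕ} (Z : Set (Cot N)) : Prop where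
  isClosed : MvPolynomial.zeroLocus ℂ (MvPolynomial.vanishingIdeal ℂ Z) = Z
  involutive : ∀ p ∈ MvPolynomial.vanishingIdeal ℂ Z, ∀ q ∈ MvPolynomial.vanishingIdeal ℂ Z,
    poisson p q ∈ MvPolynomial.vanishingIdeal ℂ Z
  dim : ∀ I ∈ (MvPolynomial.vanishingIdeal ℂ Z).minimalPrimes, ringKrullDim (CotPoly N ⧸ I) = N

/-- A holonomic `D_X`-module: it is coherent, and its characteristic variety (computed by any good
filtration) is Lagrangian. -/
structure IsHolonomic (N : ℕ) (M : Type*) [AddCommGroup M] [Module (DX N) M] [Module (OX N) M]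
    [IsScalarTower (OX N) (DX N) M] : Prop where
  coherent : Module.FinitePresentation (DX N) M
  lagrangian : ∀ (F : ℤ → Submodule (OX N) M) (hF : IsGoodFiltration F),
    IsLagrangian (charVariety hF)

/-! ## Arrangements and their strata -/

/-- A finite arrangement of hyperplanes in the affine space `X = ℂ^N`. -/
structure Arrangement (N : ℕ) where
  hyperplanes : Set (AffineSubspace ℂ (Fin N → ℂ))
  finite : hyperplanes.Finite
  isHyperplane : ∀ H ∈ hyperplanes,
    (H : Set (Fin N → ℂ)).Nonempty ∧ Module.finrank ℂ H.direction + 1 = N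

namespace Arrangement

variable {N : ℕ} (𝒜 : Arrangement N)

/-- The set `I(Γ)` of vertices. A vertex `α` is given by the closure `X̄_α` of its stratum, which
is a nonempty intersection of hyperplanes; the empty intersection is `X`. -/
def Vertex : Type :=
  {L : AffineSubspace ℂ (Fin N → ℂ) //
    (L : Set (Fin N → ℂ)).Nonempty ∧ ∃ S ⊆ 𝒜.hyperplanes, L = sInf S}

instance : Finite 𝒜.Vertex := by
  have h : {L : AffineSubspace ℂ (Fin N → ℂ) |
      (L : Set (Fin N → ℂ)).Nonempty ∧ ∃ S ⊆ 𝒜.hyperplanes, L = sInf S}.Finite := by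
    refine (𝒜.finite.finite_subsets.image sInf).subset ?_
    rintro L ⟨_, S, hS, rfl⟩
    exact ⟨S, hS, rfl⟩
  exact h.to_subtype

instance : Fintype 𝒜.Vertex := Fintype.ofFinite _

instance : DecidableEq 𝒜.Vertex := Classical.decEq _

instance (p : 𝒜.Vertex → Prop) : Fintype {α : 𝒜.Vertex // p α} := Fintype.ofFinite _

variable {𝒜}

namespace Vertex

/-- The closed stratum `X̄_α`. -/
def closedStratum (α : 𝒜.Vertex) : AffineSubspace ℂ (Fin N → ℂ) := α.1

/-- The stratum `X_α`: the complement in `X̄_α` of the smaller closed strata. -/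
def stratum (α : 𝒜.Vertex) : Set (Fin N → ℂ) :=
  (α.closedStratum : Set (Fin N → ℂ)) \
    ⋃ β : {β : 𝒜.Vertex // β.closedStratum < α.closedStratum},
      (β.1.closedStratum : Set (Fin N → ℂ))

/-- The space `T_α` of constant vector fields parallel to `X_α`. -/
def T (α : 𝒜.Vertex) : Submodule ℂ (Fin N → ℂ) := α.closedStratum.direction

/-- The codimension `l(α)` of `X_α`. -/
def l (α : 𝒜.Vertex) : ℕ := Module.finrank ℂ ((Fin N → ℂ) ⧸ α.T)

/-- `f ∈ F_α`: the affine function `f` vanishes on `X_α` (equivalently on its closure). -/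
def MemF (α : 𝒜.Vertex) (f : (Fin N → ℂ) →ᵃ[ℂ] ℂ) : Prop := ∀ x ∈ α.closedStratum, f x = 0

/-- `α ≻ β`: `X̄_β ⊂ X̄_α` has codimension one. -/
def Covers (α β : 𝒜.Vertex) : Prop := β.closedStratum ≤ α.closedStratum ∧ β.l = α.l + 1

/-- `α` and `β` are adjacent in the graph of the arrangement. -/
def Adj (α β : 𝒜.Vertex) : Prop := α.Covers β ∨ β.Covers α

/-- The conormal bundle `T^*_{X_α} X` of the stratum `X_α`. -/
def conormal (α : 𝒜.Vertex) : Set (Cot N) :=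
  {z | (fun i => z (Sum.inl i)) ∈ α.stratum ∧ ∀ v ∈ α.T, ∑ i, z (Sum.inr i) * v i = 0}

/-- The ideal of `𝒪(X)` of functions vanishing on `X̄_α`. -/
def ideal (α : 𝒜.Vertex) : Ideal (OX N) :=
  MvPolynomial.vanishingIdeal ℂ (α.closedStratum : Set (Fin N → ℂ))

end Vertex

variable (𝒜)

/-- A quiver of the graph of the arrangement; `A α β` is `A_{α,β} : V_β → V_α`. -/
structure Quiver where
  V : 𝒜.Vertex → Type*
  [addCommGroup : ∀ α, AddCommGroup (V α)]
  [module : ∀ α, Module ℂ (V α)]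
  [finiteDimensional : ∀ α, FiniteDimensional ℂ (V α)]
  A : ∀ α β : 𝒜.Vertex, V β →ₗ[ℂ] V α
  zero_of_not_adj : ∀ α β, ¬ α.Adj β → A α β = 0
  sum_eq_zero_of_two : ∀ α γ : 𝒜.Vertex, |(α.l : ℤ) - (γ.l : ℤ)| = 2 →
    ∑ β, (A α β).comp (A β γ) = 0
  sum_eq_zero_of_same : ∀ α γ : 𝒜.Vertex, α.l = γ.l → α ≠ γ →
    (∃ δ : 𝒜.Vertex, α.Covers δ ∧ γ.Covers δ) → ∑ β, (A α β).comp (A β γ) = 0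

attribute [instance] Quiver.addCommGroup Quiver.module Quiver.finiteDimensional

/-- An edge framing: for every edge `α ≻ β` a function `f_{β,α} ∈ F_β ∖ F_α` and a vector field
`ξ_{α,β} ∈ T_α ∖ T_β`. -/
structure EdgeFraming where
  f : ∀ {α β : 𝒜.Vertex}, α.Covers β → ((Fin N → ℂ) →ᵃ[ℂ] ℂ)
  ξ : ∀ {α β : 𝒜.Vertex}, α.Covers β → (Fin N → ℂ)
  f_mem : ∀ {α β : 𝒜.Vertex} (h : α.Covers β), β.MemF (f h)
  f_notMem : ∀ {α β : 𝒜.Vertex} (h : α.Covers β), ¬ α.MemF (f h)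
  ξ_mem : ∀ {α β : 𝒜.Vertex} (h : α.Covers β), ξ h ∈ α.T
  ξ_notMem : ∀ {α β : 𝒜.Vertex} (h : α.Covers β), ξ h ∉ β.T

end Arrangement

/-! ## Constant top forms -/

section Forms

variable {E : Type*} [AddCommGroup E] [Module ℂ E]

/-- The top exterior forms on a vector space `W`. -/
abbrev TopForm (W : Submodule ℂ E) : Type _ := W [⋀^Fin (Module.finrank ℂ W)]→ₗ[ℂ] ℂ

variable {W W' : Submodule ℂ E}

/-- For `W' ⊆ W` of codimension one and `ξ ∈ W`: the contraction of a top form on `W` with `ξ`,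
`(i_ξ ω)(v_1, v_2, …) = ω(ξ, v_1, v_2, …)`, restricted to `W'`. -/
def contract (hle : W' ≤ W) (hd : Module.finrank ℂ W = Module.finrank ℂ W' + 1) (ξ : W) :
    TopForm W →ₗ[ℂ] TopForm W' where
  toFun ω := ((ω.domDomCongr (finCongr hd)).curryLeft ξ).compLinearMap (Submodule.inclusion hle)
  map_add' _ _ := by ext; simp
  map_smul' _ _ := by ext; simp

/-- A linear retraction of `W` onto `W'`. -/
def retraction (hle : W' ≤ W) : W →ₗ[ℂ] W' :=
  (LinearMap.exists_leftInverse_of_injective (Submodule.inclusion hle)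
    (LinearMap.ker_eq_bot.2 (Submodule.inclusion_injective hle))).choose

lemma retraction_inclusion (hle : W' ≤ W) (w : W') :
    retraction hle (Submodule.inclusion hle w) = w :=
  LinearMap.congr_fun (LinearMap.exists_leftInverse_of_injective (Submodule.inclusion hle)
    (LinearMap.ker_eq_bot.2 (Submodule.inclusion_injective hle))).choose_spec w

/-- For `W' ⊆ W` of codimension one and a linear form `φ` on `W` vanishing on `W'`: the exterior
product `φ ∧ ω` of `φ` with (any extension to `W` of) a top form `ω` on `W'`,
`(φ ∧ ω)(v_0, …, v_n) = ∑_i (-1)^i φ(v_i) ω(v_0, …, v̂_i, …, v_n)`. -/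
def wedge (hle : W' ≤ W) (hd : Module.finrank ℂ W = Module.finrank ℂ W' + 1) (φ : W →ₗ[ℂ] ℂ) :
    TopForm W' →ₗ[ℂ] TopForm W where
  toFun ω := (AlternatingMap.alternatizeUncurryFin
    (φ.smulRight (ω.compLinearMap (retraction hle)))).domDomCongr (finCongr hd.symm)
  map_add' _ _ := by
    ext
    simp [AlternatingMap.alternatizeUncurryFin_apply, Finset.sum_add_distrib]
  map_smul' _ _ := by
    ext
    simp [AlternatingMap.alternatizeUncurryFin_apply, mul_left_comm, Finset.mul_sum]

lemma contract_injective [FiniteDimensional ℂ E] (hle : W' ≤ W) (hd : Module.finrank ℂ W = Module.finrank ℂ W' + 1)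
    (ξ : W) (hξ : (ξ : E) ∉ W') : Function.Injective (contract hle hd ξ) := by
  rw [← LinearMap.ker_eq_bot, LinearMap.ker_eq_bot']
  intro ω hω
  let b := Module.finBasis ℂ W'
  let v : Fin (Module.finrank ℂ W' + 1) → W :=
    Matrix.vecCons ξ (fun i => Submodule.inclusion hle (b i))
  have hv : LinearIndependent ℂ v := by
    refine LinearIndependent.finCons ?_ ?_
    · exact b.linearIndependent.map' _
        (LinearMap.ker_eq_bot.2 (Submodule.inclusion_injective hle))
    · intro hmem
      apply hξ
      have h2 : Submodule.span ℂ (Set.range fun i => Submodule.inclusion hle (b i))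
          ≤ LinearMap.range (Submodule.inclusion hle) := by
        rw [Submodule.span_le]
        rintro _ ⟨i, rfl⟩
        exact ⟨b i, rfl⟩
      obtain ⟨w, hw⟩ := h2 hmem
      rw [← hw]
      exact w.2
  let e := basisOfLinearIndependentOfCardEqFinrank hv (by simp [hd])
  have he : ⇑e = v := coe_basisOfLinearIndependentOfCardEqFinrank _ _
  have h0 : (ω.domDomCongr (finCongr hd)) e = 0 := by
    rw [he]
    exact congrArg (fun η : TopForm W' => η b) hω
  rw [AlternatingMap.map_basis_eq_zero_iff] at h0
  ext x
  exact congrArg (fun η => η (fun i => x (finCongr hd.symm i))) h0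

lemma contract_wedge (hle : W' ≤ W) (hd : Module.finrank ℂ W = Module.finrank ℂ W' + 1)
    (ξ : W) (φ : W →ₗ[ℂ] ℂ) (hφ : ∀ w : W', φ (Submodule.inclusion hle w) = 0) (ω : TopForm W') :
    contract hle hd ξ (wedge hle hd φ ω) = φ ξ • ω := by
  ext x
  have h : (AlternatingMap.alternatizeUncurryFin (φ.smulRight (ω.compLinearMap (retraction hle))))
      (Matrix.vecCons ξ (fun i => Submodule.inclusion hle (x i))) = φ ξ * ω x := by
    rw [AlternatingMap.alternatizeUncurryFin_apply, Fin.sum_univ_succ]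
    simp [hφ, retraction_inclusion]
  exact h

lemma contract_bijective [FiniteDimensional ℂ E] (hle : W' ≤ W) (hd : Module.finrank ℂ W = Module.finrank ℂ W' + 1)
    (ξ : W) (hξ : (ξ : E) ∉ W') : Function.Bijective (contract hle hd ξ) := by
  refine ⟨contract_injective hle hd ξ hξ, fun ω => ?_⟩
  obtain ⟨g, hg, hg0⟩ := Submodule.exists_le_ker_of_notMem hξ
  refine ⟨wedge hle hd ((g ξ)⁻¹ • g.comp W.subtype) ω, ?_⟩
  rw [contract_wedge]
  · simp [hg]
  · intro w
    have : g (w : E) = 0 := hg0 w.2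
    simp [this]

lemma wedge_bijective [FiniteDimensional ℂ E] (hle : W' ≤ W) (hd : Module.finrank ℂ W = Module.finrank ℂ W' + 1)
    (φ : W →ₗ[ℂ] ℂ) (hφ : ∀ w : W', φ (Submodule.inclusion hle w) = 0) (hφ0 : φ ≠ 0) :
    Function.Bijective (wedge hle hd φ) := by
  obtain ⟨ξ, hξ⟩ : ∃ ξ, φ ξ ≠ 0 := by
    by_contra! h
    exact hφ0 (LinearMap.ext h)
  have hξ' : (ξ : E) ∉ W' := fun h => hξ (hφ ⟨ξ, h⟩)
  constructor
  · intro ω ω' h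
    have h2 := congrArg (contract hle hd ξ) h
    rw [contract_wedge hle hd ξ φ hφ, contract_wedge hle hd ξ φ hφ] at h2
    exact smul_right_injective _ hξ h2
  · intro η
    refine ⟨(φ ξ)⁻¹ • contract hle hd ξ η, contract_injective hle hd ξ hξ' ?_⟩
    rw [contract_wedge hle hd ξ φ hφ, smul_smul, mul_inv_cancel₀ hξ, one_smul]

end Forms

namespace Arrangement

variable {N : ℕ} {𝒜 : Arrangement N}

/-- The space `Ω̄_α` of translation invariant top forms on `X_α`. -/
abbrev Vertex.Omega (α : 𝒜.Vertex) : Type := TopForm α.T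

lemma Vertex.Covers.T_le {α β : 𝒜.Vertex} (h : α.Covers β) : β.T ≤ α.T :=
  AffineSubspace.direction_le h.1

lemma Vertex.Covers.finrank_eq {α β : 𝒜.Vertex} (h : α.Covers β) :
    Module.finrank ℂ α.T = Module.finrank ℂ β.T + 1 := by
  have h1 := Submodule.finrank_quotient_add_finrank α.T
  have h2 := Submodule.finrank_quotient_add_finrank β.T
  have h3 := h.2
  unfold Vertex.l at h3
  omega

/-- The differential `df`, as a linear form on `T_α`. -/
def dOn (α : 𝒜.Vertex) (f : (Fin N → ℂ) →ᵃ[ℂ] ℂ) : α.T →ₗ[ℂ] ℂ := f.linear.comp α.T.subtype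

lemma dOn_eq_zero {α β : 𝒜.Vertex} (h : α.Covers β) {f : (Fin N → ℂ) →ᵃ[ℂ] ℂ} (hf : β.MemF f)
    (w : β.T) : dOn α f (Submodule.inclusion h.T_le w) = 0 := by
  obtain ⟨x, hx⟩ := β.2.1
  have h1 : (w : Fin N → ℂ) +ᵥ x ∈ β.closedStratum :=
    AffineSubspace.vadd_mem_of_mem_direction w.2 hx
  have h2 := f.map_vadd x (w : Fin N → ℂ)
  rw [hf _ h1, hf _ hx] at h2
  simpa [dOn] using h2.symm

lemma dOn_ne_zero {α β : 𝒜.Vertex} (h : α.Covers β) {f : (Fin N → ℂ) →ᵃ[ℂ] ℂ} (hf : β.MemF f)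
    (hf' : ¬ α.MemF f) : dOn α f ≠ 0 := by
  intro h0
  apply hf'
  intro y hy
  obtain ⟨x, hx⟩ := β.2.1
  have hyx : y -ᵥ x ∈ α.T := AffineSubspace.vsub_mem_direction hy (h.1 hx)
  have h1 := LinearMap.congr_fun h0 ⟨y -ᵥ x, hyx⟩
  have h2 := f.linearMap_vsub y x
  rw [hf _ hx] at h2
  have h3 : f.linear (y -ᵥ x) = 0 := h1
  rw [h3] at h2
  simpa using h2.symm

namespace EdgeFraming

variable (Φ : 𝒜.EdgeFraming)

/-- For `α ≻ β` the map `π_{β,α} : Ω̄_α → Ω̄_β`, where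
`π_{β,α}(ω_α) = ω_β ↔ df_{β,α} ∧ ω_β = ω_α`. -/
def piDown {α β : 𝒜.Vertex} (h : α.Covers β) : α.Omega →ₗ[ℂ] β.Omega :=
  (LinearEquiv.ofBijective (wedge h.T_le h.finrank_eq (dOn α (Φ.f h)))
    (wedge_bijective _ _ _ (dOn_eq_zero h (Φ.f_mem h))
      (dOn_ne_zero h (Φ.f_mem h) (Φ.f_notMem h)))).symm.toLinearMap

/-- For `α ≻ β` the map `π_{α,β} : Ω̄_β → Ω̄_α`, where
`π_{α,β}(ω_β) = ω_α ↔ i_{ξ_{α,β}}(ω_α) = ω_β`. -/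
def piUp {α β : 𝒜.Vertex} (h : α.Covers β) : β.Omega →ₗ[ℂ] α.Omega :=
  (LinearEquiv.ofBijective (contract h.T_le h.finrank_eq ⟨Φ.ξ h, Φ.ξ_mem h⟩)
    (contract_bijective _ _ _ (Φ.ξ_notMem h))).symm.toLinearMap

lemma piDown_eq_iff {α β : 𝒜.Vertex} (h : α.Covers β) (ω : α.Omega) (ω' : β.Omega) :
    Φ.piDown h ω = ω' ↔ wedge h.T_le h.finrank_eq (dOn α (Φ.f h)) ω' = ω := by
  rw [piDown, LinearEquiv.coe_coe, LinearEquiv.symm_apply_eq, LinearEquiv.ofBijective_apply]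
  exact eq_comm

lemma piUp_eq_iff {α β : 𝒜.Vertex} (h : α.Covers β) (ω : β.Omega) (ω' : α.Omega) :
    Φ.piUp h ω = ω' ↔ contract h.T_le h.finrank_eq ⟨Φ.ξ h, Φ.ξ_mem h⟩ ω' = ω := by
  rw [piUp, LinearEquiv.coe_coe, LinearEquiv.symm_apply_eq, LinearEquiv.ofBijective_apply]
  exact eq_comm

end EdgeFraming

/-- An affine function as an element of `𝒪(X)`. -/
def affinePoly (f : (Fin N → ℂ) →ᵃ[ℂ] ℂ) : OX N :=
  MvPolynomial.C (f 0) + ∑ i, MvPolynomial.C (f.linear (Pi.single i 1)) * MvPolynomial.X i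

/-- The operator `∑ b_i ∂/∂z_i` of a constant vector field `b`. -/
def vectorField (b : Fin N → ℂ) : DX N := ∑ i, b i • partialOp i

/-! ## The quiver `D`-module -/

variable (Φ : 𝒜.EdgeFraming) (Q : 𝒜.Quiver)

/-- The space `⊕_α Ω̄_α ⊗ V_α` of generators. -/
def Generators : Type _ := ⨁ α : 𝒜.Vertex, α.Omega ⊗[ℂ] Q.V α

instance : AddCommGroup (Generators Q) :=
  inferInstanceAs (AddCommGroup (⨁ α : 𝒜.Vertex, α.Omega ⊗[ℂ] Q.V α))

instance : Module ℂ (Generators Q) :=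
  inferInstanceAs (Module ℂ (⨁ α : 𝒜.Vertex, α.Omega ⊗[ℂ] Q.V α))

/-- The inclusion of the summand `Ω̄_α ⊗ V_α`. -/
def incl (α : 𝒜.Vertex) : α.Omega ⊗[ℂ] Q.V α →ₗ[ℂ] Generators Q :=
  DirectSum.lof ℂ 𝒜.Vertex (fun α => α.Omega ⊗[ℂ] Q.V α) α

/-- The free `D_X`-module `R⁰E𝒱 = D_X ⊗ (⊕_α Ω̄_α ⊗ V_α)`. -/
abbrev FreeModule : Type _ := DX N ⊗[ℂ] Generators Q

/-- The element `u ⊗ ω ⊗ v` of the free module. -/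
def elt (u : DX N) (α : 𝒜.Vertex) (ω : α.Omega) (v : Q.V α) : FreeModule Q :=
  u ⊗ₜ[ℂ] incl Q α (ω ⊗ₜ[ℂ] v)

/-- The relations
`u ξ ⊗ ω_α ⊗ v_α - ∑_{β, α ≻ β} ⟨ξ, f_{β,α}⟩ u ⊗ π_{β,α}(ω_α) ⊗ A_{β,α}(v_α)`, `ξ ∈ T_α`. -/
def vectorRelations : Set (FreeModule Q) :=
  {x | ∃ (α : 𝒜.Vertex) (u : DX N) (ω : α.Omega) (v : Q.V α), ∃ ξ ∈ α.T,
    x = elt Q (u * vectorField ξ) α ω v -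
      ∑ β : {β : 𝒜.Vertex // α.Covers β},
        (Φ.f β.2).linear ξ • elt Q u β.1 (Φ.piDown β.2 ω) (Q.A β.1 α v)}

/-- The relations
`u f ⊗ ω_α ⊗ v_α - ∑_{β, β ≻ α} ⟨ξ_{β,α}, f⟩ u ⊗ π_{β,α}(ω_α) ⊗ A_{β,α}(v_α)`, `f ∈ F_α`. -/
def functionRelations : Set (FreeModule Q) :=
  {x | ∃ (α : 𝒜.Vertex) (u : DX N) (ω : α.Omega) (v : Q.V α) (f : (Fin N → ℂ) →ᵃ[ℂ] ℂ), α.MemF f ∧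
    x = elt Q (u * mulOp N (affinePoly f)) α ω v -
      ∑ β : {β : 𝒜.Vertex // β.Covers α},
        f.linear (Φ.ξ β.2) • elt Q u β.1 (Φ.piUp β.2 ω) (Q.A β.1 α v)}

/-- The submodule `R'E𝒱` of relations. -/
def relations : Submodule (DX N) (FreeModule Q) :=
  Submodule.span (DX N) (vectorRelations Φ Q ∪ functionRelations Φ Q)

/-- The quiver `D_X`-module `E𝒱`. -/
abbrev QuiverDModule : Type _ := FreeModule Q ⧸ relations Φ Q

/-- The subspace `V̄_k = ⊕_{l(α) = k} Ω̄_α ⊗ V_α` of `E𝒱`. -/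
def Vbar (k : ℕ) : Submodule ℂ (QuiverDModule Φ Q) :=
  Submodule.span ℂ
    {x | ∃ α : 𝒜.Vertex, α.l = k ∧ ∃ (ω : α.Omega) (v : Q.V α),
      x = Submodule.Quotient.mk (elt Q 1 α ω v)}

/-- The principal filtration `F_p^m E𝒱 = ∑_{k=0}^N D_X^{m-k} V̄_k`. -/
def principalFiltration (m : ℤ) : Submodule (OX N) (QuiverDModule Φ Q) :=
  ⨆ k ∈ Finset.range (N + 1), Submodule.span (OX N)
    {x | ∃ P ∈ ordLE N (m - (k : ℤ)), ∃ u ∈ Vbar Φ Q k, x = P • u}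

/-- For a bilinear form `B` on `ℂ^N`, the space `T'_α` of constant vector fields orthogonal
to `T_α`. -/
abbrev Vertex.T' (B : LinearMap.BilinForm ℂ (Fin N → ℂ)) (α : 𝒜.Vertex) :
    Submodule ℂ (Fin N → ℂ) :=
  B.orthogonal α.T

/-- A `D_X`-module is smooth along the stratification if it is holonomic and its characteristic
variety (computed by any good filtration) lies in the union of the conormal bundles of strata. -/
structure IsSmoothAlong (𝒜 : Arrangement N) (M : Type*) [AddCommGroup M] [Module (DX N) M]
    [Module (OX N) M] [IsScalarTower (OX N) (DX N) M] : Prop where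
  holonomic : IsHolonomic N M
  charVariety_subset : ∀ (F : ℤ → Submodule (OX N) M) (hF : IsGoodFiltration F),
    charVariety hF ⊆ ⋃ α : 𝒜.Vertex, α.conormal

end Arrangement

end QuiverDMod

end

open QuiverDMod Arrangement

/-!
For a vertex `α`, choose affine coordinates adapted to the flat `X̄_α`. They split the Weyl algebra
into canonical pairs, one member of each pair being an operator `b i`, which is either an affine
function vanishing on `X̄_α` or a constant vector field along it, and the other one its partner `a i`
(`Frame`). The `b i` commute with each other, and so do the `a i`. The relations of the quiver
`D`-module rewrite `b i` applied to a basis vector of `Ω̄_α ⊗ V_α` as a combination of generators one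
level down or up. Since `⟨ξ, f_{β,α}⟩ π_{β,α}(ω) = i_ξ ω` and `⟨ξ_{β,α}, f⟩ π_{β,α}(ω) = df ∧ ω`,
the edge framing drops out of the relations (`smul_piDown`, `smul_piUp`, `relations_eq`).

*Normal forms.* The relations are consistent: `b k` applied to the relation for `b i` agrees with `b i`
applied to the relation for `b k`, modulo other relations (`vectorField_consistency`,
`affine_consistency`, `mixed_consistency`). This is where the quiver axioms are used: along the paths
`α, β, γ` the form `ω` undergoes two contractions, two wedge products, or one of each, and the result
does not depend on `β`, so that the sum over `β` of the `A_{γ,β} A_{β,α}` comes out as a factor.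
Consistency gives a theorem of Poincaré–Birkhoff–Witt type (`pbw_injective`): every element is in
exactly one way a sum over the generators of polynomials in the `a i` applied to them
(`HasNormalForms`, `qGen_hasNormalForms`).

*The filtration.* Rewriting an operator into normal form does not raise the order, counted with the
level of the generator: absorbing a vector field lowers the order by one and raises the level by one,
while absorbing an affine function keeps the order and lowers the level.
Hence the principal filtration consists of the elements whose coefficients have bounded order
(`HasNormalForms.mem_levelFiltration_iff`), and it is good (`HasNormalForms.isGoodFiltration`). The
part represented, up to lower filtration, by generators of level at least `l` is treated along with
it, because on the associated graded module the symbols of the `b i` of a generator raise this level (`HasNormalForms.smul_mem_map_nf`,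
`HasNormalForms.cotAction_bSymbol`).

*The associated graded module.* The leading terms of a normal form are polynomials in the coordinates
along `X̄_α` and the derivatives transversal to it, that is, functions on the conormal bundle of
`X̄_α`. As a module over the functions on `X`, the graded module is the sum over the generators of free
modules over `𝒪(X̄_α)` with the monomials in the transversal derivatives as a basis (`totalMap`,
`grEquiv`). Its annihilator contains a power of each product
of symbols of `b i`, one for every generator, and restricts to zero on every
conormal bundle that carries a generator, so that the characteristic variety is the union of these
conormal bundles (`HasNormalForms.charVariety_eq`), which is Lagrangian
(`isLagrangian_iUnion_conormal`). It is the same for every good filtration (`charVariety_eq`), and it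
lies in the union of the conormal bundles of the strata because every flat is a union of strata
(`frame_conormal_subset`).
-/

set_option linter.unusedSectionVars false

noncomputable section

namespace QuiverDMod

/-! ### Evaluation of polynomials at commuting families -/

section CommAeval

variable {σ A : Type*} [Ring A] [Algebra ℂ A]

open scoped IsMulCommutative in
/-- The evaluation of polynomials at a family of commuting elements of a noncommutative algebra. -/
def commAeval (a : σ → A) (h : ∀ i j, a i * a j = a j * a i) : MvPolynomial σ ℂ →ₐ[ℂ] A :=
  haveI : IsMulCommutative (Algebra.adjoin ℂ (Set.range a)) :=
    Algebra.isMulCommutative_adjoin ℂ (by rintro _ ⟨i, rfl⟩ _ ⟨j, rfl⟩; exact h i j)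
  (Algebra.adjoin ℂ (Set.range a)).val.comp
    (MvPolynomial.aeval fun i =>
      (⟨a i, Algebra.subset_adjoin ⟨i, rfl⟩⟩ : Algebra.adjoin ℂ (Set.range a)))

@[simp] lemma commAeval_X (a : σ → A) (h : ∀ i j, a i * a j = a j * a i) (i : σ) :
    commAeval a h (MvPolynomial.X i) = a i := by
  simp [commAeval]

lemma commAeval_commute (a : σ → A) (h : ∀ i j, a i * a j = a j * a i) (i : σ)
    (p : MvPolynomial σ ℂ) : a i * commAeval a h p = commAeval a h p * a i := by
  rw [← commAeval_X a h i, ← map_mul, ← map_mul, mul_comm]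

variable [DecidableEq σ]

lemma commAeval_commutator (a : σ → A) (h : ∀ i j, a i * a j = a j * a i) (b : A) (i : σ) (c : ℂ)
    (hb : ∀ j, b * a j = a j * b + algebraMap ℂ A (Pi.single (M := fun _ => ℂ) i c j))
    (p : MvPolynomial σ ℂ) :
    b * commAeval a h p = commAeval a h p * b + c • commAeval a h (MvPolynomial.pderiv i p) := by
  induction p using MvPolynomial.induction_on with
  | C r =>
    have h1 : commAeval a h (MvPolynomial.C r) = algebraMap ℂ A r := (commAeval a h).commutes r
    simp [h1, Algebra.commutes]
  | add p q hp hq => simp only [map_add, mul_add, add_mul, hp, hq, smul_add]; abel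
  | mul_X p j hp =>
    rw [map_mul, ← mul_assoc, hp, add_mul, mul_assoc, commAeval_X, hb, mul_add, ← mul_assoc,
      Derivation.leibniz, map_add]
    simp only [smul_eq_mul, map_mul, commAeval_X, MvPolynomial.pderiv_X, smul_add]
    rw [add_assoc]
    congr 1
    rcases eq_or_ne i j with rfl | hij
    · simp only [Pi.single_eq_same, map_one, mul_one]
      rw [commAeval_commute a h i, smul_mul_assoc, ← Algebra.commutes, ← Algebra.smul_def]
    · have : (Pi.single (M := fun _ => ℂ) i c j) = 0 := Pi.single_eq_of_ne hij.symm _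
      have h2 : (Pi.single (M := fun _ => MvPolynomial σ ℂ) i 1 j) = 0 :=
        Pi.single_eq_of_ne hij.symm _
      rw [this, h2, commAeval_commute a h j]
      simp

end CommAeval

/-! ### Normal ordering -/

section NormalOrder

variable {σ A : Type*} [Ring A] [Algebra ℂ A]

open MvPolynomial

lemma sumFinsupp_symm_eq (u v : σ →₀ ℕ) : Finsupp.sumFinsuppEquivProdFinsupp.symm (u, v)
    = Finsupp.mapDomain Sum.inl u + Finsupp.mapDomain Sum.inr v := by
  refine Finsupp.ext fun i => ?_
  rcases i with i | i
  · simp [Finsupp.mapDomain_apply Sum.inl_injective, Finsupp.mapDomain_of_notMem_range]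
  · simp [Finsupp.mapDomain_apply Sum.inr_injective, Finsupp.mapDomain_of_notMem_range]

lemma sum_poly_induction {motive : MvPolynomial (σ ⊕ σ) ℂ → Prop}
    (add : ∀ p q, motive p → motive q → motive (p + q))
    (mul : ∀ p q, motive (rename Sum.inl p * rename Sum.inr q)) (p : MvPolynomial (σ ⊕ σ) ℂ) :
    motive p := by
  induction p using MvPolynomial.induction_on' with
  | add p q hp hq => exact add p q hp hq
  | monomial μ c =>
    obtain ⟨⟨u, v⟩, rfl⟩ := Finsupp.sumFinsuppEquivProdFinsupp.symm.surjective μ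
    have : monomial (Finsupp.sumFinsuppEquivProdFinsupp.symm (u, v)) c
        = rename Sum.inl (monomial u c) * rename Sum.inr (monomial v (1 : ℂ)) := by
      rw [rename_monomial, rename_monomial, monomial_mul, mul_one, sumFinsupp_symm_eq]
    rw [this]
    exact mul _ _

variable (a b : σ → A) (ha : ∀ i j, a i * a j = a j * a i) (hb : ∀ i j, b i * b j = b j * b i)

/-- The linear map `ℂ[x, y] → A` with `x^I y^J ↦ a^I b^J`, where the variables `x` and `y` are
indexed by the two copies of `σ`. -/
def normalOrder : MvPolynomial (σ ⊕ σ) ℂ →ₗ[ℂ] A :=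
  (basisMonomials (σ ⊕ σ) ℂ).constr ℂ fun μ =>
    commAeval a ha (monomial (Finsupp.sumFinsuppEquivProdFinsupp μ).1 1) *
      commAeval b hb (monomial (Finsupp.sumFinsuppEquivProdFinsupp μ).2 1)

lemma normalOrder_mul (p q : MvPolynomial σ ℂ) :
    normalOrder a b ha hb (rename Sum.inl p * rename Sum.inr q) =
      commAeval a ha p * commAeval b hb q := by
  induction p using MvPolynomial.induction_on' with
  | add p p' hp hp' => simp only [map_add, add_mul, hp, hp']
  | monomial u c =>
    induction q using MvPolynomial.induction_on' with
    | add q q' hq hq' => simp only [map_add, mul_add, hq, hq']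
    | monomial v d =>
      have h1 : rename Sum.inl (monomial u c) * rename Sum.inr (monomial v d)
          = (c * d) • basisMonomials (σ ⊕ σ) ℂ
              (Finsupp.sumFinsuppEquivProdFinsupp.symm (u, v)) := by
        rw [rename_monomial, rename_monomial, monomial_mul, coe_basisMonomials, smul_monomial,
          smul_eq_mul, mul_one, sumFinsupp_symm_eq]
      have h2 : monomial u c = c • monomial u (1 : ℂ) := by simp [smul_monomial]
      have h3 : monomial v d = d • monomial v (1 : ℂ) := by simp [smul_monomial]
      rw [h1, map_smul, normalOrder, Module.Basis.constr_basis, Equiv.apply_symm_apply, h2, h3,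
        map_smul, map_smul, smul_mul_smul_comm]

lemma normalOrder_left (p : MvPolynomial σ ℂ) :
    normalOrder a b ha hb (rename Sum.inl p) = commAeval a ha p := by
  simpa using normalOrder_mul a b ha hb p 1

lemma normalOrder_one : normalOrder a b ha hb 1 = 1 := by
  simpa using normalOrder_left a b ha hb 1

lemma normalOrder_X_inl_mul (i : σ) (p : MvPolynomial (σ ⊕ σ) ℂ) :
    normalOrder a b ha hb (X (Sum.inl i) * p) = a i * normalOrder a b ha hb p := by
  induction p using sum_poly_induction with
  | add p q hp hq => simp only [mul_add, map_add, hp, hq]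
  | mul p q =>
    have : X (Sum.inl i) * (rename Sum.inl p * rename Sum.inr q)
        = rename Sum.inl (X i * p) * rename Sum.inr q := by simp [mul_assoc]
    rw [this, normalOrder_mul, normalOrder_mul, map_mul, commAeval_X, mul_assoc]

lemma normalOrder_mul_X_inr (i : σ) (p : MvPolynomial (σ ⊕ σ) ℂ) :
    normalOrder a b ha hb (p * X (Sum.inr i)) = normalOrder a b ha hb p * b i := by
  induction p using sum_poly_induction with
  | add p q hp hq => simp only [add_mul, map_add, hp, hq]
  | mul p q =>
    have : rename Sum.inl p * rename Sum.inr q * X (Sum.inr i)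
        = rename Sum.inl p * rename Sum.inr (q * X i) := by simp [mul_assoc]
    rw [this, normalOrder_mul, normalOrder_mul, map_mul, commAeval_X, mul_assoc]

lemma pderiv_inl_mul (i : σ) (p q : MvPolynomial σ ℂ) :
    pderiv (Sum.inl i) (rename (Sum.inl : σ → σ ⊕ σ) p * rename (Sum.inr : σ → σ ⊕ σ) q)
      = rename Sum.inl (pderiv i p) * rename Sum.inr q := by
  classical
  have h : pderiv (Sum.inl i) (rename (Sum.inr : σ → σ ⊕ σ) q) = 0 := by
    apply pderiv_eq_zero_of_notMem_vars
    intro hm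
    have := vars_rename (Sum.inr : σ → σ ⊕ σ) q hm
    simp at this
  rw [Derivation.leibniz, h, pderiv_rename Sum.inl_injective]
  simp [mul_comm]

lemma pderiv_inr_mul (i : σ) (p q : MvPolynomial σ ℂ) :
    pderiv (Sum.inr i) (rename (Sum.inl : σ → σ ⊕ σ) p * rename (Sum.inr : σ → σ ⊕ σ) q)
      = rename Sum.inl p * rename Sum.inr (pderiv i q) := by
  classical
  have h : pderiv (Sum.inr i) (rename (Sum.inl : σ → σ ⊕ σ) p) = 0 := by
    apply pderiv_eq_zero_of_notMem_vars
    intro hm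
    have := vars_rename (Sum.inl : σ → σ ⊕ σ) p hm
    simp at this
  rw [Derivation.leibniz, h, pderiv_rename Sum.inr_injective]
  simp

lemma totalDegree_le_of_degree (p : MvPolynomial σ ℂ) (n : ℕ)
    (h : ∀ μ ∈ p.support, μ.degree ≤ n) : p.totalDegree ≤ n :=
  Finset.sup_le fun μ hμ => h μ hμ

lemma degree_le_totalDegree {p : MvPolynomial σ ℂ} {μ : σ →₀ ℕ} (h : coeff μ p ≠ 0) :
    μ.degree ≤ p.totalDegree :=
  le_totalDegree (mem_support_iff.2 h)

variable [DecidableEq σ] {a b}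

lemma mul_normalOrder (i : σ) (c : ℂ)
    (hab : ∀ j, b i * a j = a j * b i + algebraMap ℂ A (Pi.single (M := fun _ => ℂ) i c j))
    (p : MvPolynomial (σ ⊕ σ) ℂ) :
    b i * normalOrder a b ha hb p = normalOrder a b ha hb (X (Sum.inr i) * p) +
      c • normalOrder a b ha hb (pderiv (Sum.inl i) p) := by
  induction p using sum_poly_induction with
  | add p q hp hq => simp only [mul_add, map_add, hp, hq, smul_add]; abel
  | mul p q =>
    have : X (Sum.inr i) * (rename Sum.inl p * rename Sum.inr q)
        = rename (Sum.inl : σ → σ ⊕ σ) p * rename Sum.inr (X i * q) := by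
      simp only [map_mul, rename_X]; ring
    rw [this, pderiv_inl_mul, normalOrder_mul, normalOrder_mul, normalOrder_mul, map_mul,
      commAeval_X, ← mul_assoc, commAeval_commutator a ha (b i) i c hab, add_mul, mul_assoc,
      smul_mul_assoc]

lemma normalOrder_mul_a (i : σ) (c : ℂ)
    (hab : ∀ j, b j * a i = a i * b j + algebraMap ℂ A (Pi.single (M := fun _ => ℂ) i c j))
    (p : MvPolynomial (σ ⊕ σ) ℂ) :
    normalOrder a b ha hb p * a i = normalOrder a b ha hb (X (Sum.inl i) * p) +
      c • normalOrder a b ha hb (pderiv (Sum.inr i) p) := by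
  have hab' : ∀ j, a i * b j
      = b j * a i + algebraMap ℂ A (Pi.single (M := fun _ => ℂ) i (-c) j) := by
    intro j
    rw [hab j, add_assoc, ← map_add, ← Pi.add_apply, ← Pi.single_add]
    simp
  induction p using sum_poly_induction with
  | add p q hp hq => simp only [mul_add, add_mul, map_add, hp, hq, smul_add]; abel
  | mul p q =>
    have : X (Sum.inl i) * (rename Sum.inl p * rename Sum.inr q)
        = rename (Sum.inl : σ → σ ⊕ σ) (X i * p) * rename Sum.inr q := by
      simp only [map_mul, rename_X]; ring
    rw [this, pderiv_inr_mul, normalOrder_mul, normalOrder_mul, normalOrder_mul, map_mul,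
      commAeval_X, commAeval_commute a ha, mul_assoc, mul_assoc,
      commAeval_commutator b hb (a i) i (-c) hab', mul_add, mul_smul_comm, neg_smul,
      neg_add_cancel_right]

/-- Normally ordered monomials in two families satisfying the canonical commutation relations are
linearly independent: commutators act on them as derivatives, and iterated derivatives of a
nonzero polynomial reach a nonzero constant. -/
lemma normalOrder_injective [Nontrivial A] (c : σ → ℂ) (hc : ∀ i, c i ≠ 0)
    (hab : ∀ i j, b i * a j
      = a j * b i + algebraMap ℂ A (Pi.single (M := fun _ => ℂ) i (c i) j)) :
    Function.Injective (normalOrder a b ha hb) := by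
  rw [injective_iff_map_eq_zero]
  intro p hp
  have hD : ∀ (s : σ ⊕ σ) (p : MvPolynomial (σ ⊕ σ) ℂ), normalOrder a b ha hb p = 0 →
      normalOrder a b ha hb (pderiv s p) = 0 := by
    rintro (i | i) p hp
    · have h1 := mul_normalOrder ha hb i (c i) (hab i) p
      have h2 := normalOrder_mul_X_inr a b ha hb i p
      rw [hp, mul_comm p, zero_mul] at h2
      rw [hp, h2, mul_zero, zero_add] at h1
      exact (smul_eq_zero.1 h1.symm).resolve_left (hc i)
    · have h1 := normalOrder_mul_a ha hb i (c i) (fun j => by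
        rw [hab j i]
        rcases eq_or_ne i j with rfl | h
        · rfl
        · simp [Pi.single_eq_of_ne h, Pi.single_eq_of_ne h.symm]) p
      have h2 := normalOrder_X_inl_mul a b ha hb i p
      rw [hp, mul_zero] at h2
      rw [hp, h2, zero_mul, zero_add] at h1
      exact (smul_eq_zero.1 h1.symm).resolve_left (hc i)
  have main : ∀ (n : ℕ) (p : MvPolynomial (σ ⊕ σ) ℂ), p.totalDegree ≤ n →
      normalOrder a b ha hb p = 0 → p = 0 := by
    intro n
    induction n with
    | zero =>
      intro p hn h0
      rw [Nat.le_zero] at hn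
      rw [totalDegree_eq_zero_iff_eq_C] at hn
      rw [hn] at h0 ⊢
      have : normalOrder a b ha hb (C (coeff 0 p)) = coeff 0 p • (1 : A) := by
        rw [← normalOrder_one a b ha hb, ← map_smul, smul_eq_C_mul, mul_one]
      rw [this] at h0
      rw [(smul_eq_zero.1 h0).resolve_right one_ne_zero, map_zero]
    | succ n ih =>
      intro p hn h0
      have hz : ∀ s, pderiv s p = 0 := by
        intro s
        refine ih _ ?_ (hD s p h0)
        refine totalDegree_le_of_degree _ _ ?_
        intro μ hμ
        rw [mem_support_iff, coeff_pderiv] at hμ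
        have h1 : coeff (μ + Finsupp.single s 1) p ≠ 0 := left_ne_zero_of_mul hμ
        have h3 := (degree_le_totalDegree h1).trans hn
        rw [map_add, Finsupp.degree_single] at h3
        exact Nat.le_of_succ_le_succ h3
      refine ih p ?_ h0
      suffices p.totalDegree ≤ 0 by omega
      refine totalDegree_le_of_degree _ _ ?_
      intro μ hμ
      rw [mem_support_iff] at hμ
      suffices μ = 0 by subst this; simp
      by_contra hne
      obtain ⟨s, hs⟩ := Finsupp.ne_iff.1 hne
      have hs' : Finsupp.single s 1 ≤ μ := by
        rw [Finsupp.single_le_iff]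
        exact Nat.one_le_iff_ne_zero.2 hs
      have h1 := congrArg (coeff (μ - Finsupp.single s 1)) (hz s)
      rw [coeff_pderiv, tsub_add_cancel_of_le hs', coeff_zero] at h1
      rcases mul_eq_zero.1 h1 with h | h
      · exact hμ h
      · exact absurd h (Nat.cast_add_one_ne_zero _)
  exact main _ p le_rfl hp

end NormalOrder

end QuiverDMod

namespace QuiverDMod

open MvPolynomial

/-! ### Vector fields and affine functions -/

section Operators

variable {N : ℕ}

lemma eval_affinePoly (f : (Fin N → ℂ) →ᵃ[ℂ] ℂ) (x : Fin N → ℂ) :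
    eval x (affinePoly f) = f x := by
  have h1 : f x = f.linear x + f 0 := by simpa using f.map_vadd 0 x
  have h2 : f.linear x = ∑ i, x i * f.linear (Pi.single i 1) := by
    conv_lhs => rw [pi_eq_sum_univ' x]
    simp [map_sum]
  simp only [affinePoly, map_add, eval_C, map_sum, map_mul, eval_X, h1, h2]
  rw [add_comm]
  simp [mul_comm]

lemma vectorField_add (v w : Fin N → ℂ) :
    vectorField (v + w) = vectorField v + vectorField w := by
  simp [vectorField, add_smul, Finset.sum_add_distrib]

lemma vectorField_smul (c : ℂ) (v : Fin N → ℂ) :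
    vectorField (c • v) = c • vectorField v := by
  simp [vectorField, mul_smul, Finset.smul_sum]

/-- The linear map sending a constant vector field to the corresponding differential operator. -/
def vectorFieldHom (N : ℕ) : (Fin N → ℂ) →ₗ[ℂ] DX N where
  toFun := vectorField
  map_add' := vectorField_add
  map_smul' := vectorField_smul

@[simp] lemma vectorFieldHom_apply (v : Fin N → ℂ) : vectorFieldHom N v = vectorField v := rfl

lemma vectorField_single (i : Fin N) :
    vectorField (Pi.single i 1) = (partialOp i : DX N) := by
  classical
  simp [vectorField, Pi.single_apply]

lemma vectorField_comm (v w : Fin N → ℂ) :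
    vectorField v * vectorField w = vectorField w * vectorField v := by
  simp only [vectorField, Finset.sum_mul_sum]
  rw [Finset.sum_comm]
  refine Finset.sum_congr rfl fun i _ => Finset.sum_congr rfl fun j _ => ?_
  rw [smul_mul_smul_comm, smul_mul_smul_comm, partialOp_comm, mul_comm]

lemma mulOp_comm (p q : OX N) : mulOp N p * mulOp N q = mulOp N q * mulOp N p := by
  rw [← map_mul, mul_comm, map_mul]

lemma mulOp_C (c : ℂ) : mulOp N (C c) = algebraMap ℂ (DX N) c := by
  refine toEnd_injective N (LinearMap.ext fun x => ?_)
  rw [AlgHom.commutes]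
  change C c * x = c • x
  rw [smul_eq_C_mul]

lemma mulOp_smul_complex (c : ℂ) (p : OX N) : mulOp N (c • p) = c • mulOp N p := by
  rw [smul_eq_C_mul, map_mul, mulOp_C, Algebra.smul_def]

lemma vectorField_mul_mulOp (v : Fin N → ℂ) (p : OX N) :
    vectorField v * mulOp N p
      = mulOp N p * vectorField v + mulOp N (∑ i, v i • pderiv i p) := by
  simp only [vectorField, Finset.sum_mul, Finset.mul_sum, map_sum, mulOp_smul_complex,
    ← Finset.sum_add_distrib]
  refine Finset.sum_congr rfl fun i _ => ?_
  rw [smul_mul_assoc, partialOp_mul_mulOp, smul_add, mul_smul_comm]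

lemma sum_smul_pderiv_affinePoly (v : Fin N → ℂ) (f : (Fin N → ℂ) →ᵃ[ℂ] ℂ) :
    ∑ i, v i • pderiv i (affinePoly f) = C (f.linear v) := by
  have h2 : f.linear v = ∑ i, v i * f.linear (Pi.single i 1) := by
    conv_lhs => rw [pi_eq_sum_univ' v]
    simp [map_sum]
  rw [h2, map_sum]
  refine Finset.sum_congr rfl fun i _ => ?_
  have : pderiv i (affinePoly f) = C (f.linear (Pi.single i 1)) := by
    classical
    simp only [affinePoly, map_add, pderiv_C, map_sum, zero_add]
    rw [Finset.sum_eq_single i]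
    · simp
    · intro j _ hj
      simp [pderiv_X_of_ne hj]
    · simp
  rw [this, smul_eq_C_mul, map_mul]

lemma vectorField_mul_affine (v : Fin N → ℂ) (f : (Fin N → ℂ) →ᵃ[ℂ] ℂ) :
    vectorField v * mulOp N (affinePoly f)
      = mulOp N (affinePoly f) * vectorField v + algebraMap ℂ (DX N) (f.linear v) := by
  rw [vectorField_mul_mulOp, sum_smul_pderiv_affinePoly, mulOp_C]

end Operators

/-! ### Adapted symplectic frames -/

/-- Affine coordinates on `X`: an origin `o` and a basis `η` of constant vector fields, together
with a set `S` of indices, to be thought of as those of the coordinates that are transversal to a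
flat through `o`. -/
structure Frame (N : ℕ) where
  o : Fin N → ℂ
  η : Module.Basis (Fin N) ℂ (Fin N → ℂ)
  S : Finset (Fin N)

namespace Frame

variable {N : ℕ} (fr : Frame N)

/-- The `j`-th affine coordinate. -/
def y (j : Fin N) : (Fin N → ℂ) →ᵃ[ℂ] ℂ :=
  (fr.η.coord j).toAffineMap - AffineMap.const ℂ (Fin N → ℂ) (fr.η.coord j fr.o)

lemma y_apply (j : Fin N) (x : Fin N → ℂ) : fr.y j x = fr.η.coord j (x - fr.o) := by
  simp [y]

lemma y_linear (j : Fin N) : (fr.y j).linear = fr.η.coord j := by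
  simp [y]

/-- The operators that act freely on a generator supported on the flat: the derivatives in the
transversal directions and the coordinates along the flat. -/
def a (i : Fin N) : DX N :=
  if i ∈ fr.S then vectorField (fr.η i) else mulOp N (affinePoly (fr.y i))

/-- The operators that do not act freely on a generator supported on the flat: the transversal
coordinates and the derivatives along the flat. -/
def b (i : Fin N) : DX N :=
  if i ∈ fr.S then mulOp N (affinePoly (fr.y i)) else vectorField (fr.η i)

/-- The signs in the commutation relations of the `a i` and `b i`. -/
def ε (i : Fin N) : ℂ := if i ∈ fr.S then -1 else 1

lemma ε_ne_zero (i : Fin N) : fr.ε i ≠ 0 := by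
  unfold ε; split_ifs <;> simp

lemma a_comm (i j : Fin N) : fr.a i * fr.a j = fr.a j * fr.a i := by
  rcases eq_or_ne i j with rfl | h
  · rfl
  unfold a
  split_ifs with hi hj hj
  · exact vectorField_comm _ _
  · rw [vectorField_mul_affine, y_linear]; simp [h]
  · rw [vectorField_mul_affine, y_linear]; simp [h.symm]
  · exact mulOp_comm _ _

lemma b_comm (i j : Fin N) : fr.b i * fr.b j = fr.b j * fr.b i := by
  rcases eq_or_ne i j with rfl | h
  · rfl
  unfold b
  split_ifs with hi hj hj
  · exact mulOp_comm _ _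
  · rw [vectorField_mul_affine, y_linear]; simp [h.symm]
  · rw [vectorField_mul_affine, y_linear]; simp [h]
  · exact vectorField_comm _ _

lemma b_mul_a (i j : Fin N) : fr.b i * fr.a j = fr.a j * fr.b i
    + algebraMap ℂ (DX N) (Pi.single (M := fun _ => ℂ) i (fr.ε i) j) := by
  unfold a b ε
  rcases eq_or_ne i j with rfl | h
  · split_ifs with hi
    · rw [vectorField_mul_affine, y_linear]; simp
    · rw [vectorField_mul_affine, y_linear]; simp
  · rw [Pi.single_eq_of_ne h.symm, map_zero, add_zero]
    split_ifs with hi hj hj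
    · rw [vectorField_mul_affine, y_linear]; simp [h.symm]
    · exact mulOp_comm _ _
    · exact vectorField_comm _ _
    · rw [vectorField_mul_affine, y_linear]; simp [h]

/-- Normal ordering with respect to the frame. -/
def ρ : MvPolynomial (Fin N ⊕ Fin N) ℂ →ₗ[ℂ] DX N :=
  normalOrder fr.a fr.b fr.a_comm fr.b_comm

/-- Evaluation of polynomials at the commuting operators `a i`. -/
def A : MvPolynomial (Fin N) ℂ →ₐ[ℂ] DX N := commAeval fr.a fr.a_comm

@[simp] lemma A_X (i : Fin N) : fr.A (X i) = fr.a i := commAeval_X _ _ _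

lemma ρ_one : fr.ρ 1 = 1 := normalOrder_one _ _ _ _

lemma ρ_rename (p : MvPolynomial (Fin N) ℂ) : fr.ρ (rename Sum.inl p) = fr.A p :=
  normalOrder_left _ _ _ _ _

lemma ρ_X_inl_mul (i : Fin N) (p : MvPolynomial (Fin N ⊕ Fin N) ℂ) :
    fr.ρ (X (Sum.inl i) * p) = fr.a i * fr.ρ p := normalOrder_X_inl_mul _ _ _ _ _ _

lemma ρ_mul_X_inr (i : Fin N) (p : MvPolynomial (Fin N ⊕ Fin N) ℂ) :
    fr.ρ (p * X (Sum.inr i)) = fr.ρ p * fr.b i := normalOrder_mul_X_inr _ _ _ _ _ _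

lemma b_mul_ρ (i : Fin N) (p : MvPolynomial (Fin N ⊕ Fin N) ℂ) :
    fr.b i * fr.ρ p = fr.ρ (X (Sum.inr i) * p) + fr.ε i • fr.ρ (pderiv (Sum.inl i) p) :=
  mul_normalOrder _ _ i _ (fr.b_mul_a i) p

lemma b_mul_A (i : Fin N) (p : MvPolynomial (Fin N) ℂ) :
    fr.b i * fr.A p = fr.A p * fr.b i + fr.ε i • fr.A (pderiv i p) :=
  commAeval_commutator _ _ _ i _ (fr.b_mul_a i) p

instance (N : ℕ) : Nontrivial (DX N) := inferInstanceAs (Nontrivial (weyl N))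

lemma ρ_injective : Function.Injective fr.ρ :=
  normalOrder_injective _ _ fr.ε fr.ε_ne_zero fr.b_mul_a

lemma affine_eq (f : (Fin N → ℂ) →ᵃ[ℂ] ℂ) :
    affinePoly f = C (f fr.o) + ∑ j, C (f.linear (fr.η j)) * affinePoly (fr.y j) := by
  refine MvPolynomial.funext fun x => ?_
  have h1 : f x = f.linear (x - fr.o) + f fr.o := by
    simpa using f.map_vadd fr.o (x - fr.o)
  have h2 : f.linear (x - fr.o) = ∑ j, fr.y j x * f.linear (fr.η j) := by
    conv_lhs => rw [← fr.η.sum_repr (x - fr.o)]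
    simp [map_sum, y_apply]
  simp only [map_add, eval_affinePoly, eval_C, map_sum, map_mul, h1, h2]
  rw [add_comm]
  simp [mul_comm]

lemma vectorField_eq (v : Fin N → ℂ) :
    vectorField v = ∑ j, fr.η.coord j v • vectorField (fr.η j) := by
  have h := congrArg (vectorFieldHom N) (fr.η.sum_repr v)
  rw [map_sum] at h
  simp only [map_smul, vectorFieldHom_apply] at h
  exact h.symm

end Frame

/-- The coordinate function `x_i` as an affine function. -/
def coordFun {N : ℕ} (i : Fin N) : (Fin N → ℂ) →ᵃ[ℂ] ℂ := (LinearMap.proj i).toAffineMap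

lemma affinePoly_coordFun {N : ℕ} (i : Fin N) : affinePoly (coordFun i) = X i := by
  refine MvPolynomial.funext fun x => ?_
  rw [eval_affinePoly, eval_X]; rfl

/-! ### The bifiltration by order and total degree -/

/-- Polynomials all of whose monomials have `w`-weight at most `k` and degree at most `n`. -/
def bidegLE {τ : Type*} (w : τ → ℕ) (k n : ℕ) : Submodule ℂ (MvPolynomial τ ℂ) :=
  restrictSupport ℂ {μ | Finsupp.weight w μ ≤ k ∧ μ.degree ≤ n}

section Bideg

variable {τ : Type*} {w : τ → ℕ} {k n : ℕ} {p : MvPolynomial τ ℂ}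

lemma mem_bidegLE : p ∈ bidegLE w k n ↔
    ∀ μ, coeff μ p ≠ 0 → Finsupp.weight w μ ≤ k ∧ μ.degree ≤ n := by
  simp [bidegLE, mem_restrictSupport_iff, Set.subset_def]

lemma bidegLE_mono {k' n' : ℕ} (hk : k ≤ k') (hn : n ≤ n') : bidegLE w k n ≤ bidegLE w k' n' :=
  restrictSupport_mono ℂ fun _ h => ⟨h.1.trans hk, h.2.trans hn⟩

lemma X_mul_mem_bidegLE (s : τ) (hp : p ∈ bidegLE w k n) :
    X s * p ∈ bidegLE w (k + w s) (n + 1) := by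
  classical
  rw [mem_bidegLE] at hp ⊢
  intro μ hμ
  rw [coeff_X_mul'] at hμ
  split_ifs at hμ with hs
  · obtain ⟨h1, h2⟩ := hp _ hμ
    have hs' : Finsupp.single s 1 ≤ μ := by
      rw [Finsupp.single_le_iff]
      exact Nat.one_le_iff_ne_zero.2 (Finsupp.mem_support_iff.1 hs)
    have h3 := tsub_add_cancel_of_le hs'
    have h4 := congrArg (Finsupp.weight w) h3
    have h5 := congrArg Finsupp.degree h3
    rw [map_add, Finsupp.weight_single] at h4
    rw [map_add, Finsupp.degree_single] at h5
    simp only [smul_eq_mul, one_mul] at h4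
    omega
  · exact absurd rfl hμ

lemma pderiv_mem_bidegLE (s : τ) (hp : p ∈ bidegLE w (k + w s) (n + 1)) :
    pderiv s p ∈ bidegLE w k n := by
  classical
  rw [mem_bidegLE] at hp ⊢
  intro μ hμ
  rw [coeff_pderiv] at hμ
  obtain ⟨h1, h2⟩ := hp _ (left_ne_zero_of_mul hμ)
  rw [map_add, Finsupp.weight_single] at h1
  rw [map_add, Finsupp.degree_single] at h2
  simp only [smul_eq_mul, one_mul] at h1
  omega

lemma monomial_mem_bidegLE {μ : τ →₀ ℕ} (c : ℂ) (h1 : Finsupp.weight w μ ≤ k)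
    (h2 : μ.degree ≤ n) : monomial μ c ∈ bidegLE w k n := by
  simp [bidegLE, h1, h2]

lemma one_mem_bidegLE : (1 : MvPolynomial τ ℂ) ∈ bidegLE w k n := by
  rw [show (1 : MvPolynomial τ ℂ) = monomial 0 1 from rfl]
  exact monomial_mem_bidegLE 1 (by simp) (by simp)

end Bideg

namespace Frame

variable {N : ℕ} (fr : Frame N)

/-- The order of `a i` as a differential operator. -/
def ordA (i : Fin N) : ℕ := if i ∈ fr.S then 1 else 0

/-- The orders of the operators `a i` and `b i`. -/
def ord : Fin N ⊕ Fin N → ℕ := Sum.elim fr.ordA fun i => if i ∈ fr.S then 0 else 1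

/-- The operators that are normally ordered polynomials of order at most `k` and degree at
most `n`. -/
def W (k n : ℕ) : Submodule ℂ (DX N) := (bidegLE fr.ord k n).map fr.ρ

variable {fr}

lemma W_mono {k k' n n' : ℕ} (hk : k ≤ k') (hn : n ≤ n') : fr.W k n ≤ fr.W k' n' :=
  Submodule.map_mono (bidegLE_mono hk hn)

lemma one_mem_W {k n : ℕ} : (1 : DX N) ∈ fr.W k n := ⟨1, one_mem_bidegLE, fr.ρ_one⟩

lemma a_mul_mem_W (i : Fin N) {k n : ℕ} {P : DX N} (hP : P ∈ fr.W k n) :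
    fr.a i * P ∈ fr.W (k + fr.ord (Sum.inl i)) (n + 1) := by
  obtain ⟨p, hp, rfl⟩ := hP
  exact ⟨_, X_mul_mem_bidegLE _ hp, fr.ρ_X_inl_mul i p⟩

lemma b_mul_mem_W (i : Fin N) {k n : ℕ} {P : DX N} (hP : P ∈ fr.W k n) :
    fr.b i * P ∈ fr.W (k + fr.ord (Sum.inr i)) (n + 1) := by
  obtain ⟨p, hp, rfl⟩ := hP
  rw [b_mul_ρ]
  refine Submodule.add_mem _ ⟨_, X_mul_mem_bidegLE _ hp, rfl⟩ (Submodule.smul_mem _ _ ?_)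
  refine W_mono (Nat.le_add_right k _) (Nat.le_succ n) ⟨_, pderiv_mem_bidegLE _ ?_, rfl⟩
  exact bidegLE_mono (Nat.le_add_right k _) (Nat.le_succ n) hp

lemma y_mul_mem_W (i : Fin N) {k n : ℕ} {P : DX N} (hP : P ∈ fr.W k n) :
    mulOp N (affinePoly (fr.y i)) * P ∈ fr.W k (n + 1) := by
  by_cases hi : i ∈ fr.S
  · simpa [b, ord, hi] using b_mul_mem_W i hP
  · simpa [a, ord, ordA, hi] using a_mul_mem_W i hP

lemma η_mul_mem_W (i : Fin N) {k n : ℕ} {P : DX N} (hP : P ∈ fr.W k n) :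
    vectorField (fr.η i) * P ∈ fr.W (k + 1) (n + 1) := by
  by_cases hi : i ∈ fr.S
  · simpa [a, ord, ordA, hi] using a_mul_mem_W i hP
  · simpa [b, ord, hi] using b_mul_mem_W i hP

lemma affine_mul_mem_W (f : (Fin N → ℂ) →ᵃ[ℂ] ℂ) {k n : ℕ} {P : DX N} (hP : P ∈ fr.W k n) :
    mulOp N (affinePoly f) * P ∈ fr.W k (n + 1) := by
  rw [fr.affine_eq, map_add, map_sum, add_mul, Finset.sum_mul, mulOp_C, ← Algebra.smul_def]
  refine Submodule.add_mem _ (Submodule.smul_mem _ _ (W_mono le_rfl (Nat.le_succ n) hP))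
    (Submodule.sum_mem _ fun j _ => ?_)
  rw [map_mul, mulOp_C, mul_assoc, ← Algebra.smul_def]
  exact Submodule.smul_mem _ _ (y_mul_mem_W j hP)

lemma vectorField_mul_mem_W (v : Fin N → ℂ) {k n : ℕ} {P : DX N} (hP : P ∈ fr.W k n) :
    vectorField v * P ∈ fr.W (k + 1) (n + 1) := by
  rw [fr.vectorField_eq, Finset.sum_mul]
  refine Submodule.sum_mem _ fun j _ => ?_
  rw [smul_mul_assoc]
  exact Submodule.smul_mem _ _ (η_mul_mem_W j hP)

lemma weight_inl_single_add (w : Fin N ⊕ Fin N → ℕ) (s : Fin N ⊕ Fin N) (μ : Fin N ⊕ Fin N →₀ ℕ) :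
    Finsupp.weight w (Finsupp.single s 1 + μ) = w s + Finsupp.weight w μ := by
  rw [map_add, Finsupp.weight_single]
  simp

lemma ρ_X_inr_mul_rename (i : Fin N) (q : MvPolynomial (Fin N) ℂ) :
    fr.ρ (X (Sum.inr i) * rename Sum.inr q) = fr.b i * fr.ρ (rename Sum.inr q) := by
  have h := pderiv_inl_mul i (1 : MvPolynomial (Fin N) ℂ) q
  rw [map_one, one_mul] at h
  rw [b_mul_ρ, h]
  simp

lemma exists_eq_single_add {τ : Type*} {μ : τ →₀ ℕ} {s : τ} (h : μ s ≠ 0) :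
    ∃ ν, μ = Finsupp.single s 1 + ν := by
  classical
  refine ⟨μ - Finsupp.single s 1, (add_tsub_cancel_of_le ?_).symm⟩
  rw [Finsupp.single_le_iff]
  exact Nat.one_le_iff_ne_zero.2 h

lemma monomial_single_add {τ : Type*} (s : τ) (μ : τ →₀ ℕ) :
    monomial (Finsupp.single s 1 + μ) (1 : ℂ) = X s * monomial μ 1 := by
  rw [X, monomial_mul, one_mul]

variable (fr) in
/-- The bifiltration does not depend on the frame. -/
lemma W_le (fr' : Frame N) (k n : ℕ) : fr.W k n ≤ fr'.W k n := by
  -- a monomial is built up by multiplying with the `b i` first and then with the `a i`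
  have key : ∀ (d : ℕ) (μ : Fin N ⊕ Fin N →₀ ℕ), μ.degree = d →
      fr.ρ (monomial μ 1) ∈ fr'.W (Finsupp.weight fr.ord μ) μ.degree := by
    intro d
    induction d with
    | zero =>
      intro μ hμ
      rw [Finsupp.degree_eq_zero_iff] at hμ
      subst hμ
      rw [show (monomial 0 1 : MvPolynomial (Fin N ⊕ Fin N) ℂ) = 1 from rfl, ρ_one]
      exact one_mem_W
    | succ d ih =>
      intro μ hμ
      by_cases h : ∃ i, μ (Sum.inl i) ≠ 0
      · obtain ⟨i, hi⟩ := h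
        obtain ⟨ν, rfl⟩ := exists_eq_single_add hi
        rw [map_add, Finsupp.degree_single] at hμ
        have h1 := ih ν (by omega)
        rw [monomial_single_add, ρ_X_inl_mul, weight_inl_single_add, map_add,
          Finsupp.degree_single, add_comm (fr.ord _), add_comm 1]
        by_cases hS : i ∈ fr.S
        · simpa [a, ord, ordA, hS] using vectorField_mul_mem_W (fr.η i) h1
        · simpa [a, ord, ordA, hS] using affine_mul_mem_W (fr.y i) h1
      · push Not at h
        have h0 : μ ≠ 0 := by rintro rfl; simp at hμ
        obtain ⟨s, hs⟩ := Finsupp.ne_iff.1 h0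
        rcases s with i | i
        · exact absurd (h i) hs
        obtain ⟨ν, rfl⟩ := exists_eq_single_add hs
        rw [map_add, Finsupp.degree_single] at hμ
        have h1 := ih ν (by omega)
        have h2 : ∃ u : Fin N →₀ ℕ, ν = Finsupp.mapDomain Sum.inr u := by
          obtain ⟨⟨u, v⟩, rfl⟩ := Finsupp.sumFinsuppEquivProdFinsupp.symm.surjective ν
          refine ⟨v, ?_⟩
          rw [sumFinsupp_symm_eq]
          suffices u = 0 by simp [this]
          refine Finsupp.ext fun j => ?_
          have := h j
          simpa using this
        obtain ⟨u, rfl⟩ := h2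
        rw [← rename_monomial] at h1
        rw [monomial_single_add, ← rename_monomial, ρ_X_inr_mul_rename, weight_inl_single_add,
          map_add, Finsupp.degree_single, add_comm (fr.ord _), add_comm 1]
        by_cases hS : i ∈ fr.S
        · simpa [b, ord, hS] using affine_mul_mem_W (fr.y i) h1
        · simpa [b, ord, hS] using vectorField_mul_mem_W (fr.η i) h1
  rw [W, bidegLE, restrictSupport_eq_span, Submodule.map_span_le]
  rintro _ ⟨μ, ⟨h1, h2⟩, rfl⟩
  exact W_mono h1 h2 (key _ μ rfl)

lemma W_eq (fr fr' : Frame N) (k n : ℕ) : fr.W k n = fr'.W k n :=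
  le_antisymm (W_le _ _ _ _) (W_le _ _ _ _)

end Frame

end QuiverDMod

namespace QuiverDMod

open MvPolynomial

/-! ### A Poincaré–Birkhoff–Witt theorem for modules with several frames -/

namespace Frame

variable {N : ℕ} (fr : Frame N)

lemma mem_range_ρ_iff {P : DX N} : P ∈ LinearMap.range fr.ρ ↔ ∃ n, P ∈ fr.W n n := by
  constructor
  · rintro ⟨p, rfl⟩
    refine ⟨(weightedTotalDegree fr.ord p) + p.totalDegree, p, mem_bidegLE.2 fun μ hμ => ?_, rfl⟩
    have h1 := le_weightedTotalDegree fr.ord (mem_support_iff.2 hμ)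
    have h2 := degree_le_totalDegree hμ
    omega
  · rintro ⟨n, p, _, rfl⟩
    exact ⟨p, rfl⟩

lemma mulOp_mul_mem_range (p : OX N) {P : DX N} (hP : P ∈ LinearMap.range fr.ρ) :
    mulOp N p * P ∈ LinearMap.range fr.ρ := by
  induction p using MvPolynomial.induction_on generalizing P with
  | C c =>
    rw [mulOp_C, ← Algebra.smul_def]
    exact Submodule.smul_mem _ _ hP
  | add p q hp hq =>
    rw [map_add, add_mul]
    exact Submodule.add_mem _ (hp hP) (hq hP)
  | mul_X p i hp =>
    rw [map_mul, mul_assoc]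
    refine hp ?_
    rw [mem_range_ρ_iff] at hP ⊢
    obtain ⟨n, hn⟩ := hP
    rw [← affinePoly_coordFun]
    exact ⟨n + 1, W_mono (Nat.le_succ n) le_rfl (affine_mul_mem_W _ hn)⟩

lemma ρ_surjective : Function.Surjective fr.ρ := by
  rw [← LinearMap.range_eq_top, eq_top_iff]
  intro P _
  let T : Subalgebra ℂ (Module.End ℂ (OX N)) :=
    { carrier := {x | ∀ Q ∈ LinearMap.range fr.ρ, ∃ Q' ∈ LinearMap.range fr.ρ,
        toEnd N Q' = x * toEnd N Q}
      mul_mem' := by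
        intro x x' hx hx' Q hQ
        obtain ⟨Q', hQ', h⟩ := hx' Q hQ
        obtain ⟨Q'', hQ'', h'⟩ := hx Q' hQ'
        exact ⟨Q'', hQ'', by rw [h', h, mul_assoc]⟩
      add_mem' := by
        intro x x' hx hx' Q hQ
        obtain ⟨Q', hQ', h⟩ := hx Q hQ
        obtain ⟨Q'', hQ'', h'⟩ := hx' Q hQ
        exact ⟨Q' + Q'', Submodule.add_mem _ hQ' hQ'', by rw [map_add, h, h', add_mul]⟩
      algebraMap_mem' := by
        intro c Q hQ
        exact ⟨c • Q, Submodule.smul_mem _ _ hQ, by rw [map_smul, Algebra.smul_def]⟩ }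
  have hT : weyl N ≤ T := by
    refine Algebra.adjoin_le ?_
    rintro _ (⟨p, rfl⟩ | ⟨i, rfl⟩) Q hQ
    · exact ⟨_, fr.mulOp_mul_mem_range p hQ, by rw [map_mul]; rfl⟩
    · refine ⟨partialOp i * Q, ?_, by rw [map_mul]; rfl⟩
      rw [mem_range_ρ_iff] at hQ ⊢
      obtain ⟨n, hn⟩ := hQ
      rw [← vectorField_single]
      exact ⟨n + 1, vectorField_mul_mem_W _ hn⟩
  obtain ⟨Q', hQ', h⟩ := hT P.2 1 ⟨1, fr.ρ_one⟩
  rw [map_one, mul_one] at h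
  rwa [show P = Q' from toEnd_injective N h.symm]

lemma weight_ord_le (μ : Fin N ⊕ Fin N →₀ ℕ) : Finsupp.weight fr.ord μ ≤ μ.degree := by
  rw [Finsupp.weight_eq_sum, Finsupp.degree_eq_sum]
  refine Finset.sum_le_sum fun i _ => ?_
  have : fr.ord i ≤ 1 := by
    rcases i with i | i <;> simp only [ord, ordA, Sum.elim_inl, Sum.elim_inr] <;> split_ifs <;> simp
  simpa using Nat.mul_le_mul_left (μ i) this

lemma ρ_monomial_mem_W {μ : Fin N ⊕ Fin N →₀ ℕ} {n : ℕ} (c : ℂ) (h : μ.degree ≤ n) :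
    fr.ρ (monomial μ c) ∈ fr.W n n :=
  ⟨_, monomial_mem_bidegLE c ((fr.weight_ord_le μ).trans h) h, rfl⟩

end Frame

section PBW

variable {N : ℕ} {B : Type*} (fr : B → Frame N)
  {X : Type*} [AddCommGroup X] [Module (DX N) X] [Module ℂ X]
  (g : Module.Basis B (DX N) X) (r : B → Fin N → X)

/-- `j` is the smallest index of a variable of the second kind dividing the monomial `μ`. -/
def IsMinY (μ : Fin N ⊕ Fin N →₀ ℕ) (j : Fin N) : Prop :=
  μ (Sum.inr j) ≠ 0 ∧ ∀ i < j, μ (Sum.inr i) = 0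

lemma IsMinY.unique {μ : Fin N ⊕ Fin N →₀ ℕ} {j k : Fin N} (hj : IsMinY μ j) (hk : IsMinY μ k) :
    j = k := by
  rcases lt_trichotomy j k with h | h | h
  · exact absurd (hk.2 j h) hj.1
  · exact h
  · exact absurd (hj.2 k h) hk.1

lemma exists_isMinY {μ : Fin N ⊕ Fin N →₀ ℕ} {j : Fin N} (h : μ (Sum.inr j) ≠ 0) :
    ∃ k ≤ j, IsMinY μ k := by
  induction j using WellFoundedLT.induction with
  | ind j ih =>
    by_cases hj : ∃ i < j, μ (Sum.inr i) ≠ 0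
    · obtain ⟨i, hi, hi'⟩ := hj
      obtain ⟨k, hk, hk'⟩ := ih i hi hi'
      exact ⟨k, hk.trans hi.le, hk'⟩
    · push Not at hj
      exact ⟨j, le_rfl, h, hj⟩

open Classical in
/-- The deformation of the basis of normally ordered monomials at the generator `g e`, in which
every monomial `ν · b_j` with `j` minimal is replaced by `ν · r e j`. -/
def relBasis (e : B) : MvPolynomial (Fin N ⊕ Fin N) ℂ →ₗ[ℂ] X :=
  (basisMonomials (Fin N ⊕ Fin N) ℂ).constr ℂ fun μ =>
    if h : ∃ j, IsMinY μ j then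
      (fr e).ρ (monomial (μ - Finsupp.single (Sum.inr h.choose) 1) 1) • r e h.choose
    else (fr e).ρ (monomial μ 1) • g e

lemma relBasis_of_isMinY (e : B) {μ : Fin N ⊕ Fin N →₀ ℕ} {j : Fin N}
    (h : IsMinY (Finsupp.single (Sum.inr j) 1 + μ) j) :
    relBasis fr g r e (monomial (Finsupp.single (Sum.inr j) 1 + μ) 1)
      = (fr e).ρ (monomial μ 1) • r e j := by
  have hex : ∃ k, IsMinY (Finsupp.single (Sum.inr j) 1 + μ) k := ⟨j, h⟩
  have hk : hex.choose = j := hex.choose_spec.unique h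
  have := (basisMonomials (Fin N ⊕ Fin N) ℂ).constr_basis ℂ (fun μ =>
    open Classical in
    if h : ∃ j, IsMinY μ j then
      (fr e).ρ (monomial (μ - Finsupp.single (Sum.inr h.choose) 1) 1) • r e h.choose
    else (fr e).ρ (monomial μ 1) • g e) (Finsupp.single (Sum.inr j) 1 + μ)
  rw [coe_basisMonomials, dif_pos hex, hk, add_tsub_cancel_left] at this
  exact this

lemma relBasis_of_not (e : B) {μ : Fin N ⊕ Fin N →₀ ℕ} (h : ¬ ∃ j, IsMinY μ j) :
    relBasis fr g r e (monomial μ 1) = (fr e).ρ (monomial μ 1) • g e := by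
  have := (basisMonomials (Fin N ⊕ Fin N) ℂ).constr_basis ℂ (fun μ =>
    open Classical in
    if h : ∃ j, IsMinY μ j then
      (fr e).ρ (monomial (μ - Finsupp.single (Sum.inr h.choose) 1) 1) • r e h.choose
    else (fr e).ρ (monomial μ 1) • g e) μ
  rwa [coe_basisMonomials, dif_neg h] at this

variable [IsScalarTower ℂ (DX N) X]

/-- The elements of the free module all of whose coordinates have degree at most `n`. -/
def coordLE (n : ℕ) : Submodule ℂ X where
  carrier := {x | ∀ e, g.repr x e ∈ (fr e).W n n}
  add_mem' hx hy e := by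
    rw [map_add]
    exact Submodule.add_mem _ (hx e) (hy e)
  zero_mem' e := by simp
  smul_mem' c x hx e := by
    rw [← algebraMap_smul (DX N) c x, map_smul, Finsupp.smul_apply, algebraMap_smul]
    exact Submodule.smul_mem _ _ (hx e)

lemma smul_basis_mem_coordLE {n : ℕ} {e : B} {P : DX N} (hP : P ∈ (fr e).W n n) (e' : B) :
    P • g e' ∈ coordLE fr g n := by
  classical
  intro e''
  rw [map_smul, Module.Basis.repr_self, Finsupp.smul_apply, Finsupp.single_apply]
  split_ifs
  · rw [smul_eq_mul, mul_one, Frame.W_eq _ (fr e)]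
    exact hP
  · simp

lemma mem_coordLE_sum [Fintype B] {n : ℕ} {P : B → DX N} (h : ∑ e, P e • g e ∈ coordLE fr g n) (e : B) :
    P e ∈ (fr e).W n n := by
  have := h e
  rwa [← Module.Basis.equivFun_apply, ← Module.Basis.equivFun_symm_apply,
    LinearEquiv.apply_symm_apply] at this

variable {r}
lemma smul_mem_of_forall {P : DX N} {T : Submodule ℂ X} {s : Set X} (h : ∀ x ∈ s, P • x ∈ T) {x : X}
    (hx : x ∈ Submodule.span ℂ s) : P • x ∈ T := by
  induction hx using Submodule.span_induction with
  | zero => simp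
  | add x y _ _ hx hy => rw [smul_add]; exact Submodule.add_mem _ hx hy
  | smul c x _ hx =>
    rw [← algebraMap_smul (DX N) c x, ← mul_smul, ← Algebra.commutes, mul_smul, algebraMap_smul]
    exact Submodule.smul_mem _ _ hx
  | mem x hx => exact h x hx

lemma relBasis_sub_mem_coordLE
    (hr : ∀ e i, r e i - (fr e).b i • g e ∈ Submodule.span ℂ (Set.range g)) (e : B) {n : ℕ} {p : MvPolynomial (Fin N ⊕ Fin N) ℂ}
    (hp : p ∈ bidegLE (fr e).ord (n + 1) (n + 1)) :
    relBasis fr g r e p - (fr e).ρ p • g e ∈ coordLE fr g n := by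
  rw [bidegLE, restrictSupport_eq_span] at hp
  induction hp using Submodule.span_induction with
  | zero => simp
  | add p q _ _ hp hq =>
    rw [map_add, map_add, add_smul, add_sub_add_comm]
    exact Submodule.add_mem _ hp hq
  | smul c p _ hp =>
    rw [map_smul, map_smul, smul_assoc, ← smul_sub]
    exact Submodule.smul_mem _ _ hp
  | mem p hp =>
    obtain ⟨μ, ⟨-, h2⟩, rfl⟩ := hp
    dsimp only
    by_cases h : ∃ j, IsMinY μ j
    · obtain ⟨j, hj⟩ := h
      obtain ⟨ν, rfl⟩ := Frame.exists_eq_single_add hj.1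
      rw [map_add, Finsupp.degree_single] at h2
      have hν : (fr e).ρ (monomial ν 1) ∈ (fr e).W n n :=
        (fr e).ρ_monomial_mem_W 1 (by omega)
      rw [relBasis_of_isMinY _ _ _ _ hj, Frame.monomial_single_add, mul_comm,
        Frame.ρ_mul_X_inr, mul_smul, ← smul_sub]
      refine smul_mem_of_forall ?_ (hr e j)
      rintro _ ⟨e', rfl⟩
      exact smul_basis_mem_coordLE fr g hν e'
    · rw [relBasis_of_not _ _ _ _ h, sub_self]
      exact Submodule.zero_mem _

/-- The deformed monomials are linearly independent, since they are congruent to the normally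
ordered monomials modulo lower degree. -/
lemma relBasis_sum_injective [Fintype B]
    (hr : ∀ e i, r e i - (fr e).b i • g e ∈ Submodule.span ℂ (Set.range g))
    (q : B → MvPolynomial (Fin N ⊕ Fin N) ℂ) (h : ∑ e, relBasis fr g r e (q e) = 0) : q = 0 := by
  have main : ∀ n : ℕ, (∀ e, q e ∈ bidegLE (fr e).ord n n) → q = 0 := by
    intro n
    induction n with
    | zero =>
      intro hq
      have h1 : ∀ e, relBasis fr g r e (q e) = (fr e).ρ (q e) • g e := by
        intro e
        have hC : q e = coeff 0 (q e) • monomial 0 1 := by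
          refine MvPolynomial.ext _ _ fun μ => ?_
          rw [coeff_smul, coeff_monomial]
          split_ifs with h0
          · rw [← h0, smul_eq_mul, mul_one]
          · rw [smul_zero]
            by_contra hne
            have := (mem_bidegLE.1 (hq e) μ hne).2
            rw [Nat.le_zero, Finsupp.degree_eq_zero_iff] at this
            exact h0 this.symm
        rw [hC, map_smul, map_smul, smul_assoc, relBasis_of_not]
        rintro ⟨j, hj, -⟩
        exact hj rfl
      rw [Finset.sum_congr rfl fun e _ => h1 e] at h
      have h2 := Fintype.linearIndependent_iff.1 g.linearIndependent _ h
      exact funext fun e => (fr e).ρ_injective (by rw [h2 e, Pi.zero_apply, map_zero])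
    | succ n ih =>
      intro hq
      refine ih fun e => ?_
      have h1 : ∑ e, (fr e).ρ (q e) • g e ∈ coordLE fr g n := by
        have := Submodule.sum_mem (coordLE fr g n)
          fun e (_ : e ∈ Finset.univ) => relBasis_sub_mem_coordLE fr g hr e (hq e)
        rw [Finset.sum_sub_distrib, h, zero_sub] at this
        simpa using Submodule.neg_mem _ this
      obtain ⟨p, hp, hpq⟩ := mem_coordLE_sum fr g h1 e
      rwa [← (fr e).ρ_injective hpq]
  refine main (∑ e, (q e).totalDegree) fun e => mem_bidegLE.2 fun μ hμ => ?_
  have h2 := (degree_le_totalDegree hμ).trans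
    (Finset.single_le_sum (f := fun e => (q e).totalDegree) (fun _ _ => Nat.zero_le _)
      (Finset.mem_univ e))
  exact ⟨((fr e).weight_ord_le μ).trans h2, h2⟩

variable (r) in
/-- The span of the deformed monomials that lie in the submodule of relations. -/
def relSpan : Submodule ℂ X :=
  Submodule.span ℂ {x | ∃ e μ, (∃ j, IsMinY μ j) ∧ x = relBasis fr g r e (monomial μ 1)}

lemma exists_poly_of_mem_W {fr' : Frame N} {n : ℕ} {P : DX N} (hP : P ∈ fr'.W n n) {T : Submodule ℂ X}
    {x : X} (h : ∀ μ : Fin N ⊕ Fin N →₀ ℕ, μ.degree ≤ n → fr'.ρ (monomial μ 1) • x ∈ T) :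
    P • x ∈ T := by
  rw [Frame.W, bidegLE, restrictSupport_eq_span, Submodule.map_span] at hP
  induction hP using Submodule.span_induction with
  | zero => simp
  | add p q _ _ hp hq => rw [add_smul]; exact Submodule.add_mem _ hp hq
  | smul c p _ hp => rw [smul_assoc]; exact Submodule.smul_mem _ _ hp
  | mem p hp =>
    obtain ⟨_, ⟨μ, ⟨-, h2⟩, rfl⟩, rfl⟩ := hp
    exact h μ h2

/-- Every product of a monomial with a relation is a combination of deformed monomials: if the
monomial `ν = ν' b_k` has `k < j`, the consistency of the relations allows to replace
`ν' b_k · r_j` by `ν' b_j · r_k` and terms of lower degree. -/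
lemma monomial_smul_mem_relSpan
    (hc : ∀ e i k, (fr e).b k • r e i - (fr e).b i • r e k
      ∈ Submodule.span ℂ (Set.range fun x : B × Fin N => r x.1 x.2))
    (n : ℕ) : ∀ (e : B) (j : Fin N) (ν : Fin N ⊕ Fin N →₀ ℕ), ν.degree = n →
      (fr e).ρ (monomial ν 1) • r e j ∈ relSpan fr g r := by
  induction n using Nat.strong_induction_on with
  | _ n ih =>
    intro e j ν hν
    by_cases hj : ∀ i < j, ν (Sum.inr i) = 0
    · have hm : IsMinY (Finsupp.single (Sum.inr j) 1 + ν) j := by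
        refine ⟨by simp, fun i hi => ?_⟩
        simp [hj i hi, hi.ne']
      exact Submodule.subset_span ⟨e, _, ⟨j, hm⟩, (relBasis_of_isMinY fr g r e hm).symm⟩
    · push Not at hj
      obtain ⟨i, hij, hi⟩ := hj
      obtain ⟨k, hki, hk⟩ := exists_isMinY hi
      have hkj : k < j := hki.trans_lt hij
      obtain ⟨ν', rfl⟩ := Frame.exists_eq_single_add hk.1
      rw [map_add, Finsupp.degree_single] at hν
      have hm : IsMinY (Finsupp.single (Sum.inr k) 1 + (Finsupp.single (Sum.inr j) 1 + ν')) k := by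
        refine ⟨by simp, fun i hi => ?_⟩
        have := hk.2 i hi
        simp only [Finsupp.add_apply, Nat.add_eq_zero_iff] at this ⊢
        refine ⟨this.1, ?_, this.2⟩
        simp [(hi.trans hkj).ne']
      have h1 := relBasis_of_isMinY fr g r e hm
      rw [Frame.monomial_single_add (Sum.inr j), mul_comm (MvPolynomial.X _), Frame.ρ_mul_X_inr, mul_smul] at h1
      have h2 : (fr e).ρ (monomial (Finsupp.single (Sum.inr k) 1 + ν') 1) • r e j
          = relBasis fr g r e
              (monomial (Finsupp.single (Sum.inr k) 1 + (Finsupp.single (Sum.inr j) 1 + ν')) 1)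
            + (fr e).ρ (monomial ν' 1) • ((fr e).b k • r e j - (fr e).b j • r e k) := by
        rw [h1, ← smul_add, add_sub_cancel, Frame.monomial_single_add, mul_comm,
          Frame.ρ_mul_X_inr, mul_smul]
      rw [h2]
      refine Submodule.add_mem _ (Submodule.subset_span ⟨e, _, ⟨k, hm⟩, rfl⟩) ?_
      refine smul_mem_of_forall ?_ (hc e j k)
      rintro _ ⟨⟨e', j'⟩, rfl⟩
      have h3 := (fr e).ρ_monomial_mem_W 1 (le_refl ν'.degree)
      rw [Frame.W_eq _ (fr e')] at h3
      refine exists_poly_of_mem_W h3 fun μ hμ => ?_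
      exact ih _ (by omega) e' j' μ rfl

lemma span_le_relSpan
    (hc : ∀ e i k, (fr e).b k • r e i - (fr e).b i • r e k
      ∈ Submodule.span ℂ (Set.range fun x : B × Fin N => r x.1 x.2)) {x : X}
    (hx : x ∈ Submodule.span (DX N) (Set.range fun x : B × Fin N => r x.1 x.2)) :
    x ∈ relSpan fr g r := by
  have h : ∀ (P : DX N) (e : B) (j : Fin N), P • r e j ∈ relSpan fr g r := by
    intro P e j
    obtain ⟨p, rfl⟩ := (fr e).ρ_surjective P
    induction p using MvPolynomial.induction_on' with
    | add p q hp hq => rw [map_add, add_smul]; exact Submodule.add_mem _ hp hq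
    | monomial μ c =>
      have : monomial μ c = c • monomial μ (1 : ℂ) := by simp [smul_monomial]
      rw [this, map_smul, smul_assoc]
      exact Submodule.smul_mem _ _ (monomial_smul_mem_relSpan fr g hc _ e j μ rfl)
  have h' : ∀ P : DX N, P • x ∈ relSpan fr g r := by
    induction hx using Submodule.span_induction with
    | zero => simp
    | add x y _ _ hx hy => exact fun P => by rw [smul_add]; exact Submodule.add_mem _ (hx P) (hy P)
    | smul Q x _ hx => exact fun P => by rw [← mul_smul]; exact hx _
    | mem x hx =>
      obtain ⟨⟨e, j⟩, rfl⟩ := hx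
      exact fun P => h P e j
  simpa using h' 1

/-- The Poincaré–Birkhoff–Witt theorem: if the relations `r e i = b_i · g e - …` are consistent,
then the normally ordered monomials in the `a i` applied to the generators remain linearly
independent modulo the relations. -/
theorem pbw_injective [Fintype B]
    (hr : ∀ e i, r e i - (fr e).b i • g e ∈ Submodule.span ℂ (Set.range g))
    (hc : ∀ e i k, (fr e).b k • r e i - (fr e).b i • r e k
      ∈ Submodule.span ℂ (Set.range fun x : B × Fin N => r x.1 x.2))
    (p : B → MvPolynomial (Fin N) ℂ)
    (hp : ∑ e, (fr e).A (p e) • g e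
      ∈ Submodule.span (DX N) (Set.range fun x : B × Fin N => r x.1 x.2)) : p = 0 := by
  have h1 := span_le_relSpan fr g hc hp
  -- polynomials all of whose monomials contain a variable of the second kind
  let K : Submodule ℂ (MvPolynomial (Fin N ⊕ Fin N) ℂ) :=
    restrictSupport ℂ {μ | ∃ j, IsMinY μ j}
  have h2 : ∀ x ∈ relSpan fr g r, ∃ q : B → MvPolynomial (Fin N ⊕ Fin N) ℂ,
      (∀ e, q e ∈ K) ∧ x = ∑ e, relBasis fr g r e (q e) := by
    intro x hx
    induction hx using Submodule.span_induction with
    | zero => exact ⟨0, fun e => Submodule.zero_mem _, by simp⟩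
    | add x y _ _ hx hy =>
      obtain ⟨q, hq, rfl⟩ := hx
      obtain ⟨q', hq', rfl⟩ := hy
      exact ⟨q + q', fun e => Submodule.add_mem _ (hq e) (hq' e),
        by simp [Finset.sum_add_distrib]⟩
    | smul c x _ hx =>
      obtain ⟨q, hq, rfl⟩ := hx
      exact ⟨c • q, fun e => Submodule.smul_mem _ _ (hq e), by simp [Finset.smul_sum]⟩
    | mem x hx =>
      classical
      obtain ⟨e, μ, hμ, rfl⟩ := hx
      refine ⟨Pi.single e (monomial μ 1), fun e' => ?_, ?_⟩
      · rcases eq_or_ne e' e with rfl | h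
        · rw [Pi.single_eq_same]
          exact (monomial_mem_restrictSupport ℂ).2 (Or.inl hμ)
        · rw [Pi.single_eq_of_ne h]
          exact Submodule.zero_mem _
      · rw [Finset.sum_eq_single e]
        · rw [Pi.single_eq_same]
        · intro e' _ h
          rw [Pi.single_eq_of_ne h, map_zero]
        · simp
  obtain ⟨q, hq, hqp⟩ := h2 _ h1
  have hnoY : ∀ (u : Fin N →₀ ℕ), ¬ ∃ j, IsMinY (Finsupp.mapDomain Sum.inl u) j := by
    rintro u ⟨j, hj, -⟩
    exact hj (Finsupp.mapDomain_of_notMem_range _ _ (by simp))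
  have h3 : ∀ (e : B) (p : MvPolynomial (Fin N) ℂ),
      relBasis fr g r e (rename Sum.inl p) = (fr e).A p • g e := by
    intro e p
    rw [← Frame.ρ_rename]
    induction p using MvPolynomial.induction_on' with
    | add p q hp hq => rw [map_add, map_add, map_add, add_smul, hp, hq]
    | monomial μ c =>
      have : monomial μ c = c • monomial μ (1 : ℂ) := by simp [smul_monomial]
      rw [this, map_smul, map_smul, map_smul, smul_assoc, rename_monomial,
        relBasis_of_not _ _ _ _ (hnoY μ)]
  have h4 := relBasis_sum_injective fr g hr (fun e => rename Sum.inl (p e) - q e) (by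
    simp only [map_sub, Finset.sum_sub_distrib, h3, ← hqp, sub_self])
  funext e
  have h5 : rename Sum.inl (p e) = q e := sub_eq_zero.1 (congrFun h4 e)
  refine MvPolynomial.ext _ _ fun μ => ?_
  rw [Pi.zero_apply, coeff_zero, ← coeff_rename_mapDomain Sum.inl Sum.inl_injective, h5]
  by_contra hne
  exact hnoY μ ((mem_restrictSupport_iff ℂ).1 (hq e) (mem_support_iff.2 hne))

end PBW

end QuiverDMod

namespace QuiverDMod

/-! ### Double contractions of top forms -/

section DoubleContraction

variable {E : Type*} [AddCommGroup E] [Module ℂ E] {W W' W'' : Submodule ℂ E}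

/-- For `W'' ⊆ W` of codimension two, the contraction of a top form on `W` with two vectors. -/
def contract₂ (hle : W'' ≤ W) (hd : Module.finrank ℂ W = Module.finrank ℂ W'' + 1 + 1)
    (ξ η : W) (ω : TopForm W) : TopForm W'' :=
  (((ω.domDomCongr (finCongr hd)).curryLeft ξ).curryLeft η).compLinearMap (Submodule.inclusion hle)

lemma contract_contract (h : W' ≤ W) (h' : W'' ≤ W')
    (hd : Module.finrank ℂ W = Module.finrank ℂ W' + 1)
    (hd' : Module.finrank ℂ W' = Module.finrank ℂ W'' + 1) (ξ : W) (η : W') (ω : TopForm W) :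
    contract h' hd' η (contract h hd ξ ω)
      = contract₂ (h'.trans h) (hd.trans (congrArg (· + 1) hd')) ξ (Submodule.inclusion h η) ω := by
  ext t
  change ω _ = ω _
  congr 1
  funext i
  generalize Module.finrank ℂ W = n at *
  generalize Module.finrank ℂ W' = n' at *
  subst hd'
  subst hd
  simp only [finCongr_refl, Equiv.refl_apply, Function.comp_apply]
  refine Fin.cases ?_ (fun j => ?_) i
  · rfl
  · refine Fin.cases ?_ (fun k => ?_) j <;> rfl

lemma contract₂_zero (hle : W'' ≤ W) (hd : Module.finrank ℂ W = Module.finrank ℂ W'' + 1 + 1)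
    (ξ η : W) : contract₂ hle hd ξ η 0 = 0 := by
  ext t; rfl

lemma alternatize_cons_cons {k n n' : ℕ} (h : W' ≤ W) (h' : W'' ≤ W')
    (h1 : n = n' + 1) (h2 : n' = k + 1) (h3 : n = k + 1 + 1)
    (φ : W →ₗ[ℂ] ℂ) (hφ : ∀ w : W', φ (Submodule.inclusion h w) = 0)
    (ω : W' [⋀^Fin n']→ₗ[ℂ] ℂ) (ξ η : W) (c : W')
    (hc : Submodule.inclusion h c = φ ξ • η - φ η • ξ) (t : Fin k → W'') :
    (((AlternatingMap.alternatizeUncurryFin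
      (φ.smulRight (ω.compLinearMap (retraction h)))).domDomCongr (finCongr h1.symm)).domDomCongr
        (finCongr h3))
        (Matrix.vecCons ξ (Matrix.vecCons η fun i => Submodule.inclusion (h'.trans h) (t i)))
      = (ω.domDomCongr (finCongr h2)) (Matrix.vecCons c fun i => Submodule.inclusion h' (t i)) := by
  subst h2
  subst h1
  have hr : c = φ ξ • retraction h η - φ η • retraction h ξ := by
    rw [← map_smul, ← map_smul, ← map_sub, ← hc, retraction_inclusion]
  have ht : ∀ i, retraction h (Submodule.inclusion (h'.trans h) (t i))
      = Submodule.inclusion h' (t i) := fun i =>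
    retraction_inclusion h (Submodule.inclusion h' (t i))
  have ht0 : ∀ i, φ (Submodule.inclusion (h'.trans h) (t i)) = 0 := fun i =>
    hφ (Submodule.inclusion h' (t i))
  have e1 : (((AlternatingMap.alternatizeUncurryFin
      (φ.smulRight (ω.compLinearMap (retraction h)))).domDomCongr (finCongr rfl)).domDomCongr
        (finCongr h3))
        (Matrix.vecCons ξ (Matrix.vecCons η fun i => Submodule.inclusion (h'.trans h) (t i)))
      = (AlternatingMap.alternatizeUncurryFin (φ.smulRight (ω.compLinearMap (retraction h))))
        (Matrix.vecCons ξ (Matrix.vecCons η fun i => Submodule.inclusion (h'.trans h) (t i))) := rfl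
  have e2 : (ω.domDomCongr (finCongr rfl)) (Matrix.vecCons c fun i => Submodule.inclusion h' (t i))
      = ω (Matrix.vecCons c fun i => Submodule.inclusion h' (t i)) := rfl
  have hvec : ∀ w : W, (fun i => retraction h (Matrix.vecCons w
        (fun i => Submodule.inclusion (h'.trans h) (t i)) i))
      = (Matrix.vecCons (retraction h w) fun i => Submodule.inclusion h' (t i) : Fin (k + 1) → W')
      := by
    intro w
    funext i
    refine Fin.cases rfl (fun j => ?_) i
    simp [ht]
  rw [e1, e2, AlternatingMap.alternatizeUncurryFin_apply, Fin.sum_univ_succ, Fin.sum_univ_succ]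
  have hz : ∑ i : Fin k, (-1 : ℤ) ^ (i.succ.succ : ℕ) •
      (φ.smulRight (ω.compLinearMap (retraction h)))
        ((Matrix.vecCons ξ (Matrix.vecCons η fun i =>
          Submodule.inclusion (h'.trans h) (t i)) : Fin (k + 1 + 1) → W) i.succ.succ)
        (i.succ.succ.removeNth (Matrix.vecCons ξ (Matrix.vecCons η fun i =>
          Submodule.inclusion (h'.trans h) (t i)))) = 0 := by
    refine Finset.sum_eq_zero fun i _ => ?_
    simp [ht0]
  rw [hz, add_zero]
  have r0 : (0 : Fin (k + 1 + 1)).removeNth (Matrix.vecCons ξ (Matrix.vecCons η fun i =>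
      Submodule.inclusion (h'.trans h) (t i)))
      = (Matrix.vecCons η fun i => Submodule.inclusion (h'.trans h) (t i)) := by
    funext i; rfl
  have r1 : (Fin.succ (0 : Fin (k + 1))).removeNth (Matrix.vecCons ξ (Matrix.vecCons η fun i =>
      Submodule.inclusion (h'.trans h) (t i)))
      = (Matrix.vecCons ξ fun i => Submodule.inclusion (h'.trans h) (t i)) := by
    funext i
    refine Fin.cases rfl (fun j => ?_) i
    rfl
  rw [r0, r1, hr]
  have hω : ∀ w : W, (ω.compLinearMap (retraction h))
      (Matrix.vecCons w fun i => Submodule.inclusion (h'.trans h) (t i))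
      = ω.curryLeft (retraction h w) (fun i => Submodule.inclusion h' (t i)) := by
    intro w
    change ω _ = ω _
    exact congrArg ω (hvec w)
  simp only [LinearMap.smulRight_apply, AlternatingMap.smul_apply, hω]
  change _ = ω.curryLeft _ _
  rw [map_sub, map_smul, map_smul]
  simp [sub_eq_add_neg]

/-- Contracting `φ ∧ ω` with `ξ` and `η` amounts to contracting `ω` with `φ(ξ) η - φ(η) ξ`. -/
lemma contract₂_wedge (h : W' ≤ W) (h' : W'' ≤ W')
    (hd : Module.finrank ℂ W = Module.finrank ℂ W' + 1)
    (hd' : Module.finrank ℂ W' = Module.finrank ℂ W'' + 1)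
    (hd₂ : Module.finrank ℂ W = Module.finrank ℂ W'' + 1 + 1)
    (φ : W →ₗ[ℂ] ℂ) (hφ : ∀ w : W', φ (Submodule.inclusion h w) = 0) (ω : TopForm W') (ξ η : W)
    (c : W') (hc : Submodule.inclusion h c = φ ξ • η - φ η • ξ) :
    contract₂ (h'.trans h) hd₂ ξ η (wedge h hd φ ω) = contract h' hd' c ω := by
  ext t
  exact alternatize_cons_cons h h' hd hd' hd₂ φ hφ ω ξ η c hc t

lemma wedge_zero (h : W' ≤ W) (hd : Module.finrank ℂ W = Module.finrank ℂ W' + 1) :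
    wedge h hd 0 = 0 := by
  ext ω x
  simp [wedge, AlternatingMap.alternatizeUncurryFin_apply]

variable [FiniteDimensional ℂ E]

lemma mem_of_apply_eq_zero (h : W' ≤ W) (hd : Module.finrank ℂ W = Module.finrank ℂ W' + 1)
    (φ : W →ₗ[ℂ] ℂ) (hφ : ∀ w : W', φ (Submodule.inclusion h w) = 0) (hφ0 : φ ≠ 0) {w : W}
    (hw : φ w = 0) : (w : E) ∈ W' := by
  have h1 : LinearMap.range (Submodule.inclusion h) ≤ LinearMap.ker φ := by
    rintro _ ⟨w, rfl⟩; exact hφ w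
  have h2 : Module.finrank ℂ (LinearMap.range (Submodule.inclusion h)) = Module.finrank ℂ W' :=
    LinearMap.finrank_range_of_inj (Submodule.inclusion_injective h)
  have h3 := LinearMap.finrank_range_add_finrank_ker φ
  have h4 : Module.finrank ℂ (LinearMap.range φ) = 1 := by
    rw [LinearMap.range_eq_top.2 (LinearMap.surjective hφ0), finrank_top]
    exact Module.finrank_self ℂ
  have h5 := Submodule.eq_of_le_of_finrank_eq h1 (by omega)
  have h6 : w ∈ LinearMap.ker φ := hw
  rw [← h5] at h6
  obtain ⟨w', rfl⟩ := h6
  exact w'.2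

lemma smul_contract_comm (h : W' ≤ W) (hd : Module.finrank ℂ W = Module.finrank ℂ W' + 1)
    (φ : W →ₗ[ℂ] ℂ) (hφ : ∀ w : W', φ (Submodule.inclusion h w) = 0) (ξ η : W) (ω : TopForm W) :
    φ ξ • contract h hd η ω = φ η • contract h hd ξ ω := by
  rcases eq_or_ne φ 0 with rfl | h0
  · simp
  obtain ⟨ω', rfl⟩ := (wedge_bijective h hd φ hφ h0).2 ω
  rw [contract_wedge _ _ _ _ hφ, contract_wedge _ _ _ _ hφ, smul_smul, smul_smul, mul_comm]

lemma contract_eq_zero_of_mem (h : W' ≤ W) (hd : Module.finrank ℂ W = Module.finrank ℂ W' + 1)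
    (ξ : W) (hξ : (ξ : E) ∈ W') : contract h hd ξ = 0 := by
  obtain ⟨η, hη, hη'⟩ : ∃ η ∈ W, η ∉ W' := by
    by_contra! hne
    have : W = W' := le_antisymm hne h
    subst this
    omega
  obtain ⟨g, hg, hg0⟩ := Submodule.exists_le_ker_of_notMem hη'
  ext1 ω
  have h1 := smul_contract_comm h hd (g.comp W.subtype) (fun w => hg0 w.2) ⟨η, hη⟩ ξ ω
  have h2 : (g.comp W.subtype) ξ = 0 := hg0 hξ
  rw [h2, zero_smul] at h1
  exact (smul_eq_zero.1 h1).resolve_left hg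

lemma contract₂_ext (h : W' ≤ W) (h' : W'' ≤ W')
    (hd : Module.finrank ℂ W = Module.finrank ℂ W' + 1)
    (hd' : Module.finrank ℂ W' = Module.finrank ℂ W'' + 1)
    (hd₂ : Module.finrank ℂ W = Module.finrank ℂ W'' + 1 + 1) {ω ω' : TopForm W}
    (he : ∀ ξ η, contract₂ (h'.trans h) hd₂ ξ η ω = contract₂ (h'.trans h) hd₂ ξ η ω') :
    ω = ω' := by
  have hex : ∀ {U U' : Submodule ℂ E}, U' ≤ U → Module.finrank ℂ U = Module.finrank ℂ U' + 1 →
      ∃ η : U, (η : E) ∉ U' := by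
    intro U U' hU hUd
    by_contra! hne
    have : U = U' := le_antisymm (fun x hx => hne ⟨x, hx⟩) hU
    subst this
    omega
  obtain ⟨ξ, hξ⟩ := hex h hd
  obtain ⟨η, hη⟩ := hex h' hd'
  refine contract_injective h hd ξ hξ (contract_injective h' hd' η hη ?_)
  rw [contract_contract, contract_contract]
  exact he _ _

/-- For linear forms `f`, `f'` on `W` vanishing on `W''`, the double wedge product `f ∧ f' ∧ ω`
can be computed through any intermediate subspace `W'`. -/
lemma contract₂_wedge_of_contract (h : W' ≤ W) (h' : W'' ≤ W')
    (hd : Module.finrank ℂ W = Module.finrank ℂ W' + 1)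
    (hd' : Module.finrank ℂ W' = Module.finrank ℂ W'' + 1)
    (hd₂ : Module.finrank ℂ W = Module.finrank ℂ W'' + 1 + 1)
    (f f' : W →ₗ[ℂ] ℂ) (hf : ∀ w : W'', f (Submodule.inclusion (h'.trans h) w) = 0)
    (hf' : ∀ w : W'', f' (Submodule.inclusion (h'.trans h) w) = 0)
    (ζ : W') (hζ : (ζ : E) ∉ W'') (ω : TopForm W') (ξ η : W) :
    contract₂ (h'.trans h) hd₂ ξ η
        (wedge h hd (f' (Submodule.inclusion h ζ) • f - f (Submodule.inclusion h ζ) • f') ω)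
      = (f' η * f ξ - f' ξ * f η) • contract h' hd' ζ ω := by
  have hker : ∀ g : W →ₗ[ℂ] ℂ, (∀ w : W'', g (Submodule.inclusion (h'.trans h) w) = 0) →
      g (Submodule.inclusion h ζ) = 0 → ∀ w : W', g (Submodule.inclusion h w) = 0 := by
    intro g hg hgζ w
    by_contra hne
    have h0 : g.comp (Submodule.inclusion h) ≠ 0 := fun h0 => hne (LinearMap.congr_fun h0 w)
    exact hζ (mem_of_apply_eq_zero h' hd' (g.comp (Submodule.inclusion h)) hg h0 hgζ)
  set c := f' (Submodule.inclusion h ζ) • f - f (Submodule.inclusion h ζ) • f' with hcdef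
  have hc : ∀ w : W', c (Submodule.inclusion h w) = 0 := by
    refine hker c (fun w => ?_) ?_
    · simp [hcdef, hf, hf']
    · simp [hcdef, mul_comm]
  by_cases hz : f (Submodule.inclusion h ζ) = 0 ∧ f' (Submodule.inclusion h ζ) = 0
  · have hc0 : c = 0 := by simp [hcdef, hz.1, hz.2]
    rw [hc0, wedge_zero, LinearMap.zero_apply, contract₂_zero]
    -- both forms vanish on `W'`, which has codimension one, hence they are proportional
    have hs : f' η * f ξ - f' ξ * f η = 0 := by
      rcases eq_or_ne f 0 with rfl | h0
      · simp
      have h1 : f (f ξ • η - f η • ξ) = 0 := by simp [mul_comm]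
      have h2 := mem_of_apply_eq_zero h hd f (hker f hf hz.1) h0 h1
      have h3 := hker f' hf' hz.2 ⟨_, h2⟩
      have h4 : f' (f ξ • η - f η • ξ) = 0 := h3
      rw [map_sub, map_smul, map_smul, smul_eq_mul, smul_eq_mul] at h4
      rw [← h4]; ring
    rw [hs, zero_smul]
  · have hd0 : ∃ d : W', Submodule.inclusion h d = c ξ • η - c η • ξ := by
      rcases eq_or_ne c 0 with h0 | h0
      · exact ⟨0, by simp [h0]⟩
      · have h1 : c (c ξ • η - c η • ξ) = 0 := by simp [mul_comm]
        exact ⟨⟨_, mem_of_apply_eq_zero h hd c hc h0 h1⟩, rfl⟩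
    obtain ⟨d, hd0⟩ := hd0
    rw [contract₂_wedge h h' hd hd' hd₂ c hc ω ξ η d hd0]
    have e1 := smul_contract_comm h' hd' (f.comp (Submodule.inclusion h)) hf ζ d ω
    have e2 := smul_contract_comm h' hd' (f'.comp (Submodule.inclusion h)) hf' ζ d ω
    simp only [LinearMap.comp_apply, hd0] at e1 e2
    have e3 : f (c ξ • η - c η • ξ)
        = f (Submodule.inclusion h ζ) * (f' η * f ξ - f' ξ * f η) := by
      simp [hcdef]; ring
    have e4 : f' (c ξ • η - c η • ξ)
        = f' (Submodule.inclusion h ζ) * (f' η * f ξ - f' ξ * f η) := by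
      simp [hcdef]; ring
    rw [e3, mul_smul] at e1
    rw [e4, mul_smul] at e2
    by_cases h0 : f (Submodule.inclusion h ζ) = 0
    · exact smul_right_injective _ (fun h1 => hz ⟨h0, h1⟩) e2
    · exact smul_right_injective _ h0 e1

/-- Contraction and exterior multiplication anticommute. -/
lemma contract_wedge_anticomm {W₁ W₁' : Submodule ℂ E} (h1 : W₁ ≤ W) (h1' : W₁' ≤ W)
    (h0 : W'' ≤ W₁) (h0' : W'' ≤ W₁')
    (hd1 : Module.finrank ℂ W = Module.finrank ℂ W₁ + 1)
    (hd1' : Module.finrank ℂ W = Module.finrank ℂ W₁' + 1)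
    (hd0 : Module.finrank ℂ W₁ = Module.finrank ℂ W'' + 1)
    (hd0' : Module.finrank ℂ W₁' = Module.finrank ℂ W'' + 1)
    (f : W →ₗ[ℂ] ℂ) (hf : ∀ w : W₁, f (Submodule.inclusion h1 w) = 0) (ξ : W₁) (ω : TopForm W₁) :
    contract h1' hd1' (Submodule.inclusion h1 ξ) (wedge h1 hd1 f ω)
      = - wedge h0' hd0' (f.comp (Submodule.inclusion h1')) (contract h0 hd0 ξ ω) := by
  obtain ⟨η, hη⟩ : ∃ η : W₁', (η : E) ∉ W'' := by
    by_contra! hne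
    have : W₁' = W'' := le_antisymm (fun x hx => hne ⟨x, hx⟩) h0'
    subst this
    omega
  refine contract_injective h0' hd0' η hη ?_
  rw [map_neg, contract_wedge h0' hd0' η (f.comp (Submodule.inclusion h1'))
    (fun w => hf (Submodule.inclusion h0 w)), contract_contract,
    contract₂_wedge h1 h0 hd1 hd0 _ f hf ω _ _ (- (f (Submodule.inclusion h1' η) • ξ))]
  · rw [LinearMap.comp_apply]
    have : ∀ x : W₁, contract h0 hd0 (-(f (Submodule.inclusion h1' η) • x)) ω
        = - (f (Submodule.inclusion h1' η) • contract h0 hd0 x ω) := by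
      intro x
      change (AlternatingMap.curryLeft _ _).compLinearMap _ = _
      rw [map_neg, map_smul]
      rfl
    exact this ξ
  · rw [hf, zero_smul, zero_sub, map_neg, map_smul]

end DoubleContraction

end QuiverDMod

namespace QuiverDMod

/-! ### Consistency of the relations of a quiver `D`-module -/

namespace Arrangement

variable {N : ℕ} {𝒜 : Arrangement N}

lemma Vertex.finrank_T_add_l (α : 𝒜.Vertex) : Module.finrank ℂ α.T + α.l = N := by
  have := Submodule.finrank_quotient_add_finrank α.T
  rw [Module.finrank_fintype_fun_eq_card, Fintype.card_fin] at this
  unfold Vertex.l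
  omega

lemma linear_eq_zero_of_memF {α : 𝒜.Vertex} {f : (Fin N → ℂ) →ᵃ[ℂ] ℂ} (hf : α.MemF f)
    {v : Fin N → ℂ} (hv : v ∈ α.T) : f.linear v = 0 := by
  obtain ⟨x, hx⟩ := α.2.1
  have h1 := hf _ (AffineSubspace.vadd_mem_of_mem_direction hv hx)
  have h2 := f.map_vadd x v
  rw [h1, hf x hx] at h2
  simpa using h2.symm

lemma memF_of_forall {α : 𝒜.Vertex} {f : (Fin N → ℂ) →ᵃ[ℂ] ℂ} {x : Fin N → ℂ}
    (hx : x ∈ α.closedStratum) (hfx : f x = 0) (h : ∀ v ∈ α.T, f.linear v = 0) : α.MemF f := by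
  intro y hy
  have h1 := f.map_vadd x (y -ᵥ x)
  rw [h _ (AffineSubspace.vsub_mem_direction hy hx), hfx] at h1
  simpa using h1

lemma Vertex.Covers.memF {α β : 𝒜.Vertex} (h : α.Covers β) {f : (Fin N → ℂ) →ᵃ[ℂ] ℂ}
    (hf : α.MemF f) : β.MemF f := fun x hx => hf x (h.1 hx)

lemma Vertex.ext {α β : 𝒜.Vertex} (h : α.closedStratum = β.closedStratum) : α = β := Subtype.ext h

lemma Vertex.eq_of_le_of_T_le {α β : 𝒜.Vertex} {x : Fin N → ℂ} (hα : x ∈ α.closedStratum)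
    (hβ : x ∈ β.closedStratum) (h : α.T = β.T) : α = β :=
  Vertex.ext (AffineSubspace.ext_of_direction_eq h ⟨x, hα, hβ⟩)

/-- The nonempty intersection of two closed strata is a closed stratum. -/
lemma Vertex.exists_inf {α β : 𝒜.Vertex} {x : Fin N → ℂ} (hα : x ∈ α.closedStratum)
    (hβ : x ∈ β.closedStratum) :
    ∃ γ : 𝒜.Vertex, γ.closedStratum = α.closedStratum ⊓ β.closedStratum := by
  obtain ⟨L, hL, S, hS, rfl⟩ := α
  obtain ⟨L', hL', S', hS', rfl⟩ := β
  exact ⟨⟨sInf S ⊓ sInf S', ⟨x, hα, hβ⟩, S ∪ S', Set.union_subset hS hS', sInf_union.symm⟩, rfl⟩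

/-- Two different hyperplanes of a flat that do not meet in a common hyperplane are parallel. -/
lemma Vertex.T_eq_of_covers {α β γ : 𝒜.Vertex} (hα : β.Covers α) (hγ : β.Covers γ)
    (hδ : ¬ ∃ δ : 𝒜.Vertex, α.Covers δ ∧ γ.Covers δ) : α.T = γ.T := by
  by_contra hT
  have e1 := hα.finrank_eq
  have e2 := hγ.finrank_eq
  have hsup : α.T ⊔ γ.T = β.T := by
    refine Submodule.eq_of_le_of_finrank_le (sup_le hα.T_le hγ.T_le) ?_
    have hlt : α.T < α.T ⊔ γ.T := by
      refine lt_of_le_of_ne le_sup_left fun h => hT ?_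
      have : γ.T ≤ α.T := by rw [h]; exact le_sup_right
      exact (Submodule.eq_of_le_of_finrank_eq this (by omega)).symm
    have := Submodule.finrank_lt_finrank_of_lt hlt
    omega
  obtain ⟨x, hx⟩ := α.2.1
  obtain ⟨y, hy⟩ := γ.2.1
  have hxy : y -ᵥ x ∈ α.T ⊔ γ.T := by
    rw [hsup]
    exact AffineSubspace.vsub_mem_direction (hγ.1 hy) (hα.1 hx)
  obtain ⟨a, ha, b, hb, hab⟩ := Submodule.mem_sup.1 hxy
  have hz : a +ᵥ x = (-b) +ᵥ y := by
    have : y = (a + b) + x := by rw [hab]; simp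
    rw [this]
    simp only [vadd_eq_add]
    abel
  have hzα : a +ᵥ x ∈ α.closedStratum := AffineSubspace.vadd_mem_of_mem_direction ha hx
  have hzγ : a +ᵥ x ∈ γ.closedStratum := by
    rw [hz]
    exact AffineSubspace.vadd_mem_of_mem_direction (Submodule.neg_mem _ hb) hy
  obtain ⟨δ, hδ'⟩ := Vertex.exists_inf hzα hzγ
  have hδT : δ.T = α.T ⊓ γ.T := by
    change δ.closedStratum.direction = _
    rw [hδ', AffineSubspace.direction_inf_of_mem hzα hzγ]
    rfl
  have e3 := Submodule.finrank_sup_add_finrank_inf_eq α.T γ.T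
  rw [hsup, ← hδT] at e3
  have f1 := α.finrank_T_add_l
  have f2 := γ.finrank_T_add_l
  have f3 := δ.finrank_T_add_l
  refine hδ ⟨δ, ⟨hδ'.le.trans inf_le_left, by omega⟩, ⟨hδ'.le.trans inf_le_right, by omega⟩⟩

/-- The vertex below two distinct vertices of equal level is unique: it is their intersection. -/
lemma Vertex.eq_of_covers_covers {α γ δ δ' : 𝒜.Vertex} (hne : α ≠ γ)
    (h : α.Covers δ) (h' : γ.Covers δ) (k : α.Covers δ') (k' : γ.Covers δ') : δ = δ' := by
  have key : ∀ {δ : 𝒜.Vertex}, α.Covers δ → γ.Covers δ →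
      δ.closedStratum = α.closedStratum ⊓ γ.closedStratum := by
    intro δ h h'
    obtain ⟨x, hx⟩ := δ.2.1
    obtain ⟨ε, hε⟩ := Vertex.exists_inf (h.1 hx) (h'.1 hx)
    have hle : δ.closedStratum ≤ ε.closedStratum := by rw [hε]; exact le_inf h.1 h'.1
    have hεα : ε.T ≤ α.T := AffineSubspace.direction_le (hε.le.trans inf_le_left)
    have hεγ : ε.T ≤ γ.T := AffineSubspace.direction_le (hε.le.trans inf_le_right)
    have e1 := h.finrank_eq
    have e2 := h'.finrank_eq
    have hlt : ε.T < α.T := by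
      refine lt_of_le_of_ne hεα fun h0 => hne ?_
      refine Vertex.eq_of_le_of_T_le (h.1 hx) (h'.1 hx) ?_
      rw [← h0]
      exact Submodule.eq_of_le_of_finrank_eq hεγ (by rw [h0]; omega)
    have e3 := Submodule.finrank_lt_finrank_of_lt hlt
    have hδε : δ.T ≤ ε.T := AffineSubspace.direction_le hle
    rw [← hε]
    refine AffineSubspace.ext_of_direction_eq ?_ ⟨x, hx, hle hx⟩
    refine Submodule.eq_of_le_of_finrank_le hδε ?_
    change Module.finrank ℂ ε.T ≤ Module.finrank ℂ δ.T
    omega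
  exact Vertex.ext ((key h h').trans (key k k').symm)

variable (Q : 𝒜.Quiver)

lemma Quiver.adj_of_comp_ne_zero {α β γ : 𝒜.Vertex} {v : Q.V α} (h : Q.A γ β (Q.A β α v) ≠ 0) :
    γ.Adj β ∧ β.Adj α := by
  constructor
  · by_contra hn
    exact h (by rw [Q.zero_of_not_adj _ _ hn, LinearMap.zero_apply])
  · by_contra hn
    exact h (by rw [Q.zero_of_not_adj _ _ hn, LinearMap.zero_apply, map_zero])

/-- The map `Ω̄_α ⊗ V_α → Ω̄_β ⊗ V_β`, `α ≻ β`, in the relation given by `ξ ∈ T_α`. It does not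
involve the framing, since `⟨ξ, f_{β,α}⟩ π_{β,α}(ω) = (i_ξ ω)|_{T_β}`. -/
def stepV (α β : 𝒜.Vertex) (ξ : α.T) : α.Omega ⊗[ℂ] Q.V α →ₗ[ℂ] β.Omega ⊗[ℂ] Q.V β :=
  open Classical in
  if h : α.Covers β then TensorProduct.map (contract h.T_le h.finrank_eq ξ) (Q.A β α) else 0

/-- The map `Ω̄_α ⊗ V_α → Ω̄_β ⊗ V_β`, `β ≻ α`, in the relation given by `f ∈ F_α`. It does not
involve the framing, since `⟨ξ_{β,α}, f⟩ π_{β,α}(ω) = df ∧ ω`. -/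
def stepF (α β : 𝒜.Vertex) (f : (Fin N → ℂ) →ᵃ[ℂ] ℂ) :
    α.Omega ⊗[ℂ] Q.V α →ₗ[ℂ] β.Omega ⊗[ℂ] Q.V β :=
  open Classical in
  if h : β.Covers α then TensorProduct.map (wedge h.T_le h.finrank_eq (dOn β f)) (Q.A β α) else 0

variable {Q}

lemma stepV_tmul {α β : 𝒜.Vertex} (h : α.Covers β) (ξ : α.T) (ω : α.Omega) (v : Q.V α) :
    stepV Q α β ξ (ω ⊗ₜ v) = contract h.T_le h.finrank_eq ξ ω ⊗ₜ Q.A β α v := by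
  rw [stepV, dif_pos h, TensorProduct.map_tmul]

lemma stepV_of_not {α β : 𝒜.Vertex} (h : ¬ α.Covers β) (ξ : α.T) : stepV Q α β ξ = 0 := by
  rw [stepV, dif_neg h]

lemma stepF_tmul {α β : 𝒜.Vertex} (h : β.Covers α) (f : (Fin N → ℂ) →ᵃ[ℂ] ℂ) (ω : α.Omega)
    (v : Q.V α) :
    stepF Q α β f (ω ⊗ₜ v) = wedge h.T_le h.finrank_eq (dOn β f) ω ⊗ₜ Q.A β α v := by
  rw [stepF, dif_pos h, TensorProduct.map_tmul]

lemma stepF_of_not {α β : 𝒜.Vertex} (h : ¬ β.Covers α) (f : (Fin N → ℂ) →ᵃ[ℂ] ℂ) :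
    stepF Q α β f = 0 := by
  rw [stepF, dif_neg h]

variable (Q)

/-- The element `u ⊗ w` of the free module. -/
def gen (u : DX N) (α : 𝒜.Vertex) : α.Omega ⊗[ℂ] Q.V α →ₗ[ℂ] FreeModule Q :=
  (TensorProduct.mk ℂ (DX N) (Generators Q) u).comp (incl Q α)

/-- The relation given by `ξ ∈ T_α`. -/
def relV (α : 𝒜.Vertex) (ξ : α.T) : α.Omega ⊗[ℂ] Q.V α →ₗ[ℂ] FreeModule Q :=
  gen Q (vectorField (ξ : Fin N → ℂ)) α - ∑ β, (gen Q 1 β).comp (stepV Q α β ξ)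

/-- The relation given by `f ∈ F_α`. -/
def relF (α : 𝒜.Vertex) (f : (Fin N → ℂ) →ᵃ[ℂ] ℂ) : α.Omega ⊗[ℂ] Q.V α →ₗ[ℂ] FreeModule Q :=
  gen Q (mulOp N (affinePoly f)) α - ∑ β, (gen Q 1 β).comp (stepF Q α β f)

/-- The complex vector space spanned by the relations `relV` and `relF`. -/
def relSpace : Submodule ℂ (FreeModule Q) :=
  Submodule.span ℂ ({x | ∃ α ξ w, x = relV Q α ξ w} ∪ {x | ∃ α f w, α.MemF f ∧ x = relF Q α f w})

variable {Q}

lemma relV_mem (α : 𝒜.Vertex) (ξ : α.T) (w : α.Omega ⊗[ℂ] Q.V α) : relV Q α ξ w ∈ relSpace Q :=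
  Submodule.subset_span (Or.inl ⟨α, ξ, w, rfl⟩)

lemma relF_mem {α : 𝒜.Vertex} {f : (Fin N → ℂ) →ᵃ[ℂ] ℂ} (hf : α.MemF f)
    (w : α.Omega ⊗[ℂ] Q.V α) : relF Q α f w ∈ relSpace Q :=
  Submodule.subset_span (Or.inr ⟨α, f, w, hf, rfl⟩)

lemma relV_apply (α : 𝒜.Vertex) (ξ : α.T) (w : α.Omega ⊗[ℂ] Q.V α) :
    relV Q α ξ w = gen Q (vectorField (ξ : Fin N → ℂ)) α w
      - ∑ β, gen Q 1 β (stepV Q α β ξ w) := by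
  simp [relV]

lemma relF_apply (α : 𝒜.Vertex) (f : (Fin N → ℂ) →ᵃ[ℂ] ℂ) (w : α.Omega ⊗[ℂ] Q.V α) :
    relF Q α f w = gen Q (mulOp N (affinePoly f)) α w
      - ∑ β, gen Q 1 β (stepF Q α β f w) := by
  simp [relF]

lemma smul_gen (u u' : DX N) (α : 𝒜.Vertex) (w : α.Omega ⊗[ℂ] Q.V α) :
    u • gen Q u' α w = gen Q (u * u') α w := rfl

lemma gen_add (u u' : DX N) (α : 𝒜.Vertex) (w : α.Omega ⊗[ℂ] Q.V α) :
    gen Q (u + u') α w = gen Q u α w + gen Q u' α w := TensorProduct.add_tmul _ _ _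

lemma gen_sub (u u' : DX N) (α : 𝒜.Vertex) (w : α.Omega ⊗[ℂ] Q.V α) :
    gen Q (u - u') α w = gen Q u α w - gen Q u' α w := TensorProduct.sub_tmul _ _ _

lemma gen_smul (c : ℂ) (u : DX N) (α : 𝒜.Vertex) (w : α.Omega ⊗[ℂ] Q.V α) :
    gen Q (c • u) α w = c • gen Q u α w := rfl

/-- A sum of terms, each of which reduces to terms of length zero modulo the relations, lies in the
span of the relations as soon as these terms cancel. -/
lemma sum_mem_relSpace (X : 𝒜.Vertex → FreeModule Q)
    (Z : 𝒜.Vertex → ∀ γ : 𝒜.Vertex, γ.Omega ⊗[ℂ] Q.V γ)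
    (hX : ∀ β, X β - ∑ γ, gen Q 1 γ (Z β γ) ∈ relSpace Q) (hZ : ∀ γ, ∑ β, Z β γ = 0) :
    ∑ β, X β ∈ relSpace Q := by
  have h := Submodule.sum_mem (relSpace Q) fun β (_ : β ∈ Finset.univ) => hX β
  rw [Finset.sum_sub_distrib, Finset.sum_comm] at h
  simpa [← map_sum, hZ] using h

/-- If the terms at `γ` carry one and the same form, the vanishing of `∑_β A_{γ,β} A_{β,α}` makes them
cancel. -/
lemma sum_tmul_eq_zero {α γ : 𝒜.Vertex} (v : Q.V α)
    (hQ : ∑ β, (Q.A γ β).comp (Q.A β α) = 0) (κ : γ.Omega) (Z : 𝒜.Vertex → γ.Omega ⊗[ℂ] Q.V γ)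
    (hZ : ∀ β, Z β = κ ⊗ₜ Q.A γ β (Q.A β α v)) : ∑ β, Z β = 0 := by
  have h := LinearMap.congr_fun hQ v
  simp only [LinearMap.sum_apply, LinearMap.comp_apply, LinearMap.zero_apply] at h
  rw [Finset.sum_congr rfl fun β _ => hZ β, ← TensorProduct.tmul_sum, h, TensorProduct.tmul_zero]

end Arrangement

end QuiverDMod

namespace QuiverDMod

namespace Arrangement

variable {N : ℕ} {𝒜 : Arrangement N} {Q : 𝒜.Quiver}

lemma Vertex.Covers.exists_notMem {α β : 𝒜.Vertex} (h : α.Covers β) :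
    ∃ ζ : α.T, (ζ : Fin N → ℂ) ∉ β.T := by
  by_contra! hne
  have hle : α.T ≤ β.T := fun x hx => hne ⟨x, hx⟩
  have e := h.finrank_eq
  rw [le_antisymm hle h.T_le] at e
  omega

lemma Vertex.Covers.exists_form {α β : 𝒜.Vertex} (h : α.Covers β) :
    ∃ φ : α.T →ₗ[ℂ] ℂ, φ ≠ 0 ∧ ∀ w : β.T, φ (Submodule.inclusion h.T_le w) = 0 := by
  obtain ⟨ζ, hζ⟩ := h.exists_notMem
  obtain ⟨g, hg, hg0⟩ := Submodule.exists_le_ker_of_notMem hζ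
  exact ⟨g.comp α.T.subtype, fun h0 => hg (LinearMap.congr_fun h0 ζ), fun w => hg0 w.2⟩

/-- Consistency of the relations given by two vector fields. Two steps down `α ≻ β ≻ γ` contract `ω`
with `ξ` and `ξ'`, which gives an element of `Ω̄_γ` that does not depend on `β`; hence the terms at `γ`
add up to a multiple of `∑_β A_{γ,β} A_{β,α} = 0`. -/
lemma vectorField_consistency (α : 𝒜.Vertex) (ξ ξ' : α.T) (w : α.Omega ⊗[ℂ] Q.V α) :
    vectorField (ξ : Fin N → ℂ) • relV Q α ξ' w - vectorField (ξ' : Fin N → ℂ) • relV Q α ξ w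
      ∈ relSpace Q := by
  induction w using TensorProduct.induction_on with
  | zero => simp
  | add w w' h h' =>
    rw [map_add, map_add, smul_add, smul_add, add_sub_add_comm]
    exact Submodule.add_mem _ h h'
  | tmul ω v =>
  have e : vectorField (ξ : Fin N → ℂ) • relV Q α ξ' (ω ⊗ₜ v)
      - vectorField (ξ' : Fin N → ℂ) • relV Q α ξ (ω ⊗ₜ v)
      = ∑ β, (gen Q (vectorField (ξ' : Fin N → ℂ)) β (stepV Q α β ξ (ω ⊗ₜ v))
          - gen Q (vectorField (ξ : Fin N → ℂ)) β (stepV Q α β ξ' (ω ⊗ₜ v))) := by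
    simp only [relV_apply, smul_sub, Finset.smul_sum, smul_gen, mul_one, Finset.sum_sub_distrib]
    rw [vectorField_comm]
    abel
  rw [e]
  classical
  let Z : 𝒜.Vertex → ∀ γ : 𝒜.Vertex, γ.Omega ⊗[ℂ] Q.V γ := fun β γ =>
    if h : α.Covers β ∧ β.Covers γ then
      contract₂ (h.2.T_le.trans h.1.T_le) (h.1.finrank_eq.trans (congrArg (· + 1) h.2.finrank_eq))
        ξ ξ' ω ⊗ₜ Q.A γ β (Q.A β α v)
    else 0
  refine sum_mem_relSpace _ Z (fun β => ?_) (fun γ => ?_)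
  · by_cases hβ : α.Covers β
    · obtain ⟨φ, hφ0, hφ⟩ := hβ.exists_form
      obtain ⟨ω', rfl⟩ := (wedge_bijective hβ.T_le hβ.finrank_eq φ hφ hφ0).2 ω
      have h1 : φ (φ ξ • ξ' - φ ξ' • ξ) = 0 := by simp [mul_comm]
      let c : β.T := ⟨_, mem_of_apply_eq_zero hβ.T_le hβ.finrank_eq φ hφ hφ0 h1⟩
      have hcv : (c : Fin N → ℂ) = φ ξ • (ξ' : Fin N → ℂ) - φ ξ' • (ξ : Fin N → ℂ) := rfl
      have hc : Submodule.inclusion hβ.T_le c = φ ξ • ξ' - φ ξ' • ξ := rfl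
      have e2 : gen Q (vectorField (ξ' : Fin N → ℂ)) β
            (stepV Q α β ξ (wedge hβ.T_le hβ.finrank_eq φ ω' ⊗ₜ v))
          - gen Q (vectorField (ξ : Fin N → ℂ)) β
            (stepV Q α β ξ' (wedge hβ.T_le hβ.finrank_eq φ ω' ⊗ₜ v))
          = gen Q (vectorField (c : Fin N → ℂ)) β (ω' ⊗ₜ Q.A β α v) := by
        rw [stepV_tmul hβ, stepV_tmul hβ, contract_wedge _ _ _ _ hφ, contract_wedge _ _ _ _ hφ,
          hcv, ← vectorFieldHom_apply, ← vectorFieldHom_apply, ← vectorFieldHom_apply, map_sub,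
          map_smul, map_smul, gen_sub, gen_smul, gen_smul, ← TensorProduct.smul_tmul',
          ← TensorProduct.smul_tmul', map_smul, map_smul]
      have e3 : ∀ γ, Z β γ = stepV Q β γ c (ω' ⊗ₜ Q.A β α v) := by
        intro γ
        by_cases hγ : β.Covers γ
        · rw [stepV_tmul hγ]
          simp only [Z]
          rw [dif_pos ⟨hβ, hγ⟩, contract₂_wedge hβ.T_le hγ.T_le hβ.finrank_eq hγ.finrank_eq _ φ hφ ω'
            ξ ξ' c hc]
        · rw [stepV_of_not hγ, LinearMap.zero_apply]
          exact dif_neg fun h => hγ h.2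
      rw [e2]
      simp only [e3]
      rw [← relV_apply]
      exact relV_mem _ _ _
    · have hz : ∀ γ, Z β γ = 0 := fun γ => dif_neg fun h => hβ h.1
      simp [hz, stepV_of_not hβ]
  · by_cases hex : ∃ β, α.Covers β ∧ β.Covers γ
    · obtain ⟨β₀, h₀⟩ := hex
      have l1 := h₀.1.2
      have l2 := h₀.2.2
      refine sum_tmul_eq_zero v ?_ (contract₂ (h₀.2.T_le.trans h₀.1.T_le)
        (h₀.1.finrank_eq.trans (congrArg (· + 1) h₀.2.finrank_eq)) ξ ξ' ω) _ (fun β => ?_)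
      · refine Q.sum_eq_zero_of_two γ α ?_
        rw [l2, l1]
        push_cast
        norm_num [add_assoc]
      · by_cases h : α.Covers β ∧ β.Covers γ
        · exact dif_pos h
        · have h0 : Q.A γ β (Q.A β α v) = 0 := by
            by_contra hne
            obtain ⟨a1, a2⟩ := Q.adj_of_comp_ne_zero hne
            apply h
            rcases a1 with a1 | a1 <;> rcases a2 with a2 | a2
            · have := a1.2; have := a2.2; omega
            · have := a1.2; have := a2.2; omega
            · have := a1.2; have := a2.2; omega
            · exact ⟨a2, a1⟩
          rw [h0, TensorProduct.tmul_zero]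
          exact dif_neg h
    · push Not at hex
      exact Finset.sum_eq_zero fun β _ => dif_neg fun h => hex β h.1 h.2

lemma affinePoly_sub (f g : (Fin N → ℂ) →ᵃ[ℂ] ℂ) :
    affinePoly (f - g) = affinePoly f - affinePoly g := by
  refine MvPolynomial.funext fun x => ?_
  simp [eval_affinePoly]

lemma affinePoly_smul (c : ℂ) (f : (Fin N → ℂ) →ᵃ[ℂ] ℂ) :
    affinePoly (c • f) = c • affinePoly f := by
  refine MvPolynomial.funext fun x => ?_
  simp [eval_affinePoly, MvPolynomial.smul_eval]

/-- Consistency of the relations given by two affine functions. As for vector fields, the form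
obtained at `γ` along `γ ≻ β ≻ α`, here a wedge product with `df` and `df'`, does not depend on `β`. -/
lemma affine_consistency (α : 𝒜.Vertex) {f f' : (Fin N → ℂ) →ᵃ[ℂ] ℂ} (hf : α.MemF f)
    (hf' : α.MemF f') (w : α.Omega ⊗[ℂ] Q.V α) :
    mulOp N (affinePoly f) • relF Q α f' w - mulOp N (affinePoly f') • relF Q α f w
      ∈ relSpace Q := by
  induction w using TensorProduct.induction_on with
  | zero => simp
  | add w w' h h' =>
    rw [map_add, map_add, smul_add, smul_add, add_sub_add_comm]
    exact Submodule.add_mem _ h h'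
  | tmul ω v =>
  have e : mulOp N (affinePoly f) • relF Q α f' (ω ⊗ₜ v)
      - mulOp N (affinePoly f') • relF Q α f (ω ⊗ₜ v)
      = ∑ β, (gen Q (mulOp N (affinePoly f')) β (stepF Q α β f (ω ⊗ₜ v))
          - gen Q (mulOp N (affinePoly f)) β (stepF Q α β f' (ω ⊗ₜ v))) := by
    simp only [relF_apply, smul_sub, Finset.smul_sum, smul_gen, mul_one, Finset.sum_sub_distrib]
    rw [mulOp_comm]
    abel
  rw [e]
  classical
  -- for `β ≻ α`, a vector of `T_β` outside `T_α` and the affine function vanishing on it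
  have hζ : ∀ β : 𝒜.Vertex, β.Covers α → ∃ ζ : β.T, (ζ : Fin N → ℂ) ∉ α.T := fun β h =>
    h.exists_notMem
  choose ζ hζ using hζ
  let g : ∀ β : 𝒜.Vertex, β.Covers α → (Fin N → ℂ) →ᵃ[ℂ] ℂ := fun β h =>
    f.linear (ζ β h) • f' - f'.linear (ζ β h) • f
  have hg : ∀ (β : 𝒜.Vertex) (h : β.Covers α), β.MemF (g β h) := by
    intro β h
    obtain ⟨x, hx⟩ := α.2.1
    refine memF_of_forall (h.1 hx) ?_ ?_
    · have h1 := hf x hx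
      have h2 := hf' x hx
      simp [g, h1, h2]
    · intro u hu
      by_contra hne
      have h0 : dOn β (g β h) ≠ 0 := fun h0 => hne (LinearMap.congr_fun h0 ⟨u, hu⟩)
      refine hζ β h (mem_of_apply_eq_zero h.T_le h.finrank_eq (dOn β (g β h)) (fun w => ?_) h0 ?_)
      · have h1 : f.linear w = 0 := linear_eq_zero_of_memF hf w.2
        have h2 : f'.linear w = 0 := linear_eq_zero_of_memF hf' w.2
        simp [g, dOn, h1, h2]
      · simp [g, dOn, mul_comm]
  -- the form on `T_β` whose contraction with this vector is `ω`
  have hω' : ∀ (β : 𝒜.Vertex) (h : β.Covers α), ∃ ω' : β.Omega,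
      contract h.T_le h.finrank_eq (ζ β h) ω' = ω := fun β h =>
    (contract_bijective h.T_le h.finrank_eq _ (hζ β h)).2 ω
  choose ω' hω' using hω'
  have hw : ∀ (β : 𝒜.Vertex) (h : β.Covers α) (k : (Fin N → ℂ) →ᵃ[ℂ] ℂ), α.MemF k →
      wedge h.T_le h.finrank_eq (dOn β k) ω = k.linear (ζ β h) • ω' β h := by
    intro β h k hk
    refine contract_injective h.T_le h.finrank_eq _ (hζ β h) ?_
    rw [contract_wedge _ _ _ _ (fun w => linear_eq_zero_of_memF hk w.2), map_smul, hω']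
    rfl
  let Z : 𝒜.Vertex → ∀ γ : 𝒜.Vertex, γ.Omega ⊗[ℂ] Q.V γ := fun β γ =>
    if h : β.Covers α ∧ γ.Covers β then
      wedge h.2.T_le h.2.finrank_eq (dOn γ (g β h.1)) (ω' β h.1) ⊗ₜ Q.A γ β (Q.A β α v)
    else 0
  refine sum_mem_relSpace _ Z (fun β => ?_) (fun γ => ?_)
  · by_cases hβ : β.Covers α
    · have e2 : gen Q (mulOp N (affinePoly f')) β (stepF Q α β f (ω ⊗ₜ v))
          - gen Q (mulOp N (affinePoly f)) β (stepF Q α β f' (ω ⊗ₜ v))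
          = gen Q (mulOp N (affinePoly (g β hβ))) β (ω' β hβ ⊗ₜ Q.A β α v) := by
        rw [stepF_tmul hβ, stepF_tmul hβ, hw β hβ f hf, hw β hβ f' hf', affinePoly_sub,
          affinePoly_smul, affinePoly_smul, map_sub, mulOp_smul_complex, mulOp_smul_complex,
          gen_sub, gen_smul, gen_smul, ← TensorProduct.smul_tmul', ← TensorProduct.smul_tmul',
          map_smul, map_smul]
      have e3 : ∀ γ, Z β γ = stepF Q β γ (g β hβ) (ω' β hβ ⊗ₜ Q.A β α v) := by
        intro γ
        by_cases hγ : γ.Covers β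
        · rw [stepF_tmul hγ]
          exact dif_pos ⟨hβ, hγ⟩
        · rw [stepF_of_not hγ, LinearMap.zero_apply]
          exact dif_neg fun h => hγ h.2
      rw [e2]
      simp only [e3]
      rw [← relF_apply]
      exact relF_mem (hg β hβ) _
    · have hz : ∀ γ, Z β γ = 0 := fun γ => dif_neg fun h => hβ h.1
      simp [hz, stepF_of_not hβ]
  · by_cases hex : ∃ β, β.Covers α ∧ γ.Covers β
    · obtain ⟨β₀, h₀⟩ := hex
      have l1 := h₀.1.2
      have l2 := h₀.2.2
      refine sum_tmul_eq_zero v ?_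
        (wedge h₀.2.T_le h₀.2.finrank_eq (dOn γ (g β₀ h₀.1)) (ω' β₀ h₀.1)) _ (fun β => ?_)
      · refine Q.sum_eq_zero_of_two γ α ?_
        rw [l1, l2]
        push_cast
        norm_num [add_assoc]
      · by_cases h : β.Covers α ∧ γ.Covers β
        · have hval : ∀ (β : 𝒜.Vertex) (h : β.Covers α ∧ γ.Covers β) (ξ η : γ.T),
              contract₂ (h.1.T_le.trans h.2.T_le)
                (h.2.finrank_eq.trans (congrArg (· + 1) h.1.finrank_eq)) ξ η
                (wedge h.2.T_le h.2.finrank_eq (dOn γ (g β h.1)) (ω' β h.1))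
                = (dOn γ f η * dOn γ f' ξ - dOn γ f ξ * dOn γ f' η) • ω := by
            intro β h ξ η
            have := contract₂_wedge_of_contract h.2.T_le h.1.T_le h.2.finrank_eq h.1.finrank_eq
              (h.2.finrank_eq.trans (congrArg (· + 1) h.1.finrank_eq)) (dOn γ f') (dOn γ f)
              (fun w => linear_eq_zero_of_memF hf' w.2) (fun w => linear_eq_zero_of_memF hf w.2)
              (ζ β h.1) (hζ β h.1) (ω' β h.1) ξ η
            rw [hω'] at this
            rw [← this]
            rfl
          have heq : wedge h.2.T_le h.2.finrank_eq (dOn γ (g β h.1)) (ω' β h.1)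
              = wedge h₀.2.T_le h₀.2.finrank_eq (dOn γ (g β₀ h₀.1)) (ω' β₀ h₀.1) := by
            refine contract₂_ext h.2.T_le h.1.T_le h.2.finrank_eq h.1.finrank_eq
              (h.2.finrank_eq.trans (congrArg (· + 1) h.1.finrank_eq)) fun ξ η => ?_
            rw [hval β h]
            exact (hval β₀ h₀ ξ η).symm
          rw [← heq]
          exact dif_pos h
        · have h0 : Q.A γ β (Q.A β α v) = 0 := by
            by_contra hne
            obtain ⟨a1, a2⟩ := Q.adj_of_comp_ne_zero hne
            apply h
            rcases a1 with a1 | a1 <;> rcases a2 with a2 | a2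
            · exact ⟨a2, a1⟩
            · have := a1.2; have := a2.2; omega
            · have := a1.2; have := a2.2; omega
            · have := a1.2; have := a2.2; omega
          rw [h0, TensorProduct.tmul_zero]
          exact dif_neg h
    · push Not at hex
      exact Finset.sum_eq_zero fun β _ => dif_neg fun h => hex β h.1 h.2

/-- Consistency of the relations given by a vector field and an affine function. If `γ ≠ α`, the paths
from `α` to `γ` through the larger and through the smaller flat carry the same form, because `i_ξ` and
`df ∧` anticommute, and the quiver axiom on vertices of equal level applies. If `γ = α`, or if
no flat lies below both, so that `α` and `γ` are parallel, then every form is zero, because `f` is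
constant along `T_α` and `ξ` lies in `T_γ`. -/
lemma mixed_consistency (α : 𝒜.Vertex) (ξ : α.T) {f : (Fin N → ℂ) →ᵃ[ℂ] ℂ} (hf : α.MemF f)
    (w : α.Omega ⊗[ℂ] Q.V α) :
    mulOp N (affinePoly f) • relV Q α ξ w - vectorField (ξ : Fin N → ℂ) • relF Q α f w
      ∈ relSpace Q := by
  induction w using TensorProduct.induction_on with
  | zero => simp
  | add w w' h h' =>
    rw [map_add, map_add, smul_add, smul_add, add_sub_add_comm]
    exact Submodule.add_mem _ h h'
  | tmul ω v =>
  have e : mulOp N (affinePoly f) • relV Q α ξ (ω ⊗ₜ v)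
      - vectorField (ξ : Fin N → ℂ) • relF Q α f (ω ⊗ₜ v)
      = ∑ β, (gen Q (vectorField (ξ : Fin N → ℂ)) β (stepF Q α β f (ω ⊗ₜ v))
          - gen Q (mulOp N (affinePoly f)) β (stepV Q α β ξ (ω ⊗ₜ v))) := by
    simp only [relF_apply, relV_apply, smul_sub, Finset.smul_sum, smul_gen, mul_one,
      Finset.sum_sub_distrib]
    rw [vectorField_mul_affine, linear_eq_zero_of_memF hf ξ.2, map_zero, add_zero]
    abel
  rw [e]
  classical
  let Z : 𝒜.Vertex → ∀ γ : 𝒜.Vertex, γ.Omega ⊗[ℂ] Q.V γ := fun β γ =>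
    (if h : β.Covers α then
      stepV Q β γ (Submodule.inclusion h.T_le ξ) (stepF Q α β f (ω ⊗ₜ v)) else 0)
    - stepF Q β γ f (stepV Q α β ξ (ω ⊗ₜ v))
  refine sum_mem_relSpace _ Z (fun β => ?_) (fun γ => ?_)
  · by_cases hu : β.Covers α
    · have hd : ¬ α.Covers β := fun h => by have := h.2; have := hu.2; omega
      have hz : ∀ γ, Z β γ
          = stepV Q β γ (Submodule.inclusion hu.T_le ξ) (stepF Q α β f (ω ⊗ₜ v)) := by
        intro γ
        simp [Z, hu, stepV_of_not hd]
      simp only [hz, stepV_of_not hd, LinearMap.zero_apply, map_zero, sub_zero]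
      have hm := relV_mem β (Submodule.inclusion hu.T_le ξ) (stepF Q α β f (ω ⊗ₜ v))
      rw [relV_apply] at hm
      exact hm
    · by_cases hd : α.Covers β
      · have hz : ∀ γ, Z β γ = - stepF Q β γ f (stepV Q α β ξ (ω ⊗ₜ v)) := by
          intro γ
          simp [Z, hu]
        simp only [hz, stepF_of_not hu, LinearMap.zero_apply, map_zero, zero_sub, map_neg,
          Finset.sum_neg_distrib]
        rw [neg_sub_neg, ← neg_sub, ← relF_apply]
        exact Submodule.neg_mem _ (relF_mem (hd.memF hf) _)
      · have hz : ∀ γ, Z β γ = 0 := by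
          intro γ
          simp [Z, hu, stepV_of_not hd]
        simp [hz, stepV_of_not hd, stepF_of_not hu]
  · -- the paths from `α` through a larger flat `β`
    have hup : ∀ β (hu : β.Covers α) (hγ : β.Covers γ), Z β γ
        = contract hγ.T_le hγ.finrank_eq (Submodule.inclusion hu.T_le ξ)
          (wedge hu.T_le hu.finrank_eq (dOn β f) ω) ⊗ₜ Q.A γ β (Q.A β α v) := by
      intro β hu hγ
      have hd : ¬ α.Covers β := fun h => by have := h.2; have := hu.2; omega
      simp only [Z]
      rw [dif_pos hu, stepF_tmul hu, stepV_tmul hγ, stepV_of_not hd]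
      simp
    -- the paths from `α` through a smaller flat `β`
    have hdown : ∀ β (hd : α.Covers β) (hγ : γ.Covers β), Z β γ
        = (- wedge hγ.T_le hγ.finrank_eq (dOn γ f) (contract hd.T_le hd.finrank_eq ξ ω))
          ⊗ₜ Q.A γ β (Q.A β α v) := by
      intro β hd hγ
      have hu : ¬ β.Covers α := fun h => by have := h.2; have := hd.2; omega
      simp only [Z]
      rw [dif_neg hu, stepV_tmul hd, stepF_tmul hγ, zero_sub, TensorProduct.neg_tmul]
    have hother : ∀ β, ¬ (β.Covers α ∧ β.Covers γ) → ¬ (α.Covers β ∧ γ.Covers β) → Z β γ = 0 := by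
      intro β h1 h2
      have e1 : (if h : β.Covers α then
          stepV Q β γ (Submodule.inclusion h.T_le ξ) (stepF Q α β f (ω ⊗ₜ v)) else 0) = 0 := by
        split_ifs with h
        · rw [stepV_of_not fun h' => h1 ⟨h, h'⟩, LinearMap.zero_apply]
        · rfl
      have e2 : stepF Q β γ f (stepV Q α β ξ (ω ⊗ₜ v)) = 0 := by
        by_cases h : α.Covers β
        · rw [stepF_of_not fun h' => h2 ⟨h, h'⟩, LinearMap.zero_apply]
        · rw [stepV_of_not h, LinearMap.zero_apply, map_zero]
      simp only [Z, e1, e2, sub_zero]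
    by_cases hαγ : γ = α
    · subst hαγ
      refine Finset.sum_eq_zero fun β _ => ?_
      by_cases hu : β.Covers γ
      · rw [hup β hu hu, contract_eq_zero_of_mem _ _ _ (show ((Submodule.inclusion hu.T_le ξ : β.T)
          : Fin N → ℂ) ∈ γ.T from ξ.2), LinearMap.zero_apply, TensorProduct.zero_tmul]
      · by_cases hd : γ.Covers β
        · have h0 : dOn γ f = 0 := LinearMap.ext fun w => linear_eq_zero_of_memF hf w.2
          rw [hdown β hd hd, h0, wedge_zero, LinearMap.zero_apply, neg_zero,
            TensorProduct.zero_tmul]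
        · exact hother β (fun h => hu h.1) (fun h => hd h.1)
    · by_cases hδ : ∃ δ : 𝒜.Vertex, γ.Covers δ ∧ α.Covers δ
      · obtain ⟨δ, hγδ, hαδ⟩ := hδ
        have l1 := hγδ.2
        have l2 := hαδ.2
        refine sum_tmul_eq_zero v
          (Q.sum_eq_zero_of_same γ α (by omega) hαγ ⟨δ, hγδ, hαδ⟩)
          (- wedge hγδ.T_le hγδ.finrank_eq (dOn γ f) (contract hαδ.T_le hαδ.finrank_eq ξ ω)) _
          (fun β => ?_)
        by_cases h1 : β.Covers α ∧ β.Covers γ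
        · rw [hup β h1.1 h1.2]
          congr 1
          exact contract_wedge_anticomm h1.1.T_le h1.2.T_le hαδ.T_le hγδ.T_le h1.1.finrank_eq
            h1.2.finrank_eq hαδ.finrank_eq hγδ.finrank_eq (dOn β f)
            (fun w => linear_eq_zero_of_memF hf w.2) ξ ω
        · by_cases h2 : α.Covers β ∧ γ.Covers β
          · obtain rfl := Vertex.eq_of_covers_covers hαγ hγδ hαδ h2.2 h2.1
            rw [hdown _ h2.1 h2.2]
          · have h0 : Q.A γ β (Q.A β α v) = 0 := by
              by_contra hne
              obtain ⟨a1, a2⟩ := Q.adj_of_comp_ne_zero hne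
              rcases a1 with a1 | a1 <;> rcases a2 with a2 | a2
              · have := a1.2; have := a2.2; omega
              · exact h2 ⟨a2, a1⟩
              · exact h1 ⟨a2, a1⟩
              · have := a1.2; have := a2.2; omega
            rw [h0, TensorProduct.tmul_zero]
            exact hother β h1 h2
      · refine Finset.sum_eq_zero fun β _ => ?_
        by_cases h1 : β.Covers α ∧ β.Covers γ
        · have hT := Vertex.T_eq_of_covers h1.2 h1.1 hδ
          rw [hup β h1.1 h1.2, contract_eq_zero_of_mem _ _ _ (show ((Submodule.inclusion
            h1.1.T_le ξ : β.T) : Fin N → ℂ) ∈ γ.T by rw [hT]; exact ξ.2), LinearMap.zero_apply,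
            TensorProduct.zero_tmul]
        · exact hother β h1 fun h2 => hδ ⟨β, h2.2, h2.1⟩

end Arrangement

end QuiverDMod

namespace QuiverDMod

/-! ### The relations in adapted frames -/

section TopForms

variable {E : Type*} [AddCommGroup E] [Module ℂ E] {W W' : Submodule ℂ E}

instance [FiniteDimensional ℂ E] (W : Submodule ℂ E) : Module.Finite ℂ (TopForm W) := by
  let b := Module.finBasis ℂ W
  refine Module.Finite.of_injective
    ({ toFun := fun ω => ω b, map_add' := fun _ _ => rfl, map_smul' := fun _ _ => rfl } :
      TopForm W →ₗ[ℂ] ℂ) ?_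
  rw [injective_iff_map_eq_zero]
  intro ω hω
  exact (AlternatingMap.map_basis_eq_zero_iff b ω).1 hω

lemma contract_add (hle : W' ≤ W) (hd : Module.finrank ℂ W = Module.finrank ℂ W' + 1) (ξ η : W) :
    contract hle hd (ξ + η) = contract hle hd ξ + contract hle hd η := by
  ext1 ω
  change (AlternatingMap.curryLeft _ _).compLinearMap _ = _
  rw [map_add]
  rfl

lemma contract_smul (hle : W' ≤ W) (hd : Module.finrank ℂ W = Module.finrank ℂ W' + 1) (c : ℂ)
    (ξ : W) : contract hle hd (c • ξ) = c • contract hle hd ξ := by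
  ext1 ω
  change (AlternatingMap.curryLeft _ _).compLinearMap _ = _
  rw [map_smul]
  rfl

lemma wedge_add (hle : W' ≤ W) (hd : Module.finrank ℂ W = Module.finrank ℂ W' + 1)
    (φ ψ : W →ₗ[ℂ] ℂ) : wedge hle hd (φ + ψ) = wedge hle hd φ + wedge hle hd ψ := by
  ext ω x
  simp [wedge, AlternatingMap.alternatizeUncurryFin_apply, add_mul, Finset.sum_add_distrib]

lemma wedge_smul (hle : W' ≤ W) (hd : Module.finrank ℂ W = Module.finrank ℂ W' + 1) (c : ℂ)
    (φ : W →ₗ[ℂ] ℂ) : wedge hle hd (c • φ) = c • wedge hle hd φ := by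
  ext ω x
  simp [wedge, AlternatingMap.alternatizeUncurryFin_apply, mul_assoc, mul_left_comm,
    Finset.mul_sum]

end TopForms

namespace Arrangement

variable {N : ℕ} {𝒜 : Arrangement N}

/-- The frame `fr` is adapted to the flat `α`: its origin lies on the flat, the coordinates with
index in `S` cut out the flat, and the other basis vectors are parallel to it. -/
structure IsAdapted (fr : Frame N) (α : 𝒜.Vertex) : Prop where
  o_mem : fr.o ∈ α.closedStratum
  y_memF : ∀ i ∈ fr.S, α.MemF (fr.y i)
  η_mem : ∀ i ∉ fr.S, fr.η i ∈ α.T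
  card_S : fr.S.card = α.l

lemma exists_isAdapted (α : 𝒜.Vertex) : ∃ fr : Frame N, IsAdapted fr α := by
  obtain ⟨o, ho⟩ := α.2.1
  obtain ⟨C, hC⟩ := Submodule.exists_isCompl α.T
  let bT := Module.finBasis ℂ α.T
  let bC := Module.finBasis ℂ C
  let b := (bT.prod bC).map (Submodule.prodEquivOfIsCompl _ _ hC)
  have hTC := Submodule.finrank_add_eq_of_isCompl hC
  rw [Module.finrank_fintype_fun_eq_card, Fintype.card_fin] at hTC
  let e : Fin (Module.finrank ℂ α.T) ⊕ Fin (Module.finrank ℂ C) ≃ Fin N :=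
    finSumFinEquiv.trans (finCongr hTC)
  let fr : Frame N := ⟨o, b.reindex e, Finset.univ.map (Function.Embedding.inr.trans e.toEmbedding)⟩
  have hη : ∀ i, fr.η (e (Sum.inl i)) = bT i := by
    intro i
    simp [fr, b]
  have hS : ∀ i, e (Sum.inl i) ∉ fr.S := by
    intro i
    simp [fr]
  have hS' : ∀ i ∉ fr.S, ∃ j, i = e (Sum.inl j) := by
    intro i hi
    obtain ⟨j | j, rfl⟩ := e.surjective i
    · exact ⟨j, rfl⟩
    · exact absurd (by simp [fr]) hi
  refine ⟨fr, ho, fun i hi => ?_, fun i hi => ?_, ?_⟩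
  · refine memF_of_forall ho (by simp [Frame.y_apply, fr]) fun v hv => ?_
    rw [Frame.y_linear]
    have h1 : v = ∑ j, bT.repr ⟨v, hv⟩ j • (bT j : Fin N → ℂ) := by
      have := congrArg α.T.subtype (bT.sum_repr ⟨v, hv⟩)
      rw [map_sum] at this
      simp only [map_smul, Submodule.subtype_apply] at this
      exact this.symm
    rw [h1, map_sum]
    refine Finset.sum_eq_zero fun j _ => ?_
    have hne : e (Sum.inl j) ≠ i := by
      rintro rfl; exact hS j hi
    rw [map_smul, ← hη, Module.Basis.coord_apply, Module.Basis.repr_self,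
      Finsupp.single_eq_of_ne hne.symm, smul_zero]
  · obtain ⟨j, rfl⟩ := hS' i hi
    rw [hη]
    exact (bT j).2
  · have := α.finrank_T_add_l
    simp only [fr, Finset.card_map, Finset.card_univ, Fintype.card_fin]
    omega

/-- A frame adapted to the flat `α`. -/
def Vertex.frame (α : 𝒜.Vertex) : Frame N := (exists_isAdapted α).choose

lemma Vertex.isAdapted (α : 𝒜.Vertex) : IsAdapted α.frame α := (exists_isAdapted α).choose_spec

lemma eq_sum_of_mem_T {α : 𝒜.Vertex} {v : Fin N → ℂ} (hv : v ∈ α.T) :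
    v = ∑ j, (if j ∈ α.frame.S then 0 else α.frame.η.coord j v) • α.frame.η j := by
  conv_lhs => rw [← α.frame.η.sum_repr v]
  refine Finset.sum_congr rfl fun j _ => ?_
  split_ifs with hj
  · have := linear_eq_zero_of_memF (α.isAdapted.y_memF j hj) hv
    rw [Frame.y_linear, Module.Basis.coord_apply] at this
    rw [this]
  · rfl

lemma eq_sum_of_memF {α : 𝒜.Vertex} {f : (Fin N → ℂ) →ᵃ[ℂ] ℂ} (hf : α.MemF f) :
    f = ∑ j ∈ α.frame.S, f.linear (α.frame.η j) • α.frame.y j := by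
  ext x
  have h1 := congrArg (MvPolynomial.eval x) (α.frame.affine_eq f)
  rw [hf _ α.isAdapted.o_mem, map_zero, zero_add, eval_affinePoly, map_sum] at h1
  rw [h1]
  have h2 : ∀ (s : Finset (Fin N)) (g : Fin N → ((Fin N → ℂ) →ᵃ[ℂ] ℂ)),
      (∑ j ∈ s, g j) x = ∑ j ∈ s, g j x := by
    intro s g
    induction s using Finset.induction_on with
    | empty => simp
    | insert a s ha ih => rw [Finset.sum_insert ha, Finset.sum_insert ha, ← ih]; rfl
  rw [h2]
  symm
  refine Finset.sum_subset_zero_on_sdiff (Finset.subset_univ _) (fun j hj => ?_) (fun j hj => ?_)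
  · have : f.linear (α.frame.η j) = 0 :=
      linear_eq_zero_of_memF hf (α.isAdapted.η_mem j (Finset.mem_sdiff.1 hj).2)
    simp [this]
  · simp [eval_affinePoly]

variable (Q : 𝒜.Quiver)

/-- The index set of a basis of `⊕_α Ω̄_α ⊗ V_α` that is compatible with the decomposition. -/
abbrev BasisIdx : Type := Σ α : 𝒜.Vertex, Fin (Module.finrank ℂ (α.Omega ⊗[ℂ] Q.V α))

/-- A basis of `Ω̄_α ⊗ V_α`. -/
def wBasis (α : 𝒜.Vertex) :
    Module.Basis (Fin (Module.finrank ℂ (α.Omega ⊗[ℂ] Q.V α))) ℂ (α.Omega ⊗[ℂ] Q.V α) :=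
  Module.finBasis ℂ _

/-- A basis of the space of generators that is compatible with the decomposition. -/
def genBasis : Module.Basis (BasisIdx Q) ℂ (Generators Q) :=
  DFinsupp.basis fun α => wBasis Q α

lemma genBasis_apply (e : BasisIdx Q) : genBasis Q e = incl Q e.1 (wBasis Q e.1 e.2) := by
  classical
  obtain ⟨α, i⟩ := e
  have h : (DFinsupp.basis fun α => wBasis Q α) ⟨α, i⟩
      = (DFinsupp.mapRange.linearEquiv fun α => (wBasis Q α).repr).symm
        (sigmaFinsuppEquivDFinsupp (Finsupp.single ⟨α, i⟩ 1)) := rfl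
  rw [sigmaFinsuppEquivDFinsupp_single, DFinsupp.mapRange.linearEquiv_symm] at h
  refine h.trans ((DFinsupp.mapRange_single (hf := fun β => map_zero (wBasis Q β).repr.symm)).trans ?_)
  exact congrArg (incl Q α) (Module.Basis.repr_symm_single_one (wBasis Q α) i)

/-- The corresponding basis of the free module. -/
def freeBasis : Module.Basis (BasisIdx Q) (DX N) (FreeModule Q) :=
  Algebra.TensorProduct.basis (DX N) (genBasis Q)

lemma freeBasis_apply (e : BasisIdx Q) : freeBasis Q e = gen Q 1 e.1 (wBasis Q e.1 e.2) := by
  rw [freeBasis, Algebra.TensorProduct.basis_apply, genBasis_apply]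
  rfl

/-- The relation that expresses `b_i` applied to a generator through other generators. -/
def rel (e : BasisIdx Q) (i : Fin N) : FreeModule Q :=
  if h : i ∈ e.1.frame.S then relF Q e.1 (e.1.frame.y i) (wBasis Q e.1 e.2)
  else relV Q e.1 ⟨e.1.frame.η i, e.1.isAdapted.η_mem i h⟩ (wBasis Q e.1 e.2)

variable {Q}

lemma gen_one_mem_span (α : 𝒜.Vertex) (w : α.Omega ⊗[ℂ] Q.V α) :
    gen Q 1 α w ∈ Submodule.span ℂ {x | ∃ e : BasisIdx Q, e.1 = α ∧ x = freeBasis Q e} := by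
  have h : ∀ i, gen Q 1 α (wBasis Q α i)
      ∈ Submodule.span ℂ {x | ∃ e : BasisIdx Q, e.1 = α ∧ x = freeBasis Q e} := fun i =>
    Submodule.subset_span ⟨(⟨α, i⟩ : BasisIdx Q), rfl, (freeBasis_apply Q ⟨α, i⟩).symm⟩
  rw [← (wBasis Q α).sum_repr w, map_sum]
  refine Submodule.sum_mem _ fun i _ => ?_
  rw [map_smul]
  exact Submodule.smul_mem _ _ (h i)

lemma stepV_add (α β : 𝒜.Vertex) (ξ η : α.T) :
    stepV Q α β (ξ + η) = stepV Q α β ξ + stepV Q α β η := by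
  by_cases h : α.Covers β
  · simp only [stepV, dif_pos h, contract_add, TensorProduct.map_add_left]
  · simp [stepV_of_not h]

lemma stepV_smul (α β : 𝒜.Vertex) (c : ℂ) (ξ : α.T) :
    stepV Q α β (c • ξ) = c • stepV Q α β ξ := by
  by_cases h : α.Covers β
  · simp only [stepV, dif_pos h, contract_smul, TensorProduct.map_smul_left]
  · simp [stepV_of_not h]

lemma stepF_add (α β : 𝒜.Vertex) (f g : (Fin N → ℂ) →ᵃ[ℂ] ℂ) :
    stepF Q α β (f + g) = stepF Q α β f + stepF Q α β g := by
  by_cases h : β.Covers α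
  · have : dOn β (f + g) = dOn β f + dOn β g := by ext; simp [dOn]
    simp only [stepF, dif_pos h, this, wedge_add, TensorProduct.map_add_left]
  · simp [stepF_of_not h]

lemma stepF_smul (α β : 𝒜.Vertex) (c : ℂ) (f : (Fin N → ℂ) →ᵃ[ℂ] ℂ) :
    stepF Q α β (c • f) = c • stepF Q α β f := by
  by_cases h : β.Covers α
  · have : dOn β (c • f) = c • dOn β f := by ext; simp [dOn]
    simp only [stepF, dif_pos h, this, wedge_smul, TensorProduct.map_smul_left]
  · simp [stepF_of_not h]

variable (Q) in
/-- `relV` as a linear map in the vector field. -/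
def relVHom (α : 𝒜.Vertex) (w : α.Omega ⊗[ℂ] Q.V α) : α.T →ₗ[ℂ] FreeModule Q where
  toFun ξ := relV Q α ξ w
  map_add' ξ η := by
    simp only [relV_apply, stepV_add, Submodule.coe_add, vectorField_add, gen_add,
      LinearMap.add_apply, map_add, Finset.sum_add_distrib]
    abel
  map_smul' c ξ := by
    simp only [relV_apply, stepV_smul, Submodule.coe_smul, vectorField_smul, gen_smul,
      LinearMap.smul_apply, map_smul, smul_sub, Finset.smul_sum, RingHom.id_apply]

lemma affinePoly_add (f g : (Fin N → ℂ) →ᵃ[ℂ] ℂ) :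
    affinePoly (f + g) = affinePoly f + affinePoly g := by
  refine MvPolynomial.funext fun x => ?_
  simp [eval_affinePoly]

variable (Q) in
/-- `relF` as a linear map in the affine function. -/
def relFHom (α : 𝒜.Vertex) (w : α.Omega ⊗[ℂ] Q.V α) :
    ((Fin N → ℂ) →ᵃ[ℂ] ℂ) →ₗ[ℂ] FreeModule Q where
  toFun f := relF Q α f w
  map_add' f g := by
    simp only [relF_apply, stepF_add, affinePoly_add, map_add, gen_add,
      LinearMap.add_apply, Finset.sum_add_distrib]
    abel
  map_smul' c f := by
    simp only [relF_apply, stepF_smul, affinePoly_smul, mulOp_smul_complex, gen_smul,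
      LinearMap.smul_apply, map_smul, smul_sub, Finset.smul_sum, RingHom.id_apply]

/-- The relations are linear in `ξ`, in `f` and in the generator, so that those attached to the adapted
frames and to the bases span all of them. -/
lemma relSpace_eq : relSpace Q
    = Submodule.span ℂ (Set.range fun x : BasisIdx Q × Fin N => rel Q x.1 x.2) := by
  set R := Submodule.span ℂ (Set.range fun x : BasisIdx Q × Fin N => rel Q x.1 x.2) with hR
  have hr : ∀ e i, rel Q e i ∈ R := fun e i => Submodule.subset_span ⟨(e, i), rfl⟩
  apply le_antisymm
  · refine Submodule.span_le.2 ?_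
    rintro _ (⟨α, ξ, w, rfl⟩ | ⟨α, f, w, hf, rfl⟩)
    · change _ ∈ R
      rw [← (wBasis Q α).sum_repr w, map_sum]
      refine Submodule.sum_mem _ fun i _ => ?_
      rw [map_smul]
      refine Submodule.smul_mem _ _ ?_
      have h1 : ξ = ∑ j, if h : j ∈ α.frame.S then 0 else
          α.frame.η.coord j ξ • (⟨α.frame.η j, α.isAdapted.η_mem j h⟩ : α.T) := by
        apply Subtype.ext
        rw [AddSubmonoidClass.coe_finsetSum]
        conv_lhs => rw [eq_sum_of_mem_T ξ.2]
        refine Finset.sum_congr rfl fun j _ => ?_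
        split_ifs
        · simp
        · rfl
      change relVHom Q α _ ξ ∈ R
      rw [h1, map_sum]
      refine Submodule.sum_mem _ fun j _ => ?_
      split_ifs with hj
      · simp
      · rw [map_smul]
        refine Submodule.smul_mem _ _ ?_
        have := hr ⟨α, i⟩ j
        rwa [rel, dif_neg hj] at this
    · change _ ∈ R
      rw [← (wBasis Q α).sum_repr w, map_sum]
      refine Submodule.sum_mem _ fun i _ => ?_
      rw [map_smul]
      refine Submodule.smul_mem _ _ ?_
      change relFHom Q α _ f ∈ R
      rw [eq_sum_of_memF hf, map_sum]
      refine Submodule.sum_mem _ fun j hj => ?_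
      rw [map_smul]
      refine Submodule.smul_mem _ _ ?_
      have := hr ⟨α, i⟩ j
      rwa [rel, dif_pos hj] at this
  · refine Submodule.span_le.2 ?_
    rintro _ ⟨⟨e, i⟩, rfl⟩
    change rel Q e i ∈ _
    unfold rel
    split_ifs with h
    · exact relF_mem (e.1.isAdapted.y_memF i h) _
    · exact relV_mem _ _ _

/-- The consistency hypothesis of `pbw_injective` for the relations of a quiver `D`-module. -/
lemma rel_consistency (e : BasisIdx Q) (i k : Fin N) :
    e.1.frame.b k • rel Q e i - e.1.frame.b i • rel Q e k
      ∈ Submodule.span ℂ (Set.range fun x : BasisIdx Q × Fin N => rel Q x.1 x.2) := by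
  rw [← relSpace_eq]
  unfold rel Frame.b
  split_ifs with hk hi hi
  · exact affine_consistency _ (e.1.isAdapted.y_memF k hk) (e.1.isAdapted.y_memF i hi) _
  · exact mixed_consistency e.1 ⟨_, e.1.isAdapted.η_mem i hi⟩ (e.1.isAdapted.y_memF k hk) _
  · rw [← neg_sub]
    exact Submodule.neg_mem _
      (mixed_consistency e.1 ⟨_, e.1.isAdapted.η_mem k hk⟩ (e.1.isAdapted.y_memF i hi) _)
  · exact vectorField_consistency e.1 ⟨_, e.1.isAdapted.η_mem k hk⟩
      ⟨_, e.1.isAdapted.η_mem i hi⟩ _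

lemma b_smul_freeBasis_sub_rel (e : BasisIdx Q) (i : Fin N) :
    e.1.frame.b i • freeBasis Q e - rel Q e i ∈ Submodule.span ℂ {x | ∃ e' : BasisIdx Q,
      (if i ∈ e.1.frame.S then e'.1.l + 1 = e.1.l else e'.1.l = e.1.l + 1)
        ∧ x = freeBasis Q e'} := by
  rw [freeBasis_apply, smul_gen, mul_one]
  by_cases h : i ∈ e.1.frame.S
  · rw [rel, dif_pos h, Frame.b, if_pos h, relF_apply, sub_sub_cancel]
    refine Submodule.sum_mem _ fun β _ => ?_
    by_cases hβ : β.Covers e.1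
    · refine Submodule.span_mono ?_ (gen_one_mem_span β _)
      rintro _ ⟨e', rfl, rfl⟩
      exact ⟨e', by rw [if_pos h]; exact hβ.2.symm, rfl⟩
    · simp [stepF_of_not hβ]
  · rw [rel, dif_neg h, Frame.b, if_neg h, relV_apply, sub_sub_cancel]
    refine Submodule.sum_mem _ fun β _ => ?_
    by_cases hβ : e.1.Covers β
    · refine Submodule.span_mono ?_ (gen_one_mem_span β _)
      rintro _ ⟨e', rfl, rfl⟩
      exact ⟨e', by rw [if_neg h]; exact hβ.2, rfl⟩
    · simp [stepV_of_not hβ]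

variable (Φ : 𝒜.EdgeFraming)

lemma smul_piDown {α β : 𝒜.Vertex} (h : α.Covers β) (ξ : α.T) (ω : α.Omega) :
    (Φ.f h).linear ξ • Φ.piDown h ω = contract h.T_le h.finrank_eq ξ ω := by
  have h1 := (Φ.piDown_eq_iff h ω _).1 rfl
  conv_rhs => rw [← h1]
  rw [contract_wedge _ _ _ _ (dOn_eq_zero h (Φ.f_mem h))]
  rfl

lemma smul_piUp {α β : 𝒜.Vertex} (h : α.Covers β) {f : (Fin N → ℂ) →ᵃ[ℂ] ℂ} (hf : β.MemF f)
    (ω : β.Omega) :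
    f.linear (Φ.ξ h) • Φ.piUp h ω = wedge h.T_le h.finrank_eq (dOn α f) ω := by
  have h1 := (Φ.piUp_eq_iff h ω _).1 rfl
  refine contract_injective h.T_le h.finrank_eq ⟨Φ.ξ h, Φ.ξ_mem h⟩ (Φ.ξ_notMem h) ?_
  rw [map_smul, h1, contract_wedge _ _ _ _ (dOn_eq_zero h hf)]
  rfl

lemma sum_subtype_eq {M : Type*} [AddCommMonoid M] (p : 𝒜.Vertex → Prop)
    (f : {β // p β} → M) (g : 𝒜.Vertex → M) (h : ∀ β, f β = g β) (h' : ∀ β, ¬ p β → g β = 0) :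
    ∑ β, f β = ∑ β, g β := by
  classical
  rw [Finset.sum_congr rfl fun β _ => h β, ← Finset.sum_subset (Finset.filter_subset p Finset.univ)]
  · exact (Finset.sum_subtype _ (by simp) _).symm
  · intro β _ hβ
    exact h' β fun hp => hβ (by simp [hp])

lemma vectorRelation_eq (α : 𝒜.Vertex) (u : DX N) (ω : α.Omega) (v : Q.V α) (ξ : α.T) :
    elt Q (u * vectorField (ξ : Fin N → ℂ)) α ω v -
      ∑ β : {β : 𝒜.Vertex // α.Covers β},
        (Φ.f β.2).linear ξ • elt Q u β.1 (Φ.piDown β.2 ω) (Q.A β.1 α v)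
      = u • relV Q α ξ (ω ⊗ₜ v) := by
  rw [relV_apply, smul_sub, smul_gen, Finset.smul_sum]
  congr 1
  refine sum_subtype_eq _ _ _ (fun β => ?_) (fun β hβ => ?_)
  · rw [smul_gen, mul_one, stepV_tmul β.2, ← smul_piDown Φ β.2, ← TensorProduct.smul_tmul',
      map_smul]
    rfl
  · simp [stepV_of_not hβ]

lemma functionRelation_eq (α : 𝒜.Vertex) (u : DX N) (ω : α.Omega) (v : Q.V α)
    {f : (Fin N → ℂ) →ᵃ[ℂ] ℂ} (hf : α.MemF f) :
    elt Q (u * mulOp N (affinePoly f)) α ω v -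
      ∑ β : {β : 𝒜.Vertex // β.Covers α},
        f.linear (Φ.ξ β.2) • elt Q u β.1 (Φ.piUp β.2 ω) (Q.A β.1 α v)
      = u • relF Q α f (ω ⊗ₜ v) := by
  rw [relF_apply, smul_sub, smul_gen, Finset.smul_sum]
  congr 1
  refine sum_subtype_eq _ _ _ (fun β => ?_) (fun β hβ => ?_)
  · rw [smul_gen, mul_one, stepF_tmul β.2, ← smul_piUp Φ β.2 hf, ← TensorProduct.smul_tmul',
      map_smul]
    rfl
  · simp [stepF_of_not hβ]

variable (Q)

/-- The relations do not depend on the edge framing. -/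
lemma relations_eq : relations Φ Q
    = Submodule.span (DX N) (Set.range fun x : BasisIdx Q × Fin N => rel Q x.1 x.2) := by
  have hsub : ∀ x ∈ relSpace Q,
      x ∈ Submodule.span (DX N) (Set.range fun x : BasisIdx Q × Fin N => rel Q x.1 x.2) := by
    intro x hx
    rw [relSpace_eq] at hx
    exact Submodule.span_le_restrictScalars ℂ (DX N) _ hx
  apply le_antisymm
  · refine Submodule.span_le.2 ?_
    rintro _ (⟨α, u, ω, v, ξ, hξ, rfl⟩ | ⟨α, u, ω, v, f, hf, rfl⟩)
    · rw [vectorRelation_eq Φ α u ω v ⟨ξ, hξ⟩]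
      exact Submodule.smul_mem _ _ (hsub _ (relV_mem _ _ _))
    · rw [functionRelation_eq Φ α u ω v hf]
      exact Submodule.smul_mem _ _ (hsub _ (relF_mem hf _))
  · have hV : ∀ α ξ w, relV Q α ξ w ∈ relations Φ Q := by
      intro α ξ w
      induction w using TensorProduct.induction_on with
      | zero => simp
      | add w w' h h' => rw [map_add]; exact Submodule.add_mem _ h h'
      | tmul ω v =>
        refine Submodule.subset_span (Or.inl ⟨α, 1, ω, v, ξ, ξ.2, ?_⟩)
        rw [vectorRelation_eq Φ α 1 ω v ξ, one_smul]
    have hF : ∀ α f w, α.MemF f → relF Q α f w ∈ relations Φ Q := by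
      intro α f w hf
      induction w using TensorProduct.induction_on with
      | zero => simp
      | add w w' h h' => rw [map_add]; exact Submodule.add_mem _ h h'
      | tmul ω v =>
        refine Submodule.subset_span (Or.inr ⟨α, 1, ω, v, f, hf, ?_⟩)
        rw [functionRelation_eq Φ α 1 ω v hf, one_smul]
    refine Submodule.span_le.2 ?_
    rintro _ ⟨⟨e, i⟩, rfl⟩
    change rel Q e i ∈ _
    unfold rel
    split_ifs with h
    · exact hF _ _ _ (e.1.isAdapted.y_memF i h)
    · exact hV _ _ _

/-- The images of the basis generators in the quiver `D`-module. -/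
def qGen (e : BasisIdx Q) : QuiverDModule Φ Q := Submodule.Quotient.mk (freeBasis Q e)

lemma qGen_span : Submodule.span (DX N) (Set.range (qGen Q Φ)) = ⊤ := by
  have h1 : Set.range (qGen Q Φ) = (relations Φ Q).mkQ '' Set.range (freeBasis Q) := by
    rw [← Set.range_comp]; rfl
  rw [h1, ← Submodule.map_span, (freeBasis Q).span_eq, Submodule.map_top, Submodule.range_mkQ]

/-- Uniqueness of normal forms in a quiver `D`-module. -/
lemma qGen_injective (p : BasisIdx Q → MvPolynomial (Fin N) ℂ)
    (hp : ∑ e, e.1.frame.A (p e) • qGen Q Φ e = 0) : p = 0 := by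
  refine pbw_injective (fun e : BasisIdx Q => e.1.frame) (freeBasis Q) (r := rel Q) (fun e i => ?_)
    rel_consistency p ?_
  · rw [← neg_sub]
    refine Submodule.neg_mem _ (Submodule.span_mono ?_ (b_smul_freeBasis_sub_rel e i))
    rintro _ ⟨e', -, rfl⟩
    exact ⟨e', rfl⟩
  · rw [← relations_eq Q Φ, ← Submodule.Quotient.mk_eq_zero, ← hp, ← Submodule.mkQ_apply, map_sum]
    rfl

/-- An affine function vanishing on the flat of a generator moves it one level down, a vector field
along the flat moves it one level up. -/
lemma b_smul_qGen (e : BasisIdx Q) (i : Fin N) :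
    e.1.frame.b i • qGen Q Φ e ∈ Submodule.span ℂ {x | ∃ e' : BasisIdx Q,
      (if i ∈ e.1.frame.S then e'.1.l + 1 = e.1.l else e'.1.l = e.1.l + 1)
        ∧ x = qGen Q Φ e'} := by
  have h1 := b_smul_freeBasis_sub_rel e i
  have h2 : rel Q e i ∈ relations Φ Q := by
    rw [relations_eq]
    exact Submodule.subset_span ⟨(e, i), rfl⟩
  have h3 : e.1.frame.b i • qGen Q Φ e
      = ((relations Φ Q).mkQ.restrictScalars ℂ) (e.1.frame.b i • freeBasis Q e - rel Q e i) := by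
    rw [map_sub]
    have : ((relations Φ Q).mkQ.restrictScalars ℂ) (rel Q e i) = 0 :=
      (Submodule.Quotient.mk_eq_zero _).2 h2
    rw [this, sub_zero]
    rfl
  rw [h3]
  have h4 := Submodule.mem_map_of_mem (f := (relations Φ Q).mkQ.restrictScalars ℂ) h1
  rw [Submodule.map_span] at h4
  refine Submodule.span_mono ?_ h4
  rintro _ ⟨_, ⟨e', he', rfl⟩, rfl⟩
  exact ⟨e', he', rfl⟩

end Arrangement

end QuiverDMod

namespace QuiverDMod

open MvPolynomial

/-! ### The order filtration of the ring of differential operators -/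

section Order

variable {N : ℕ}

lemma ordLE_mono {k l : ℤ} (h : k ≤ l) : ordLE N k ≤ ordLE N l :=
  Submodule.span_mono fun _ ⟨w, hw, hP⟩ => ⟨w, hw.trans h, hP⟩

lemma ordLE_eq_bot {k : ℤ} (h : k < 0) : ordLE N k = ⊥ := by
  rw [ordLE, Submodule.span_eq_bot]
  rintro _ ⟨w, hw, rfl⟩
  omega

lemma one_mem_ordLE {k : ℤ} (hk : 0 ≤ k) : (1 : DX N) ∈ ordLE N k :=
  Submodule.subset_span ⟨[], by simpa using hk, by simp⟩

lemma partialOp_mul_mem_ordLE (i : Fin N) {k : ℤ} {P : DX N} (hP : P ∈ ordLE N k) :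
    partialOp i * P ∈ ordLE N (k + 1) := by
  induction hP using Submodule.span_induction with
  | zero => simp
  | add P Q _ _ hP hQ => rw [mul_add]; exact Submodule.add_mem _ hP hQ
  | smul p P hP' hP =>
    have : partialOp i * p • P = p • (partialOp i * P) + pderiv i p • P := by
      simp only [poly_smul_def]
      rw [← mul_assoc, partialOp_mul_mulOp, add_mul, mul_assoc]
    rw [this]
    exact Submodule.add_mem _ (Submodule.smul_mem _ _ hP)
      (Submodule.smul_mem _ _ (ordLE_mono (by omega) hP'))
  | mem P hP =>
    obtain ⟨w, hw, rfl⟩ := hP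
    exact Submodule.subset_span ⟨i :: w, by simpa using hw, by simp⟩

lemma mul_mem_ordLE {k l : ℤ} {P Q : DX N} (hP : P ∈ ordLE N k) (hQ : Q ∈ ordLE N l) :
    P * Q ∈ ordLE N (k + l) := by
  induction hP using Submodule.span_induction with
  | zero => simp
  | add P P' _ _ hP hP' => rw [add_mul]; exact Submodule.add_mem _ hP hP'
  | smul p P _ hP => rw [smul_mul_assoc]; exact Submodule.smul_mem _ _ hP
  | mem P hP =>
    obtain ⟨w, hw, rfl⟩ := hP
    refine ordLE_mono (show (w.length : ℤ) + l ≤ k + l by omega) ?_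
    clear hw
    induction w with
    | nil => simpa using hQ
    | cons i w ih =>
      rw [List.map_cons, List.prod_cons, mul_assoc]
      have := partialOp_mul_mem_ordLE i ih
      refine ordLE_mono (le_of_eq ?_) this
      rw [List.length_cons]
      push_cast
      ring

lemma mulOp_mem_ordLE (p : OX N) {k : ℤ} (hk : 0 ≤ k) : mulOp N p ∈ ordLE N k := by
  have := (ordLE N k).smul_mem p (one_mem_ordLE hk)
  rwa [poly_smul_def, mul_one] at this

lemma complex_smul_mem_ordLE (c : ℂ) {k : ℤ} {P : DX N} (hP : P ∈ ordLE N k) :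
    c • P ∈ ordLE N k := by
  rw [Algebra.smul_def, ← mulOp_C, ← poly_smul_def]
  exact Submodule.smul_mem _ _ hP

lemma vectorField_mem_ordLE (v : Fin N → ℂ) {k : ℤ} (hk : 1 ≤ k) :
    vectorField v ∈ ordLE N k :=
  Submodule.sum_mem _ fun i _ => complex_smul_mem_ordLE _ (ordLE_mono hk (partialOp_mem i))

lemma ordLE_fg (k : ℤ) : (ordLE N k).FG := by
  refine Submodule.fg_span ?_
  have h : {w : List (Fin N) | (w.length : ℤ) ≤ k}.Finite := by
    refine (List.finite_length_le (Fin N) k.toNat).subset fun w hw => ?_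
    simp only [Set.mem_ofPred_eq] at hw ⊢
    omega
  refine (h.image fun w => (w.map partialOp).prod).subset ?_
  rintro _ ⟨w, hw, rfl⟩
  exact ⟨w, hw, rfl⟩

/-- `D_X^{k+l} = D_X^k D_X^l`. -/
lemma ordLE_add_le {k l : ℤ} (hk : 0 ≤ k) (hl : 0 ≤ l) {P : DX N} (hP : P ∈ ordLE N (k + l)) :
    P ∈ Submodule.span (OX N) {P | ∃ P₁ ∈ ordLE N k, ∃ P₂ ∈ ordLE N l, P = P₁ * P₂} := by
  refine Submodule.span_mono ?_ hP
  rintro _ ⟨w, hw, rfl⟩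
  refine ⟨((w.take k.toNat).map partialOp).prod, Submodule.subset_span ⟨_, ?_, rfl⟩,
    ((w.drop k.toNat).map partialOp).prod, Submodule.subset_span ⟨_, ?_, rfl⟩, ?_⟩
  · rw [List.length_take]; omega
  · rw [List.length_drop]; omega
  · rw [← List.prod_append, ← List.map_append, List.take_append_drop]

namespace Frame

lemma W_le_ordLE (fr : Frame N) {k n : ℕ} {P : DX N} (hP : P ∈ fr.W k n) : P ∈ ordLE N k := by
  let std : Frame N := ⟨0, Pi.basisFun ℂ (Fin N), ∅⟩
  have ha : ∀ i, std.a i = mulOp N (affinePoly (std.y i)) := fun i => if_neg (Finset.notMem_empty i)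
  have hb : ∀ i, std.b i = vectorField (std.η i) := fun i => if_neg (Finset.notMem_empty i)
  rw [W_eq _ std, W, bidegLE, restrictSupport_eq_span, Submodule.map_span] at hP
  induction hP using Submodule.span_induction with
  | zero => simp
  | add P Q _ _ hP hQ => exact Submodule.add_mem _ hP hQ
  | smul c P _ hP => exact complex_smul_mem_ordLE c hP
  | mem P hP =>
    obtain ⟨_, ⟨μ, ⟨h1, -⟩, rfl⟩, rfl⟩ := hP
    have hgen : ∀ (d : ℕ) (μ : Fin N ⊕ Fin N →₀ ℕ), μ.degree = d →
        std.ρ (monomial μ 1) ∈ ordLE N (Finsupp.weight std.ord μ : ℕ) := by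
      intro d
      induction d with
      | zero =>
        intro μ hμ
        rw [Finsupp.degree_eq_zero_iff] at hμ
        subst hμ
        rw [show (monomial 0 1 : MvPolynomial (Fin N ⊕ Fin N) ℂ) = 1 from rfl, ρ_one]
        exact one_mem_ordLE (by simp)
      | succ d ih =>
        intro μ hμ
        have h0 : μ ≠ 0 := by rintro rfl; simp at hμ
        obtain ⟨s, hs⟩ := Finsupp.ne_iff.1 h0
        obtain ⟨ν, rfl⟩ := exists_eq_single_add hs
        rw [map_add, Finsupp.degree_single] at hμ
        have h1 := ih ν (by omega)
        rw [monomial_single_add, weight_inl_single_add]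
        rcases s with i | i
        · rw [ρ_X_inl_mul, ha]
          refine ordLE_mono ?_ (mul_mem_ordLE (mulOp_mem_ordLE _ le_rfl) h1)
          push_cast; omega
        · rw [mul_comm, ρ_mul_X_inr, hb]
          have h2 : std.ord (Sum.inr i) = 1 := by simp [ord, std]
          refine ordLE_mono ?_ (mul_mem_ordLE h1 (vectorField_mem_ordLE _ le_rfl))
          rw [h2]; push_cast; omega
    exact ordLE_mono (by exact_mod_cast h1) (hgen _ μ rfl)

lemma exists_mem_W (fr : Frame N) {k : ℕ} {P : DX N} (hP : P ∈ ordLE N k) :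
    ∃ n, P ∈ fr.W k n := by
  have hmul : ∀ (p : OX N) (Q : DX N), (∃ n, Q ∈ fr.W k n) → ∃ n, mulOp N p * Q ∈ fr.W k n := by
    intro p
    induction p using MvPolynomial.induction_on with
    | C c =>
      rintro Q ⟨n, hQ⟩
      exact ⟨n, by rw [mulOp_C, ← Algebra.smul_def]; exact Submodule.smul_mem _ _ hQ⟩
    | add p q hp hq =>
      intro Q hQ
      obtain ⟨n, hn⟩ := hp Q hQ
      obtain ⟨n', hn'⟩ := hq Q hQ
      refine ⟨n + n', ?_⟩
      rw [map_add, add_mul]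
      exact Submodule.add_mem _ (W_mono le_rfl (Nat.le_add_right _ _) hn)
        (W_mono le_rfl (Nat.le_add_left _ _) hn')
    | mul_X p i hp =>
      rintro Q ⟨n, hQ⟩
      rw [map_mul, mul_assoc]
      refine hp _ ⟨n + 1, ?_⟩
      rw [← affinePoly_coordFun]
      exact affine_mul_mem_W _ hQ
  induction hP using Submodule.span_induction with
  | zero => exact ⟨0, Submodule.zero_mem _⟩
  | add P Q _ _ hP hQ =>
    obtain ⟨n, hn⟩ := hP
    obtain ⟨n', hn'⟩ := hQ
    exact ⟨n + n', Submodule.add_mem _ (W_mono le_rfl (Nat.le_add_right _ _) hn)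
      (W_mono le_rfl (Nat.le_add_left _ _) hn')⟩
  | smul p P _ hP => exact hmul p P hP
  | mem P hP =>
    obtain ⟨w, hw, rfl⟩ := hP
    have : ∀ w : List (Fin N), (w.map partialOp).prod ∈ fr.W w.length w.length := by
      intro w
      induction w with
      | nil => exact one_mem_W
      | cons i w ih =>
        rw [List.map_cons, List.prod_cons, ← vectorField_single]
        exact vectorField_mul_mem_W _ ih
    exact ⟨w.length, W_mono (by exact_mod_cast hw) le_rfl (this w)⟩

/-- Normally ordered polynomials without variables of the second kind. -/
lemma A_mem_W (fr : Frame N) {k n : ℕ} {p : MvPolynomial (Fin N) ℂ} (hp : p ∈ bidegLE fr.ordA k n) :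
    fr.A p ∈ fr.W k n := by
  rw [← ρ_rename]
  refine ⟨_, mem_bidegLE.2 fun μ hμ => ?_, rfl⟩
  obtain ⟨u, rfl, hu⟩ := coeff_rename_ne_zero _ _ _ hμ
  obtain ⟨h1, h2⟩ := mem_bidegLE.1 hp u hu
  refine ⟨le_trans (le_of_eq ?_) h1, by rwa [Finsupp.degree_mapDomain]⟩
  rw [Finsupp.weight_apply, Finsupp.weight_apply, Finsupp.sum_mapDomain_index (by simp)
    (by intros; simp [add_mul])]
  rfl

lemma A_mem_ordLE (fr : Frame N) {k : ℕ} {p : MvPolynomial (Fin N) ℂ}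
    (hp : ∀ μ, coeff μ p ≠ 0 → Finsupp.weight fr.ordA μ ≤ k) : fr.A p ∈ ordLE N k :=
  fr.W_le_ordLE (n := p.totalDegree)
    (fr.A_mem_W (mem_bidegLE.2 fun μ hμ => ⟨hp μ hμ, degree_le_totalDegree hμ⟩))

end Frame

end Order

end QuiverDMod

namespace QuiverDMod

open MvPolynomial

/-! ### Normal forms and the filtration they define -/

/-- The component of weight `k` of a polynomial, for an integer `k`. -/
def homPart {τ : Type*} (w : τ → ℕ) (k : ℤ) :
    MvPolynomial τ ℂ →ₗ[ℂ] MvPolynomial τ ℂ :=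
  weightedHomogeneousComponent (fun s => (w s : ℤ)) k

section HomPart

variable {τ : Type*} {w : τ → ℕ}

lemma weight_cast (μ : τ →₀ ℕ) :
    Finsupp.weight (fun s => (w s : ℤ)) μ = (Finsupp.weight w μ : ℕ) := by
  simp [Finsupp.weight_apply, Finsupp.sum]

lemma coeff_homPart (k : ℤ) (p : MvPolynomial τ ℂ) (μ : τ →₀ ℕ) :
    coeff μ (homPart w k p) = if (Finsupp.weight w μ : ℤ) = k then coeff μ p else 0 := by
  classical
  rw [homPart, coeff_weightedHomogeneousComponent, weight_cast]

lemma homPart_X_mul (s : τ) (k : ℤ) (p : MvPolynomial τ ℂ) :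
    homPart w (k + w s) (X s * p) = X s * homPart w k p := by
  classical
  ext μ
  rw [coeff_homPart, coeff_X_mul', coeff_X_mul', coeff_homPart]
  by_cases hs : s ∈ μ.support
  · obtain ⟨ν, rfl⟩ := Frame.exists_eq_single_add (Finsupp.mem_support_iff.1 hs)
    rw [if_pos hs, if_pos hs, add_tsub_cancel_left, map_add, Finsupp.weight_single]
    refine if_congr ?_ rfl rfl
    push_cast
    simp only [one_smul]
    omega
  · rw [if_neg hs, if_neg hs, ite_self]

lemma homPart_eq_zero {k : ℤ} {p : MvPolynomial τ ℂ}
    (hp : ∀ μ, coeff μ p ≠ 0 → (Finsupp.weight w μ : ℤ) ≤ k - 1) : homPart w k p = 0 := by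
  ext μ
  rw [coeff_homPart, coeff_zero]
  split_ifs with h
  · by_contra h0
    have := hp μ h0
    omega
  · rfl

end HomPart

section NormalForms

variable {N : ℕ} {ι M : Type*} [Fintype ι] [AddCommGroup M] [Module (DX N) M] [Module (OX N) M]
  [IsScalarTower (OX N) (DX N) M] [Module ℂ M] [IsScalarTower ℂ (DX N) M]

/-- The family `g` of generators of a `D_X`-module `M`, each placed in a level and equipped with a
frame, has unique normal forms: every element of `M` is in exactly one way a sum of polynomials in
the operators `a` applied to the generators, and the operators `b` of the frame of a generator `g e`
move `g e` one level down or up. -/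
structure HasNormalForms (fr : ι → Frame N) (lv : ι → ℕ) (g : ι → M) : Prop where
  b_smul : ∀ e i, (fr e).b i • g e ∈ Submodule.span ℂ {x | ∃ e',
    (if i ∈ (fr e).S then lv e' + 1 = lv e else lv e' = lv e + 1) ∧ x = g e'}
  injective : ∀ p : ι → MvPolynomial (Fin N) ℂ, ∑ e, (fr e).A (p e) • g e = 0 → p = 0
  span_eq_top : Submodule.span (DX N) (Set.range g) = ⊤

/-- The maximal order of the operators that are applied to a generator of level `n` in
`levelFiltration`. -/
def orderBound (m : ℤ) (l n : ℕ) : ℤ := if l ≤ n then m - n else m - 1 - n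

lemma orderBound_zero (m : ℤ) (n : ℕ) : orderBound m 0 n = m - n := if_pos n.zero_le

lemma orderBound_le (m : ℤ) (l n : ℕ) : orderBound m l n ≤ m - n := by
  unfold orderBound; split_ifs <;> omega

lemma le_orderBound (m : ℤ) (l n : ℕ) : m - 1 - n ≤ orderBound m l n := by
  unfold orderBound; split_ifs <;> omega

lemma orderBound_of_le {m : ℤ} {l n : ℕ} (h : l ≤ n) : orderBound m l n = m - n := if_pos h

lemma orderBound_of_lt {m : ℤ} {l n : ℕ} (h : n < l) : orderBound m l n = m - 1 - n :=
  if_neg (not_le.2 h)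

variable (N) in
/-- For `l = 0` this is `∑_e D_X^{m - lv e} g_e`; in general it is the sum of
`∑_{lv e ≥ l} D_X^{m - lv e} g_e` and of the preceding step `m - 1` of that filtration. -/
def levelFiltration (lv : ι → ℕ) (g : ι → M) (m : ℤ) (l : ℕ) : Submodule (OX N) M where
  carrier := {x | ∃ P : ι → DX N, (∀ e, P e ∈ ordLE N (orderBound m l (lv e))) ∧
    x = ∑ e, P e • g e}
  zero_mem' := ⟨0, fun _ => Submodule.zero_mem _, by simp⟩
  add_mem' := by
    rintro _ _ ⟨P, hP, rfl⟩ ⟨P', hP', rfl⟩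
    exact ⟨P + P', fun e => Submodule.add_mem _ (hP e) (hP' e),
      by simp [add_smul, Finset.sum_add_distrib]⟩
  smul_mem' := by
    rintro p _ ⟨P, hP, rfl⟩
    exact ⟨p • P, fun e => Submodule.smul_mem _ p (hP e), by simp [Finset.smul_sum]⟩

lemma smul_mem_levelFiltration {lv : ι → ℕ} {g : ι → M} {m : ℤ} {l : ℕ} {P : DX N} {e : ι}
    (hP : P ∈ ordLE N (orderBound m l (lv e))) : P • g e ∈ levelFiltration N lv g m l := by
  classical
  refine ⟨Pi.single e P, fun e' => ?_, ?_⟩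
  · rcases eq_or_ne e' e with rfl | h
    · simpa using hP
    · simp [h]
  · rw [Finset.sum_eq_single e] <;> simp +contextual

lemma levelFiltration_mono {lv : ι → ℕ} {g : ι → M} {m m' : ℤ} {l l' : ℕ}
    (h : ∀ e, orderBound m l (lv e) ≤ orderBound m' l' (lv e)) :
    levelFiltration N lv g m l ≤ levelFiltration N lv g m' l' :=
  fun _ ⟨P, hP, hx⟩ => ⟨P, fun e => ordLE_mono (h e) (hP e), hx⟩

lemma levelFiltration_pred_le {lv : ι → ℕ} {g : ι → M} (m : ℤ) (l : ℕ) :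
    levelFiltration N lv g (m - 1) 0 ≤ levelFiltration N lv g m l :=
  levelFiltration_mono fun e => by rw [orderBound_zero]; exact le_orderBound _ _ _

lemma ordLE_smul_mem_levelFiltration {lv : ι → ℕ} {g : ι → M} {m k : ℤ} {l : ℕ} {P : DX N} {x : M}
    (hP : P ∈ ordLE N k) (hx : x ∈ levelFiltration N lv g m l) :
    P • x ∈ levelFiltration N lv g (m + k) l := by
  obtain ⟨P', hP', rfl⟩ := hx
  refine ⟨fun e => P * P' e, fun e => ordLE_mono (le_of_eq ?_) (mul_mem_ordLE hP (hP' e)), ?_⟩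
  · unfold orderBound; split_ifs <;> ring
  · simp [Finset.smul_sum, mul_smul]

lemma complex_smul_mem_of_mem (F : Submodule (OX N) M) (c : ℂ) {x : M} (hx : x ∈ F) :
    c • x ∈ F := by
  have h : c • x = (C c : OX N) • x := by
    rw [← mulOp_smul, mulOp_C, algebraMap_smul]
  rw [h]
  exact F.smul_mem _ hx

/-- A submodule over the functions, as a complex vector space. -/
def restrictComplex (F : Submodule (OX N) M) : Submodule ℂ M where
  carrier := F
  zero_mem' := F.zero_mem
  add_mem' := F.add_mem
  smul_mem' c _ hx := complex_smul_mem_of_mem F c hx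

/-- If `P • x` lies in a complex subspace for all `x` in a set, it does so for all `x` in the
complex span of the set. -/
lemma smul_mem_of_mem_span {P : DX N} {s : Set M} {x : M} (V : Submodule ℂ M)
    (hx : x ∈ Submodule.span ℂ s) (h : ∀ y ∈ s, P • y ∈ V) : P • x ∈ V := by
  induction hx using Submodule.span_induction with
  | zero => simp
  | add x y _ _ hx hy => rw [smul_add]; exact V.add_mem hx hy
  | smul c x _ hx => rw [smul_comm]; exact V.smul_mem _ hx
  | mem x hx => exact h x hx

variable {fr : ι → Frame N} {lv : ι → ℕ} {g : ι → M}

variable (fr g) in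
/-- The element of `M` with the given coefficients in normal form. -/
def nf : (ι → MvPolynomial (Fin N) ℂ) →ₗ[ℂ] M where
  toFun p := ∑ e, (fr e).A (p e) • g e
  map_add' p q := by simp [add_smul, Finset.sum_add_distrib]
  map_smul' c p := by simp [Finset.smul_sum]

lemma nf_apply (p : ι → MvPolynomial (Fin N) ℂ) : nf fr g p = ∑ e, (fr e).A (p e) • g e := rfl

lemma nf_single [DecidableEq ι] (e : ι) (q : MvPolynomial (Fin N) ℂ) :
    nf fr g (Pi.single e q) = (fr e).A q • g e := by
  rw [nf_apply, Finset.sum_eq_single e]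
  · simp
  · intro e' _ h; simp [h]
  · simp

variable (fr lv) in
/-- The coefficients of the normal forms of the elements of `levelFiltration`. -/
def nfSet (m : ℤ) (l : ℕ) : Submodule ℂ (ι → MvPolynomial (Fin N) ℂ) where
  carrier := {p | ∀ e μ, coeff μ (p e) ≠ 0 →
    (Finsupp.weight (fr e).ordA μ : ℤ) ≤ orderBound m l (lv e)}
  zero_mem' := by simp
  add_mem' := by
    intro p q hp hq e μ h
    by_cases h0 : coeff μ (p e) = 0
    · refine hq e μ fun h1 => h ?_
      simp [h0, h1]
    · exact hp e μ h0
  smul_mem' := by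
    intro c p hp e μ h
    refine hp e μ fun h1 => h ?_
    simp [h1]

lemma single_mem_nfSet [DecidableEq ι] {m : ℤ} {l : ℕ} {e : ι} {q : MvPolynomial (Fin N) ℂ}
    (h : ∀ μ, coeff μ q ≠ 0 → (Finsupp.weight (fr e).ordA μ : ℤ) ≤ orderBound m l (lv e)) :
    Pi.single e q ∈ nfSet fr lv m l := by
  intro e' μ hμ
  rcases eq_or_ne e' e with rfl | h'
  · rw [Pi.single_eq_same] at hμ; exact h μ hμ
  · rw [Pi.single_eq_of_ne h'] at hμ; simp at hμ

lemma Frame.A_mem_ordLE_int (fr : Frame N) {k : ℤ} {p : MvPolynomial (Fin N) ℂ}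
    (hp : ∀ μ, coeff μ p ≠ 0 → (Finsupp.weight fr.ordA μ : ℤ) ≤ k) : fr.A p ∈ ordLE N k := by
  rcases lt_or_ge k 0 with hk | hk
  · have : p = 0 := by
      ext μ
      by_contra h
      have := hp μ h
      omega
    simp [this]
  · obtain ⟨k, rfl⟩ := Int.eq_ofNat_of_zero_le hk
    exact fr.A_mem_ordLE fun μ hμ => by exact_mod_cast hp μ hμ

lemma nf_mem_levelFiltration {m : ℤ} {l : ℕ} {p : ι → MvPolynomial (Fin N) ℂ}
    (hp : p ∈ nfSet fr lv m l) : nf fr g p ∈ levelFiltration N lv g m l :=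
  ⟨fun e => (fr e).A (p e), fun e => (fr e).A_mem_ordLE_int (hp e), rfl⟩

namespace HasNormalForms

/-- Rewriting of an operator applied to a generator into normal form: a factor `b i` on the right
is absorbed by the generator at the cost of changing its level, which the bound on the order of the
remaining operator compensates. -/
lemma smul_mem_map_nf (h : HasNormalForms fr lv g) {m : ℤ} {l : ℕ} (n : ℕ) :
    ∀ (k : ℕ) (e : ι) (P : DX N), P ∈ (fr e).W k n → (k : ℤ) ≤ orderBound m l (lv e) →
      P • g e ∈ (nfSet fr lv m l).map (nf fr g) := by
  classical
  induction n with
  | zero =>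
    intro k e P hP hk
    obtain ⟨p, hp, rfl⟩ := hP
    have : p = C (coeff 0 p) := by
      ext μ
      rw [coeff_C]
      split_ifs with h0
      · rw [h0]
      · by_contra hμ
        have := (mem_bidegLE.1 hp μ hμ).2
        rw [Nat.le_zero, Finsupp.degree_eq_zero_iff] at this
        exact h0 this.symm
    rw [this, ← mul_one (C _), ← smul_eq_C_mul, map_smul, Frame.ρ_one, smul_assoc, one_smul]
    refine Submodule.smul_mem _ _ ⟨Pi.single e 1, single_mem_nfSet fun μ hμ => ?_, ?_⟩
    · rw [coeff_one] at hμ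
      have : μ = 0 := by by_contra h0; exact hμ (if_neg (Ne.symm h0))
      subst this
      simp only [map_zero, Nat.cast_zero]
      omega
    · rw [nf_single, map_one, one_smul]
  | succ n ih =>
    intro k e P hP hk
    rw [Frame.W, bidegLE, restrictSupport_eq_span, Submodule.map_span] at hP
    induction hP using Submodule.span_induction with
    | zero => simp
    | add P Q _ _ hP hQ => rw [add_smul]; exact Submodule.add_mem _ hP hQ
    | smul c P _ hP => rw [smul_assoc]; exact Submodule.smul_mem _ _ hP
    | mem P hP =>
      obtain ⟨_, ⟨μ, ⟨h1, h2⟩, rfl⟩, rfl⟩ := hP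
      by_cases hb : ∃ i, μ (Sum.inr i) ≠ 0
      · obtain ⟨i, hi⟩ := hb
        obtain ⟨ν, rfl⟩ := Frame.exists_eq_single_add hi
        rw [Frame.weight_inl_single_add] at h1
        rw [map_add, Finsupp.degree_single] at h2
        dsimp only
        rw [Frame.monomial_single_add, mul_comm, Frame.ρ_mul_X_inr, mul_smul]
        refine smul_mem_of_mem_span _ (h.b_smul e i) ?_
        rintro _ ⟨e', he', rfl⟩
        have hν : (fr e).ρ (monomial ν 1) ∈ (fr e').W (Finsupp.weight (fr e).ord ν) n := by
          rw [Frame.W_eq _ (fr e)]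
          exact ⟨_, monomial_mem_bidegLE _ le_rfl (by omega), rfl⟩
        refine ih _ e' _ hν ?_
        have h3 : (Finsupp.weight (fr e).ord ν : ℤ) ≤ k - (fr e).ord (Sum.inr i) := by omega
        refine h3.trans ?_
        by_cases hS : i ∈ (fr e).S
        · rw [if_pos hS] at he'
          have : (fr e).ord (Sum.inr i) = 0 := by simp [Frame.ord, hS]
          rw [this]
          have := orderBound_le m l (lv e)
          have := le_orderBound m l (lv e')
          push_cast; omega
        · rw [if_neg hS] at he'
          have : (fr e).ord (Sum.inr i) = 1 := by simp [Frame.ord, hS]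
          rw [this]
          unfold orderBound at hk ⊢
          split_ifs at hk ⊢ <;> push_cast <;> omega
      · push Not at hb
        obtain ⟨u, rfl⟩ : ∃ u : Fin N →₀ ℕ, μ = Finsupp.mapDomain Sum.inl u := by
          obtain ⟨⟨u, v⟩, rfl⟩ := Finsupp.sumFinsuppEquivProdFinsupp.symm.surjective μ
          refine ⟨u, ?_⟩
          rw [sumFinsupp_symm_eq]
          suffices v = 0 by simp [this]
          refine Finsupp.ext fun j => ?_
          simpa using hb j
        dsimp only
        rw [← rename_monomial, Frame.ρ_rename]
        refine ⟨Pi.single e (monomial u 1), single_mem_nfSet fun μ hμ => ?_, nf_single _ _⟩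
        rw [coeff_monomial] at hμ
        have : u = μ := by by_contra h0; exact hμ (if_neg h0)
        subst this
        refine le_trans ?_ hk
        have h4 : Finsupp.weight (fr e).ord (Finsupp.mapDomain Sum.inl u)
            = Finsupp.weight (fr e).ordA u := by
          rw [Finsupp.weight_apply, Finsupp.weight_apply, Finsupp.sum_mapDomain_index (by simp)
            (by intros; simp [add_mul])]
          rfl
        rw [← h4]
        exact_mod_cast h1

/-- The filtration can be read off from the orders of the coefficients of normal forms. -/
lemma mem_levelFiltration_iff (h : HasNormalForms fr lv g) {m : ℤ} {l : ℕ} {x : M} :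
    x ∈ levelFiltration N lv g m l ↔ ∃ p ∈ nfSet fr lv m l, nf fr g p = x := by
  constructor
  · rintro ⟨P, hP, rfl⟩
    suffices ∑ e, P e • g e ∈ (nfSet fr lv m l).map (nf fr g) from this
    refine Submodule.sum_mem _ fun e _ => ?_
    rcases lt_or_ge (orderBound m l (lv e)) 0 with hk | hk
    · have := hP e
      rw [ordLE_eq_bot hk, Submodule.mem_bot] at this
      simp [this]
    · obtain ⟨k, hk'⟩ := Int.eq_ofNat_of_zero_le hk
      have := hP e
      rw [hk'] at this
      obtain ⟨n, hn⟩ := (fr e).exists_mem_W this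
      exact h.smul_mem_map_nf n k e _ hn hk'.ge
  · rintro ⟨p, hp, rfl⟩
    exact nf_mem_levelFiltration hp

lemma exists_mem_levelFiltration (h : HasNormalForms fr lv g) (x : M) :
    ∃ m, x ∈ levelFiltration N lv g m 0 := by
  have hx : x ∈ Submodule.span (DX N) (Set.range g) := h.span_eq_top ▸ Submodule.mem_top
  obtain ⟨P, rfl⟩ := (Submodule.mem_span_range_iff_exists_fun _).1 hx
  have h1 : ∀ Q : DX N, ∃ k : ℕ, Q ∈ ordLE N k := by
    intro Q
    obtain ⟨p, rfl⟩ := Frame.ρ_surjective ⟨0, Pi.basisFun ℂ (Fin N), ∅⟩ Q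
    exact ⟨_, Frame.W_le_ordLE _ ⟨p, mem_bidegLE.2 fun μ hμ =>
      ⟨(Finset.le_sup (f := Finsupp.weight _) (mem_support_iff.2 hμ)),
        degree_le_totalDegree hμ⟩, rfl⟩⟩
  choose k hk using fun e => h1 (P e)
  refine ⟨∑ e, ((k e : ℤ) + lv e), P, fun e => ordLE_mono ?_ (hk e), rfl⟩
  rw [orderBound_zero]
  have := Finset.single_le_sum (f := fun e => (k e : ℤ) + lv e) (fun e _ => by positivity)
    (Finset.mem_univ e)
  omega

/-- The normal form isomorphism. -/
def nfEquiv (h : HasNormalForms fr lv g) :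
    (ι → MvPolynomial (Fin N) ℂ) ≃ₗ[ℂ] M :=
  LinearEquiv.ofBijective (nf fr g) ⟨by
    rw [← LinearMap.ker_eq_bot, LinearMap.ker_eq_bot']
    exact h.injective, fun x => by
      obtain ⟨m, hm⟩ := h.exists_mem_levelFiltration x
      obtain ⟨p, -, hp⟩ := h.mem_levelFiltration_iff.1 hm
      exact ⟨p, hp⟩⟩

lemma nfEquiv_symm_nf (h : HasNormalForms fr lv g) (p : ι → MvPolynomial (Fin N) ℂ) :
    h.nfEquiv.symm (nf fr g p) = p := h.nfEquiv.symm_apply_apply p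

lemma nf_nfEquiv_symm (h : HasNormalForms fr lv g) (x : M) :
    nf fr g (h.nfEquiv.symm x) = x := h.nfEquiv.apply_symm_apply x

lemma nfEquiv_symm_mem (h : HasNormalForms fr lv g) {m : ℤ} {l : ℕ} {x : M}
    (hx : x ∈ levelFiltration N lv g m l) : h.nfEquiv.symm x ∈ nfSet fr lv m l := by
  obtain ⟨p, hp, rfl⟩ := h.mem_levelFiltration_iff.1 hx
  rwa [nfEquiv_symm_nf]

end HasNormalForms

end NormalForms

end QuiverDMod

namespace QuiverDMod

open MvPolynomial

/-! ### Leading terms of normal forms -/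

namespace Frame

variable {N : ℕ} (fr : Frame N)

/-- The restriction of the coordinate function `x_i` to the flat of the frame. -/
def resX (i : Fin N) : MvPolynomial (Fin N) ℂ :=
  C (fr.o i) + ∑ j, if j ∈ fr.S then 0 else C (fr.η j i) * X j

/-- The restriction of the symbol `ξ_i` to the conormal directions of the flat of the frame. -/
def resΞ (i : Fin N) : MvPolynomial (Fin N) ℂ :=
  ∑ j, if j ∈ fr.S then C (fr.η.coord j (Pi.single i 1)) * X j else 0

/-- The restriction of functions on the cotangent bundle to the conormal bundle of the flat of the
frame, whose coordinates are the symbols of the operators `a`. -/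
def res : CotPoly N →ₐ[ℂ] MvPolynomial (Fin N) ℂ := aeval (Sum.elim fr.resX fr.resΞ)

lemma res_X_inl (i : Fin N) : fr.res (X (Sum.inl i)) = fr.resX i := by simp [res]

lemma res_X_inr (i : Fin N) : fr.res (X (Sum.inr i)) = fr.resΞ i := by simp [res]

lemma mulOp_X_eq (i : Fin N) : mulOp N (X i)
    = fr.A (fr.resX i) + ∑ j, if j ∈ fr.S then fr.η j i • fr.b j else 0 := by
  rw [← affinePoly_coordFun, fr.affine_eq, resX, map_add, map_add, add_assoc, map_sum, map_sum,
    ← Finset.sum_add_distrib]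
  congr 1
  · rw [mulOp_C, ← algebraMap_eq, AlgHom.commutes]; rfl
  · refine Finset.sum_congr rfl fun j _ => ?_
    rw [map_mul, mulOp_C, ← Algebra.smul_def]
    split_ifs with h
    · rw [map_zero, zero_add, b, if_pos h]; rfl
    · rw [map_mul, A_X, ← algebraMap_eq, AlgHom.commutes, ← Algebra.smul_def, add_zero, a,
        if_neg h]
      rfl

lemma partialOp_eq (i : Fin N) : partialOp i = fr.A (fr.resΞ i)
    + ∑ j, if j ∈ fr.S then 0 else fr.η.coord j (Pi.single i 1) • fr.b j := by
  rw [← vectorField_single, fr.vectorField_eq, resΞ, map_sum, ← Finset.sum_add_distrib]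
  refine Finset.sum_congr rfl fun j _ => ?_
  split_ifs with h
  · rw [map_mul, A_X, ← algebraMap_eq, AlgHom.commutes, ← Algebra.smul_def, add_zero, a, if_pos h]
  · rw [map_zero, zero_add, b, if_neg h]

lemma homPart_resX_mul (i : Fin N) (k : ℤ) (p : MvPolynomial (Fin N) ℂ) :
    homPart fr.ordA k (fr.resX i * p) = fr.resX i * homPart fr.ordA k p := by
  rw [resX, add_mul, add_mul, map_add, Finset.sum_mul, Finset.sum_mul, map_sum, ← smul_eq_C_mul,
    ← smul_eq_C_mul, map_smul]
  congr 1
  refine Finset.sum_congr rfl fun j _ => ?_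
  split_ifs with h
  · simp
  · rw [mul_assoc, mul_assoc, ← smul_eq_C_mul, ← smul_eq_C_mul, map_smul, ← homPart_X_mul]
    simp [ordA, h]

lemma homPart_resΞ_mul (i : Fin N) (k : ℤ) (p : MvPolynomial (Fin N) ℂ) :
    homPart fr.ordA (k + 1) (fr.resΞ i * p) = fr.resΞ i * homPart fr.ordA k p := by
  rw [resΞ, Finset.sum_mul, Finset.sum_mul, map_sum]
  refine Finset.sum_congr rfl fun j _ => ?_
  split_ifs with h
  · rw [mul_assoc, mul_assoc, ← smul_eq_C_mul, ← smul_eq_C_mul, map_smul, ← homPart_X_mul]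
    simp [ordA, h]
  · simp

end Frame

section Leading

variable {N : ℕ} {ι M : Type*} [Fintype ι] [AddCommGroup M] [Module (DX N) M] [Module (OX N) M]
  [IsScalarTower (OX N) (DX N) M] [Module ℂ M] [IsScalarTower ℂ (DX N) M]
  {fr : ι → Frame N} {lv : ι → ℕ} {g : ι → M}

lemma coeff_pderiv_weight {fr : Frame N} {k : ℤ} {q : MvPolynomial (Fin N) ℂ} (j : Fin N)
    (hq : ∀ μ, coeff μ q ≠ 0 → (Finsupp.weight fr.ordA μ : ℤ) ≤ k) (μ : Fin N →₀ ℕ)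
    (hμ : coeff μ (pderiv j q) ≠ 0) : (Finsupp.weight fr.ordA μ : ℤ) ≤ k - fr.ordA j := by
  rw [coeff_pderiv] at hμ
  have h := hq _ (left_ne_zero_of_mul hμ)
  rw [map_add, Finsupp.weight_single] at h
  push_cast at h
  simp only [one_smul] at h
  omega

namespace HasNormalForms

lemma b_smul_mem (h : HasNormalForms fr lv g) {m : ℤ} {l : ℕ} {P : DX N} {e : ι} (i : Fin N)
    (hP : ∀ e', (if i ∈ (fr e).S then lv e' + 1 = lv e else lv e' = lv e + 1) →
      P ∈ ordLE N (orderBound m l (lv e'))) :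
    (P * (fr e).b i) • g e ∈ levelFiltration N lv g m l := by
  rw [mul_smul]
  refine smul_mem_of_mem_span (restrictComplex (levelFiltration N lv g m l)) (h.b_smul e i) ?_
  rintro _ ⟨e', he', rfl⟩
  exact smul_mem_levelFiltration (hP e' he')

/-- The functions vanishing on the flat of a generator lower the filtration. -/
lemma b_smul_mem_of_mem (h : HasNormalForms fr lv g) {m : ℤ} {e : ι} {j : Fin N}
    (hj : j ∈ (fr e).S) {q : MvPolynomial (Fin N) ℂ}
    (hq : ∀ μ, coeff μ q ≠ 0 → (Finsupp.weight (fr e).ordA μ : ℤ) ≤ m - lv e) :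
    ((fr e).b j * (fr e).A q) • g e ∈ levelFiltration N lv g (m - 1) 0 := by
  rw [Frame.b_mul_A, add_smul]
  refine Submodule.add_mem _ (h.b_smul_mem j fun e' he' => ?_) (smul_mem_levelFiltration ?_)
  · rw [if_pos hj] at he'
    refine ordLE_mono ?_ ((fr e).A_mem_ordLE_int hq)
    rw [orderBound_zero]; omega
  · refine complex_smul_mem_ordLE _ ((fr e).A_mem_ordLE_int fun μ hμ => ?_)
    have := coeff_pderiv_weight j hq μ hμ
    rw [orderBound_zero]
    simp only [Frame.ordA, if_pos hj] at this
    push_cast at this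
    omega

/-- The vector fields along the flat of a generator raise the level. -/
lemma b_smul_mem_of_notMem (h : HasNormalForms fr lv g) {m : ℤ} {e : ι} {j : Fin N}
    (hj : j ∉ (fr e).S) {q : MvPolynomial (Fin N) ℂ}
    (hq : ∀ μ, coeff μ q ≠ 0 → (Finsupp.weight (fr e).ordA μ : ℤ) ≤ m - lv e) :
    ((fr e).b j * (fr e).A q) • g e ∈ levelFiltration N lv g (m + 1) (lv e + 1) := by
  rw [Frame.b_mul_A, add_smul]
  refine Submodule.add_mem _ (h.b_smul_mem j fun e' he' => ?_) (smul_mem_levelFiltration ?_)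
  · rw [if_neg hj] at he'
    refine ordLE_mono ?_ ((fr e).A_mem_ordLE_int hq)
    rw [orderBound_of_le (by omega)]; omega
  · refine complex_smul_mem_ordLE _ ((fr e).A_mem_ordLE_int fun μ hμ => ?_)
    have := coeff_pderiv_weight j hq μ hμ
    rw [orderBound_of_lt (by omega)]
    simp only [Frame.ordA, if_neg hj] at this
    push_cast at this
    omega

lemma X_smul_nf_sub_mem (h : HasNormalForms fr lv g) {m : ℤ} (i : Fin N)
    {p : ι → MvPolynomial (Fin N) ℂ} (hp : p ∈ nfSet fr lv m 0) :
    (X i : OX N) • nf fr g p - nf fr g (fun e => (fr e).resX i * p e)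
      ∈ levelFiltration N lv g (m - 1) 0 := by
  rw [← mulOp_smul, nf_apply, nf_apply, Finset.smul_sum, ← Finset.sum_sub_distrib]
  refine Submodule.sum_mem _ fun e _ => ?_
  rw [(fr e).mulOp_X_eq i, ← mul_smul, ← sub_smul, map_mul, add_mul, add_sub_cancel_left,
    Finset.sum_mul, Finset.sum_smul]
  refine Submodule.sum_mem _ fun j _ => ?_
  split_ifs with hj
  · rw [smul_mul_assoc, smul_assoc]
    refine complex_smul_mem_of_mem _ _ (h.b_smul_mem_of_mem hj fun μ hμ => ?_)
    simpa [orderBound_zero] using hp e μ hμ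
  · simp

lemma partialOp_smul_nf_sub_mem (h : HasNormalForms fr lv g) {m : ℤ} {l : ℕ} (i : Fin N)
    {p : ι → MvPolynomial (Fin N) ℂ} (hp : p ∈ nfSet fr lv m l) :
    (partialOp i : DX N) • nf fr g p - nf fr g (fun e => (fr e).resΞ i * p e)
      ∈ levelFiltration N lv g (m + 1) (l + 1) := by
  rw [nf_apply, nf_apply, Finset.smul_sum, ← Finset.sum_sub_distrib]
  refine Submodule.sum_mem _ fun e _ => ?_
  rw [(fr e).partialOp_eq i, ← mul_smul, ← sub_smul, map_mul, add_mul, add_sub_cancel_left,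
    Finset.sum_mul, Finset.sum_smul]
  refine Submodule.sum_mem _ fun j _ => ?_
  split_ifs with hj
  · simp
  · rw [smul_mul_assoc, smul_assoc]
    refine complex_smul_mem_of_mem _ _ ?_
    rcases le_or_gt l (lv e) with hl | hl
    · refine levelFiltration_mono (fun e' => ?_)
        (h.b_smul_mem_of_notMem (m := m) hj fun μ hμ => ?_)
      · unfold orderBound; split_ifs <;> omega
      · simpa [orderBound_of_le hl] using hp e μ hμ
    · refine levelFiltration_mono (fun e' => ?_)
        (h.b_smul_mem_of_notMem (m := m - 1) hj fun μ hμ => ?_)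
      · unfold orderBound; split_ifs <;> omega
      · simpa [orderBound_of_lt hl] using hp e μ hμ

/-- The part of order exactly `m - lv e` of the coefficient of the generator `g e`. -/
def leading (h : HasNormalForms fr lv g) (e : ι) (m : ℤ) : M →ₗ[ℂ] MvPolynomial (Fin N) ℂ :=
  (homPart (fr e).ordA (m - lv e)).comp
    ((LinearMap.proj e).comp h.nfEquiv.symm.toLinearMap)

lemma leading_apply (h : HasNormalForms fr lv g) (e : ι) (m : ℤ) (x : M) :
    h.leading e m x = homPart (fr e).ordA (m - lv e) (h.nfEquiv.symm x e) := rfl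

lemma leading_eq_zero_of_lt (h : HasNormalForms fr lv g) {e : ι} {m : ℤ} {l : ℕ} (hl : lv e < l)
    {x : M} (hx : x ∈ levelFiltration N lv g m l) : h.leading e m x = 0 := by
  rw [leading_apply]
  refine homPart_eq_zero fun μ hμ => ?_
  have := h.nfEquiv_symm_mem hx e μ hμ
  rw [orderBound_of_lt hl] at this
  omega

lemma leading_eq_zero (h : HasNormalForms fr lv g) {e : ι} {m : ℤ}
    {x : M} (hx : x ∈ levelFiltration N lv g (m - 1) 0) : h.leading e m x = 0 :=
  h.leading_eq_zero_of_lt (Nat.lt_succ_self _) (levelFiltration_pred_le _ _ hx)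

lemma leading_X_smul (h : HasNormalForms fr lv g) (e : ι) {m : ℤ} (i : Fin N) {x : M}
    (hx : x ∈ levelFiltration N lv g m 0) :
    h.leading e m ((X i : OX N) • x) = (fr e).resX i * h.leading e m x := by
  obtain ⟨p, hp, rfl⟩ := h.mem_levelFiltration_iff.1 hx
  have h1 := h.leading_eq_zero (e := e) (h.X_smul_nf_sub_mem i hp)
  rw [map_sub, sub_eq_zero] at h1
  rw [h1, leading_apply, leading_apply, nfEquiv_symm_nf, nfEquiv_symm_nf, Frame.homPart_resX_mul]

lemma leading_smul (h : HasNormalForms fr lv g) (e : ι) {m : ℤ} (f : OX N) :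
    ∀ {x : M}, x ∈ levelFiltration N lv g m 0 →
      h.leading e m (f • x) = (fr e).res (rename Sum.inl f) * h.leading e m x := by
  induction f using MvPolynomial.induction_on with
  | C c =>
    intro x _
    have : (C c : OX N) • x = c • x := by rw [← mulOp_smul, mulOp_C, algebraMap_smul]
    rw [this, map_smul, rename_C, ← algebraMap_eq, AlgHom.commutes, Algebra.smul_def]
  | add f f' hf hf' =>
    intro x hx
    rw [add_smul, map_add, hf hx, hf' hx, map_add, map_add, add_mul]
  | mul_X f i hf =>
    intro x hx
    rw [mul_smul, hf (Submodule.smul_mem _ _ hx), h.leading_X_smul e i hx, map_mul, map_mul,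
      rename_X, Frame.res_X_inl, mul_assoc]

lemma leading_partialOp_smul (h : HasNormalForms fr lv g) (e : ι) {m : ℤ} (i : Fin N) {x : M}
    (hx : x ∈ levelFiltration N lv g m (lv e)) :
    h.leading e (m + 1) ((partialOp i : DX N) • x) = (fr e).resΞ i * h.leading e m x := by
  obtain ⟨p, hp, rfl⟩ := h.mem_levelFiltration_iff.1 hx
  have h1 := h.leading_eq_zero_of_lt (Nat.lt_succ_self _) (h.partialOp_smul_nf_sub_mem i hp)
  rw [map_sub, sub_eq_zero] at h1
  rw [h1, leading_apply, leading_apply, nfEquiv_symm_nf, nfEquiv_symm_nf,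
    show m + 1 - (lv e : ℤ) = m - lv e + 1 by ring, Frame.homPart_resΞ_mul]

lemma nfEquiv_symm_A_smul [DecidableEq ι] (h : HasNormalForms fr lv g) (e : ι)
    (q : MvPolynomial (Fin N) ℂ) : h.nfEquiv.symm ((fr e).A q • g e) = Pi.single e q := by
  rw [← nf_single, nfEquiv_symm_nf]

/-- The level filtration is good. -/
lemma isGoodFiltration (h : HasNormalForms fr lv g) :
    IsGoodFiltration (N := N) (M := M) fun m => levelFiltration N lv g m 0 where
  mono m m' hm := levelFiltration_mono fun e => by simp only [orderBound_zero]; omega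
  eventually_zero := by
    refine ⟨-1, fun m hm => ?_⟩
    rw [eq_bot_iff]
    rintro _ ⟨P, hP, rfl⟩
    rw [Submodule.mem_bot]
    refine Finset.sum_eq_zero fun e _ => ?_
    have := hP e
    rw [ordLE_eq_bot (by rw [orderBound_zero]; omega), Submodule.mem_bot] at this
    rw [this, zero_smul]
  exhaustive := h.exists_mem_levelFiltration
  smul_mem k l P u hP hu := by
    rw [add_comm]
    exact ordLE_smul_mem_levelFiltration hP hu
  stable := by
    refine ⟨∑ e, (lv e : ℤ), fun l hl k hk => le_antisymm ?_ (Submodule.span_le.2 ?_)⟩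
    · rintro _ ⟨P, hP, rfl⟩
      refine Submodule.sum_mem _ fun e _ => ?_
      have hle : (lv e : ℤ) ≤ l := le_trans (Finset.single_le_sum
        (f := fun e => (lv e : ℤ)) (fun e _ => by positivity) (Finset.mem_univ e)) hl
      have h1 := hP e
      rw [orderBound_zero, add_sub_assoc] at h1
      have h2 := ordLE_add_le hk (by omega) h1
      generalize P e = Q at h2
      induction h2 using Submodule.span_induction with
      | zero => simp
      | add Q Q' _ _ hQ hQ' => rw [add_smul]; exact Submodule.add_mem _ hQ hQ'
      | smul f Q _ hQ => rw [smul_assoc]; exact Submodule.smul_mem _ _ hQ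
      | mem Q hQ =>
        obtain ⟨P₁, h₁, P₂, h₂, rfl⟩ := hQ
        refine Submodule.subset_span ⟨P₁, h₁, P₂ • g e, smul_mem_levelFiltration ?_, mul_smul _ _ _⟩
        rwa [orderBound_zero]
    · rintro _ ⟨P, hP, u, hu, rfl⟩
      rw [add_comm]
      exact ordLE_smul_mem_levelFiltration hP hu
  fg m := by
    have h1 : levelFiltration N lv g m 0 = ⨆ e, (ordLE N (orderBound m 0 (lv e))).map
        ((LinearMap.toSpanSingleton (DX N) M (g e)).restrictScalars (OX N)) := by
      refine le_antisymm ?_ (iSup_le fun e => ?_)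
      · rintro _ ⟨P, hP, rfl⟩
        exact Submodule.sum_mem _ fun e _ =>
          Submodule.mem_iSup_of_mem e ⟨P e, hP e, rfl⟩
      · rintro _ ⟨P, hP, rfl⟩
        exact smul_mem_levelFiltration hP
    rw [h1]
    exact Submodule.fg_iSup _ fun e => (ordLE_fg _).map _

end HasNormalForms

end Leading

end QuiverDMod

namespace QuiverDMod

open MvPolynomial

/-! ### The associated graded module -/

section GrClass

variable {N : ℕ} {M : Type*} [AddCommGroup M] [Module (DX N) M] [Module (OX N) M]

/-- The scalar multiplication underlying the module structure of the associated graded module. -/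
instance grSMul (F : ℤ → Submodule (OX N) M) : SMul (OX N) (Gr F) :=
  DistribSMul.toSMulZeroClass.toSMul

/-- The class in the associated graded module of an element of the filtration. -/
def grClass (F : ℤ → Submodule (OX N) M) (m : ℤ) : F m →ₗ[OX N] Gr F :=
  (DirectSum.lof (OX N) ℤ (GrPiece F) m).comp (Submodule.mkQ _)

variable {F : ℤ → Submodule (OX N) M}

lemma grClass_eq_zero {m : ℤ} {u : F m} (hu : (u : M) ∈ F (m - 1)) : grClass F m u = 0 := by
  have : (Submodule.mkQ ((F (m - 1)).submoduleOf (F m))) u = 0 :=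
    (Submodule.Quotient.mk_eq_zero _).2 hu
  rw [grClass, LinearMap.comp_apply, this, map_zero]

lemma grClass_eq_zero_iff {m : ℤ} {u : F m} : grClass F m u = 0 ↔ (u : M) ∈ F (m - 1) := by
  refine ⟨fun h => ?_, grClass_eq_zero⟩
  rw [grClass, LinearMap.comp_apply, DirectSum.lof_eq_of] at h
  have h1 := DirectSum.of_injective m (h.trans (map_zero _).symm)
  rw [← LinearMap.mem_ker, Submodule.ker_mkQ] at h1
  exact h1

lemma grClass_heq {m m' : ℤ} (h : m = m') (u : M) (hu : u ∈ F m) (hu' : u ∈ F m') :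
    grClass F m ⟨u, hu⟩ = grClass F m' ⟨u, hu'⟩ := by subst h; rfl

lemma gr_induction {motive : Gr F → Prop} (z : Gr F) (zero : motive 0)
    (add : ∀ z z', motive z → motive z' → motive (z + z'))
    (mk : ∀ m (u : F m), motive (grClass F m u)) : motive z := by
  induction z using DirectSum.induction_on with
  | zero => exact zero
  | add z z' h h' => exact add z z' h h'
  | of m u =>
    obtain ⟨u, rfl⟩ := Submodule.Quotient.mk_surjective _ u
    exact mk m u

variable [IsScalarTower (OX N) (DX N) M]

lemma symbolOp_grClass (hF : IsGoodFiltration F) (i : Fin N) (m : ℤ) (u : F m) :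
    symbolOp hF i (grClass F m u) = grClass F (m + 1) ⟨partialOp i • (u : M), hF.partial_mem i u.2⟩ :=
  symbolOp_lof hF i m u

lemma symbolAction_X (hF : IsGoodFiltration F) (i : Fin N) :
    symbolAction hF (X i) = symbolOp hF i := by
  simp [symbolAction]

/-- The action of functions on the cotangent bundle on the associated graded module. -/
def cotAction (hF : IsGoodFiltration F) : CotPoly N →+* Module.End (OX N) (Gr F) :=
  (symbolAction hF : MvPolynomial (Fin N) (OX N) →+* _).comp (cotHom N : CotPoly N →+* _)

lemma mem_charIdeal {hF : IsGoodFiltration F} {p : CotPoly N} :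
    p ∈ charIdeal hF ↔ cotAction hF p = 0 := Iff.rfl

lemma cotAction_X_inr (hF : IsGoodFiltration F) (i : Fin N) :
    cotAction hF (X (Sum.inr i)) = symbolOp hF i := by
  simp [cotAction, cotHom, symbolAction_X]

lemma cotAction_rename_inl (hF : IsGoodFiltration F) (f : OX N) (z : Gr F) :
    cotAction hF (rename Sum.inl f) z = f • z := by
  have h1 : cotHom N (rename Sum.inl f) = C f := by
    induction f using MvPolynomial.induction_on with
    | C c =>
      rw [rename_C, ← algebraMap_eq, AlgHom.commutes]; rfl
    | add p q hp hq => rw [map_add, map_add, hp, hq, map_add]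
    | mul_X p i hp => rw [map_mul, map_mul, hp, map_mul, rename_X]; simp [cotHom]
  have h2 : symbolAction hF (C f) = algebraMap (OX N) _ f := by
    rw [← algebraMap_eq, AlgHom.commutes]
  change symbolAction hF (cotHom N (rename Sum.inl f)) z = _
  rw [h1, h2]
  rfl

lemma cotAction_C (hF : IsGoodFiltration F) (c : ℂ) (z : Gr F) :
    cotAction hF (C c) z = (C c : OX N) • z := by
  rw [← cotAction_rename_inl hF, rename_C]

lemma cotAction_mul_apply (hF : IsGoodFiltration F) (p q : CotPoly N) (z : Gr F) :
    cotAction hF (p * q) z = cotAction hF p (cotAction hF q z) := by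
  rw [map_mul]; rfl

/-- An additive subgroup of the associated graded module that is preserved by the functions on the
base and by the symbols `ξ_i` is preserved by all functions on the cotangent bundle. -/
lemma cotAction_mem (hF : IsGoodFiltration F) (V : Submodule (OX N) (Gr F))
    (hV : ∀ i, ∀ z ∈ V, symbolOp hF i z ∈ V) (p : CotPoly N) :
    ∀ z ∈ V, cotAction hF p z ∈ V := by
  induction p using MvPolynomial.induction_on with
  | C c => intro z hz; rw [cotAction_C]; exact V.smul_mem _ hz
  | add p q hp hq => intro z hz; rw [map_add]; exact V.add_mem (hp z hz) (hq z hz)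
  | mul_X p s hp =>
    intro z hz
    rw [cotAction_mul_apply]
    refine hp _ ?_
    rcases s with i | i
    · rw [← rename_X, cotAction_rename_inl]; exact V.smul_mem _ hz
    · rw [cotAction_X_inr]; exact hV i z hz

end GrClass

namespace Frame

variable {N : ℕ} (fr : Frame N)

/-- The symbol of the operator `b i`. -/
def bSymbol (i : Fin N) : CotPoly N :=
  if i ∈ fr.S then rename Sum.inl (affinePoly (fr.y i))
  else ∑ k, C (fr.η i k) * X (Sum.inr k)

end Frame

section Level

variable {N : ℕ} {ι M : Type*} [Fintype ι] [AddCommGroup M] [Module (DX N) M] [Module (OX N) M]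
  [IsScalarTower (OX N) (DX N) M] [Module ℂ M] [IsScalarTower ℂ (DX N) M]
  {fr : ι → Frame N} {lv : ι → ℕ} {g : ι → M}

variable (N lv g) in
/-- The filtration `∑_e D_X^{m - lv e} g_e`. -/
abbrev baseFiltration (m : ℤ) : Submodule (OX N) M := levelFiltration N lv g m 0

variable (N lv g) in
/-- The submodule of the associated graded module coming from the generators of level at
least `l`. -/
def grLevel (l : ℕ) : Submodule (OX N) (Gr (baseFiltration N lv g)) :=
  ⨆ m, ((levelFiltration N lv g m l).submoduleOf (baseFiltration N lv g m)).map
    (grClass (baseFiltration N lv g) m)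

lemma grClass_mem_grLevel {m : ℤ} {l : ℕ} {u : baseFiltration N lv g m}
    (hu : (u : M) ∈ levelFiltration N lv g m l) : grClass _ m u ∈ grLevel N lv g l :=
  Submodule.mem_iSup_of_mem m ⟨u, hu, rfl⟩

lemma grLevel_induction {l : ℕ} {motive : Gr (baseFiltration N lv g) → Prop}
    {z : Gr (baseFiltration N lv g)} (hz : z ∈ grLevel N lv g l) (zero : motive 0)
    (add : ∀ z z', motive z → motive z' → motive (z + z'))
    (mk : ∀ m (u : baseFiltration N lv g m), (u : M) ∈ levelFiltration N lv g m l →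
      motive (grClass _ m u)) : motive z := by
  induction hz using Submodule.iSup_induction' with
  | mem m z hz =>
    obtain ⟨u, hu, rfl⟩ := hz
    exact mk m u hu
  | zero => exact zero
  | add z z' _ _ h h' => exact add z z' h h'

lemma grLevel_zero : grLevel N lv g 0 = ⊤ := by
  refine eq_top_iff.2 fun z _ => ?_
  induction z using gr_induction with
  | zero => exact Submodule.zero_mem _
  | add z z' h h' => exact Submodule.add_mem _ (h trivial) (h' trivial)
  | mk m u => exact grClass_mem_grLevel u.2

lemma grLevel_eq_bot {l : ℕ} (hl : ∀ e, lv e < l) : grLevel N lv g l = ⊥ := by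
  refine eq_bot_iff.2 fun z hz => ?_
  rw [Submodule.mem_bot]
  refine grLevel_induction (motive := fun z : Gr (baseFiltration N lv g) => z = 0) hz rfl ?_ ?_
  · intro z z' h h'
    rw [h, h', add_zero]
  · intro m u hu
    refine grClass_eq_zero (levelFiltration_mono (fun e => ?_) hu)
    rw [orderBound_of_lt (hl e), orderBound_zero]

namespace HasNormalForms

variable (h : HasNormalForms fr lv g)

lemma symbolOp_mem_grLevel (i : Fin N) {l : ℕ} {z : Gr (baseFiltration N lv g)}
    (hz : z ∈ grLevel N lv g l) : symbolOp h.isGoodFiltration i z ∈ grLevel N lv g l := by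
  refine grLevel_induction
    (motive := fun z => symbolOp h.isGoodFiltration i z ∈ grLevel N lv g l) hz
    (by rw [map_zero]; exact Submodule.zero_mem _) ?_ ?_
  · intro z z' h h'
    rw [map_add]
    exact Submodule.add_mem _ h h'
  · intro m u hu
    rw [symbolOp_grClass]
    exact grClass_mem_grLevel (ordLE_smul_mem_levelFiltration (partialOp_mem i) hu)

lemma cotAction_mem_grLevel (p : CotPoly N) {l : ℕ} {z : Gr (baseFiltration N lv g)}
    (hz : z ∈ grLevel N lv g l) : cotAction h.isGoodFiltration p z ∈ grLevel N lv g l :=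
  cotAction_mem _ _ (fun i _ hz => h.symbolOp_mem_grLevel i hz) p z hz

/-- The leading coefficient of the generator `g e`, on the associated graded module. -/
def grLeading (e : ι) : Gr (baseFiltration N lv g) →+ MvPolynomial (Fin N) ℂ :=
  DirectSum.toAddMonoid fun m => (Submodule.liftQ
    ((baseFiltration N lv g (m - 1)).submoduleOf (baseFiltration N lv g m))
    ({ toFun := fun u => h.leading e m (u : M)
       map_add' := fun u v => by simp
       map_smul' := fun f u => h.leading_smul e f u.2 } :
      baseFiltration N lv g m →ₛₗ[((fr e).res.comp (rename Sum.inl) : OX N →ₐ[ℂ] _).toRingHom]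
        MvPolynomial (Fin N) ℂ)
    (fun u hu => h.leading_eq_zero (e := e) hu)).toAddMonoidHom

lemma grLeading_grClass (e : ι) (m : ℤ) (u : baseFiltration N lv g m) :
    h.grLeading e (grClass _ m u) = h.leading e m u := by
  rw [grClass, LinearMap.comp_apply, DirectSum.lof_eq_of, grLeading, DirectSum.toAddMonoid_of]
  rfl

lemma grLeading_smul (e : ι) (f : OX N) (z : Gr (baseFiltration N lv g)) :
    h.grLeading e (f • z) = (fr e).res (rename Sum.inl f) * h.grLeading e z := by
  induction z using gr_induction with
  | zero => simp
  | add z z' hz hz' => rw [smul_add, map_add, hz, hz', map_add, mul_add]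
  | mk m u => rw [← map_smul, grLeading_grClass, grLeading_grClass]; exact h.leading_smul e f u.2

/-- On the part of the associated graded module of level at least `lv e`, the leading coefficient
of `g e` is linear over the functions on the cotangent bundle. -/
lemma grLeading_cotAction (e : ι) (p : CotPoly N) : ∀ z ∈ grLevel N lv g (lv e),
    h.grLeading e (cotAction h.isGoodFiltration p z) = (fr e).res p * h.grLeading e z := by
  induction p using MvPolynomial.induction_on with
  | C c => intro z _; rw [cotAction_C, grLeading_smul, rename_C]
  | add p q hp hq =>
    intro z hz
    rw [map_add, LinearMap.add_apply, map_add, hp z hz, hq z hz, map_add, add_mul]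
  | mul_X p s hp =>
    intro z hz
    rw [cotAction_mul_apply, hp _ (h.cotAction_mem_grLevel _ hz), map_mul, mul_assoc]
    congr 1
    rcases s with i | i
    · rw [← rename_X, cotAction_rename_inl, grLeading_smul]
    · rw [cotAction_X_inr, Frame.res_X_inr]
      refine grLevel_induction (motive := fun z => h.grLeading e (symbolOp h.isGoodFiltration i z)
        = (fr e).resΞ i * h.grLeading e z) hz (by simp) ?_ ?_
      · intro z z' hz hz'
        rw [map_add, map_add, hz, hz', map_add, mul_add]
      · intro m u hu
        rw [symbolOp_grClass, grLeading_grClass, grLeading_grClass]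
        exact h.leading_partialOp_smul e i hu

lemma smul_mem_baseFiltration {m : ℤ} {e : ι} {q : MvPolynomial (Fin N) ℂ}
    (hq : ∀ μ, coeff μ q ≠ 0 → (Finsupp.weight (fr e).ordA μ : ℤ) ≤ m - lv e) :
    (fr e).A q • g e ∈ baseFiltration N lv g m := by
  refine smul_mem_levelFiltration ((fr e).A_mem_ordLE_int ?_)
  rwa [orderBound_zero]

/-- The associated graded module is generated by the classes of the normal forms. -/
lemma grLevel_le (h : HasNormalForms fr lv g) (l : ℕ) (V : AddSubmonoid (Gr (baseFiltration N lv g)))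
    (hV : ∀ e m (q : MvPolynomial (Fin N) ℂ), l ≤ lv e →
      ∀ hq : ∀ μ, coeff μ q ≠ 0 → (Finsupp.weight (fr e).ordA μ : ℤ) ≤ m - lv e,
      grClass _ m ⟨(fr e).A q • g e, smul_mem_baseFiltration hq⟩ ∈ V) :
    ∀ z ∈ grLevel N lv g l, z ∈ V := by
  intro z hz
  refine grLevel_induction (motive := fun z => z ∈ V) hz V.zero_mem (fun _ _ => V.add_mem) ?_
  intro m u hu
  obtain ⟨p, hp, hu'⟩ := h.mem_levelFiltration_iff.1 hu
  have hp0 : ∀ e μ, coeff μ (p e) ≠ 0 →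
      (Finsupp.weight (fr e).ordA μ : ℤ) ≤ m - lv e := fun e μ hμ =>
    (hp e μ hμ).trans (orderBound_le _ _ _)
  have : u = ∑ e, ⟨(fr e).A (p e) • g e, smul_mem_baseFiltration (hp0 e)⟩ := by
    ext
    rw [← hu', nf_apply, AddSubmonoidClass.coe_finsetSum]
  rw [this, map_sum]
  refine V.sum_mem fun e _ => ?_
  rcases le_or_gt l (lv e) with hl | hl
  · exact hV e m (p e) hl (hp0 e)
  · rw [grClass_eq_zero]
    · exact V.zero_mem
    · refine smul_mem_levelFiltration ((fr e).A_mem_ordLE_int fun μ hμ => ?_)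
      have := hp e μ hμ
      rw [orderBound_of_lt hl] at this
      rwa [orderBound_zero]

lemma cotAction_bSymbol (e : ι) (j : Fin N) {m : ℤ} {q : MvPolynomial (Fin N) ℂ}
    (hq : ∀ μ, coeff μ q ≠ 0 → (Finsupp.weight (fr e).ordA μ : ℤ) ≤ m - lv e) :
    cotAction h.isGoodFiltration ((fr e).bSymbol j)
      (grClass _ m ⟨(fr e).A q • g e, smul_mem_baseFiltration hq⟩)
      ∈ grLevel N lv g (lv e + 1) := by
  unfold Frame.bSymbol
  split_ifs with hj
  · have h1 := h.b_smul_mem_of_mem hj hq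
    rw [Frame.b, if_pos hj, mul_smul, mulOp_smul] at h1
    rw [cotAction_rename_inl, ← map_smul, grClass_eq_zero]
    · exact Submodule.zero_mem _
    · exact h1
  · have h1 := h.b_smul_mem_of_notMem hj hq
    rw [Frame.b, if_neg hj, mul_smul] at h1
    have h2 : ∀ u : baseFiltration N lv g m, ∃ hu' : vectorField ((fr e).η j) • (u : M) ∈
        baseFiltration N lv g (m + 1), cotAction h.isGoodFiltration
          (∑ k, C ((fr e).η j k) * X (Sum.inr k)) (grClass _ m u) = grClass _ (m + 1) ⟨_, hu'⟩ := by
      intro u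
      refine ⟨ordLE_smul_mem_levelFiltration (vectorField_mem_ordLE _ le_rfl) u.2, ?_⟩
      rw [map_sum, LinearMap.sum_apply]
      simp only [cotAction_mul_apply, cotAction_X_inr, cotAction_C, symbolOp_grClass]
      simp only [← map_smul, ← map_sum]
      congr 1
      ext
      rw [AddSubmonoidClass.coe_finsetSum]
      simp only [Submodule.coe_smul, vectorField, Finset.sum_smul]
      refine Finset.sum_congr rfl fun k _ => ?_
      rw [← mulOp_smul, mulOp_C, algebraMap_smul, smul_assoc]
    obtain ⟨hu', h3⟩ := h2 ⟨(fr e).A q • g e, smul_mem_baseFiltration hq⟩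
    rw [h3]
    exact grClass_mem_grLevel h1

/-- A function annihilating the associated graded module vanishes on the conormal bundle of each
flat. -/
lemma res_eq_zero_of_mem_charIdeal (e : ι) {p : CotPoly N}
    (hp : p ∈ charIdeal h.isGoodFiltration) : (fr e).res p = 0 := by
  classical
  have h0 : ∀ μ, coeff μ (1 : MvPolynomial (Fin N) ℂ) ≠ 0 →
      (Finsupp.weight (fr e).ordA μ : ℤ) ≤ (lv e : ℤ) - lv e := by
    intro μ hμ
    rw [coeff_one] at hμ
    have : μ = 0 := by by_contra h0; exact hμ (if_neg (Ne.symm h0))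
    simp [this]
  have h1 := h.grLeading_cotAction e p (grClass _ (lv e) ⟨(fr e).A 1 • g e,
    smul_mem_baseFiltration h0⟩) (grClass_mem_grLevel (smul_mem_levelFiltration (by
      rw [map_one, orderBound_of_le le_rfl]; exact one_mem_ordLE (by omega))))
  rw [mem_charIdeal.1 hp, LinearMap.zero_apply, map_zero, grLeading_grClass, leading_apply,
    nfEquiv_symm_A_smul, Pi.single_eq_same] at h1
  have h2 : homPart (fr e).ordA ((lv e : ℤ) - lv e) 1 = 1 := by
    ext μ
    rw [coeff_homPart, coeff_one]
    by_cases hμ : 0 = μ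
    · subst hμ; simp
    · simp [hμ]
  rw [h2, mul_one] at h1
  exact h1.symm

/-- A product of symbols of operators `b`, one for each generator, has a power annihilating the
associated graded module. -/
lemma prod_bSymbol_pow_mem_charIdeal (c : ι → Fin N) :
    ∃ n, (∏ e, (fr e).bSymbol (c e)) ^ n ∈ charIdeal h.isGoodFiltration := by
  classical
  have key : ∀ l, ∀ z ∈ grLevel N lv g l,
      cotAction h.isGoodFiltration (∏ e, (fr e).bSymbol (c e)) z ∈ grLevel N lv g (l + 1) := by
    intro l
    refine h.grLevel_le l ((grLevel N lv g (l + 1)).toAddSubmonoid.comap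
      (cotAction h.isGoodFiltration (∏ e, (fr e).bSymbol (c e))).toAddMonoidHom) ?_
    intro e m q hl hq
    have hle : grLevel N lv g (lv e + 1) ≤ grLevel N lv g (l + 1) :=
      iSup_mono fun m => Submodule.map_mono (Submodule.comap_mono (levelFiltration_mono
        fun e' => by unfold orderBound; split_ifs <;> omega))
    change cotAction h.isGoodFiltration (∏ e, (fr e).bSymbol (c e)) (grClass _ m _)
      ∈ grLevel N lv g (l + 1)
    rw [← Finset.prod_erase_mul _ _ (Finset.mem_univ e), cotAction_mul_apply]
    exact h.cotAction_mem_grLevel _ (hle (h.cotAction_bSymbol e (c e) hq))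
  have key2 : ∀ n, ∀ z, cotAction h.isGoodFiltration ((∏ e, (fr e).bSymbol (c e)) ^ n) z
      ∈ grLevel N lv g n := by
    intro n
    induction n with
    | zero => intro z; rw [grLevel_zero]; exact Submodule.mem_top
    | succ n ih =>
      intro z
      rw [pow_succ', cotAction_mul_apply]
      exact key n _ (ih z)
  refine ⟨∑ e, lv e + 1, mem_charIdeal.2 (LinearMap.ext fun z => ?_)⟩
  have := key2 (∑ e, lv e + 1) z
  rwa [grLevel_eq_bot fun e => Nat.lt_succ_of_le
    (Finset.single_le_sum (f := lv) (fun e _ => Nat.zero_le _) (Finset.mem_univ e)),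
    Submodule.mem_bot] at this

end HasNormalForms

end Level

end QuiverDMod

namespace QuiverDMod

open MvPolynomial

/-! ### Independence of the characteristic variety of the good filtration -/

section Independence

variable {N : ℕ} {M : Type*} [AddCommGroup M] [Module (DX N) M] [Module (OX N) M]
  [IsScalarTower (OX N) (DX N) M]

/-- The function `p` on the cotangent bundle acts on the associated graded module of any good
filtration of `M` as the class of the operator `P` of order `d`. -/
def IsSymbol (M : Type*) [AddCommGroup M] [Module (DX N) M] [Module (OX N) M]
    [IsScalarTower (OX N) (DX N) M] (P : DX N) (p : CotPoly N) (d : ℕ) : Prop :=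
  ∀ (F : ℤ → Submodule (OX N) M) (hF : IsGoodFiltration F) (m : ℤ) (u : F m),
    ∃ h : P • (u : M) ∈ F (m + d), cotAction hF p (grClass F m u) = grClass F (m + d) ⟨P • (u : M), h⟩

lemma IsSymbol.add {P P' : DX N} {p p' : CotPoly N} {d : ℕ} (h : IsSymbol M P p d)
    (h' : IsSymbol M P' p' d) : IsSymbol M (P + P') (p + p') d := by
  intro F hF m u
  obtain ⟨h1, h2⟩ := h F hF m u
  obtain ⟨h1', h2'⟩ := h' F hF m u
  refine ⟨by rw [add_smul]; exact Submodule.add_mem _ h1 h1', ?_⟩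
  rw [map_add, LinearMap.add_apply, h2, h2', ← map_add]
  congr 1
  ext
  simp [add_smul]

lemma IsSymbol.mul {P P' : DX N} {p p' : CotPoly N} {d d' : ℕ} (h : IsSymbol M P p d)
    (h' : IsSymbol M P' p' d') : IsSymbol M (P * P') (p * p') (d + d') := by
  intro F hF m u
  obtain ⟨h1', h2'⟩ := h' F hF m u
  obtain ⟨h1, h2⟩ := h F hF _ ⟨P' • (u : M), h1'⟩
  have h3 : P • P' • (u : M) ∈ F (m + (d + d' : ℕ)) := by
    rw [show m + (d + d' : ℕ) = m + d' + d by push_cast; ring]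
    exact h1
  refine ⟨by rwa [mul_smul], ?_⟩
  rw [cotAction_mul_apply, h2', h2, grClass_heq (by push_cast; ring) _ h1 h3]
  simp only [mul_smul]

lemma IsSymbol.pow {P : DX N} {p : CotPoly N} {d : ℕ} (h : IsSymbol M P p d) (n : ℕ) :
    IsSymbol M (P ^ n) (p ^ n) (n * d) := by
  induction n with
  | zero =>
    intro F hF m u
    have h1 : (u : M) ∈ F (m + (0 * d : ℕ)) := by simp
    refine ⟨by simp, ?_⟩
    simp only [pow_zero, map_one, Module.End.one_apply, one_smul]
    exact grClass_heq (by simp) _ u.2 h1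
  | succ n ih =>
    rw [pow_succ, pow_succ, Nat.succ_mul]
    exact ih.mul h

lemma isSymbol_mulOp (f : OX N) : IsSymbol M (mulOp N f) (rename Sum.inl f) 0 := by
  intro F hF m u
  have h1 : mulOp N f • (u : M) ∈ F m := by rw [mulOp_smul]; exact Submodule.smul_mem _ _ u.2
  have h2 : mulOp N f • (u : M) ∈ F (m + (0 : ℕ)) := by simpa using h1
  refine ⟨h2, ?_⟩
  rw [cotAction_rename_inl, ← map_smul, ← grClass_heq (by simp) _ h1 h2]
  simp only [mulOp_smul]
  rfl

lemma isSymbol_partialOp (i : Fin N) : IsSymbol M (partialOp i) (X (Sum.inr i)) 1 := by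
  intro F hF m u
  exact ⟨hF.partial_mem i u.2, by rw [cotAction_X_inr, symbolOp_grClass]; rfl⟩

/-- The weights with respect to which a function on the cotangent bundle is homogeneous if it is so
in the fibre coordinates. -/
def fibreWeight (N : ℕ) : Fin N ⊕ Fin N → ℕ := Sum.elim (fun _ => 0) fun _ => 1

lemma exists_isSymbol_monomial (n : ℕ) : ∀ μ : Fin N ⊕ Fin N →₀ ℕ, μ.degree = n →
    ∃ P, IsSymbol M P (monomial μ 1) (Finsupp.weight (fibreWeight N) μ) := by
  induction n with
  | zero =>
    intro μ hμ
    rw [Finsupp.degree_eq_zero_iff] at hμ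
    subst hμ
    refine ⟨mulOp N 1, ?_⟩
    have := isSymbol_mulOp (M := M) (1 : OX N)
    rwa [map_one (rename _)] at this
  | succ n ih =>
    intro μ hμ
    have h0 : μ ≠ 0 := by rintro rfl; simp at hμ
    obtain ⟨s, hs⟩ := Finsupp.ne_iff.1 h0
    obtain ⟨ν, rfl⟩ := Frame.exists_eq_single_add hs
    rw [map_add, Finsupp.degree_single] at hμ
    obtain ⟨P, hP⟩ := ih ν (by omega)
    rw [Frame.monomial_single_add, Frame.weight_inl_single_add]
    rcases s with i | i
    · rw [← rename_X]
      exact ⟨_, (isSymbol_mulOp (X i)).mul hP⟩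
    · exact ⟨_, (isSymbol_partialOp i).mul hP⟩

lemma exists_isSymbol {p : CotPoly N} {d : ℕ}
    (hp : IsWeightedHomogeneous (fibreWeight N) p d) : ∃ P, IsSymbol M P p d := by
  rw [p.as_sum]
  have key : ∀ s ⊆ p.support, ∃ P, IsSymbol M P (∑ μ ∈ s, monomial μ (coeff μ p)) d := by
    intro s
    induction s using Finset.induction_on with
    | empty =>
      refine fun _ => ⟨0, fun F hF m u => ⟨by simp, ?_⟩⟩
      rw [Finset.sum_empty, map_zero, LinearMap.zero_apply]
      exact (grClass_eq_zero (by simp)).symm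
    | insert μ s hμ ih =>
      intro hs
      obtain ⟨P, hP⟩ := ih ((Finset.subset_insert _ _).trans hs)
      obtain ⟨P', hP'⟩ := exists_isSymbol_monomial (M := M) _ μ rfl
      rw [Finset.sum_insert hμ]
      have h1 := (isSymbol_mulOp (M := M) (C (coeff μ p))).mul hP'
      rw [rename_C, C_mul_monomial, mul_one, zero_add,
        hp (mem_support_iff.1 (hs (Finset.mem_insert_self _ _)))] at h1
      exact ⟨_, h1.add hP⟩
  exact key _ subset_rfl

/-- Two good filtrations differ by a bounded shift. -/
lemma IsGoodFiltration.exists_le_shift {F G : ℤ → Submodule (OX N) M} (hF : IsGoodFiltration F)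
    (hG : IsGoodFiltration G) : ∃ k : ℕ, ∀ m, F m ≤ G (m + k) := by
  obtain ⟨l₀, hl₀⟩ := hF.stable
  obtain ⟨m₀, hm₀⟩ := hF.eventually_zero
  obtain ⟨j, hj⟩ : ∃ j, F l₀ ≤ G j := by
    obtain ⟨S, hS⟩ := hF.fg l₀
    choose i hi using hG.exhaustive
    obtain ⟨j, hj⟩ := (S.image i).exists_le
    refine ⟨j, ?_⟩
    rw [← hS, Submodule.span_le]
    intro u hu
    exact hG.mono (hj _ (Finset.mem_image_of_mem i hu)) (hi u)
  refine ⟨(j - l₀).toNat + (j - m₀).toNat, fun m => ?_⟩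
  rcases le_or_gt l₀ m with h | h
  · have h1 := hl₀ l₀ le_rfl (m - l₀) (by omega)
    rw [sub_add_cancel] at h1
    rw [h1, Submodule.span_le]
    rintro _ ⟨P, hP, u, hu, rfl⟩
    exact hG.mono (by omega) (hG.smul_mem _ _ P u hP (hj hu))
  · rcases le_or_gt m m₀ with h' | h'
    · rw [hm₀ m h']; exact bot_le
    · exact (hF.mono h.le).trans (hj.trans (hG.mono (by omega)))

lemma cotAction_eq_zero_iff {F : ℤ → Submodule (OX N) M} (hF : IsGoodFiltration F) {P : DX N}
    {p : CotPoly N} {d : ℕ} (h : IsSymbol M P p d) :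
    cotAction hF p = 0 ↔ ∀ m, ∀ u ∈ F m, P • u ∈ F (m + d - 1) := by
  constructor
  · intro h0 m u hu
    obtain ⟨h1, h2⟩ := h F hF m ⟨u, hu⟩
    rw [h0, LinearMap.zero_apply] at h2
    exact grClass_eq_zero_iff.1 h2.symm
  · intro h0
    refine LinearMap.ext fun z => ?_
    induction z using gr_induction with
    | zero => simp
    | add z z' hz hz' => rw [map_add, hz, hz']; simp
    | mk m u =>
      obtain ⟨h1, h2⟩ := h F hF m u
      rw [h2, LinearMap.zero_apply]
      exact grClass_eq_zero (h0 m _ u.2)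

/-- A homogeneous function annihilating the associated graded module of a good filtration has a
power annihilating that of any other good filtration. -/
lemma exists_pow_mem_charIdeal_of_homogeneous {F G : ℤ → Submodule (OX N) M}
    (hF : IsGoodFiltration F) (hG : IsGoodFiltration G) {p : CotPoly N} {d : ℕ}
    (hp : IsWeightedHomogeneous (fibreWeight N) p d) (hpF : p ∈ charIdeal hF) :
    ∃ n, p ^ n ∈ charIdeal hG := by
  obtain ⟨P, hP⟩ := exists_isSymbol (M := M) hp
  obtain ⟨k, hk⟩ := hF.exists_le_shift hG
  obtain ⟨k', hk'⟩ := hG.exists_le_shift hF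
  rw [mem_charIdeal, cotAction_eq_zero_iff hF hP] at hpF
  have key : ∀ (n : ℕ) m, ∀ u ∈ F m, P ^ n • u ∈ F (m + n * d - n) := by
    intro n
    induction n with
    | zero => intro m u hu; simpa using hu
    | succ n ih =>
      intro m u hu
      rw [pow_succ', mul_smul]
      have := hpF _ _ (ih m u hu)
      rwa [show m + n * d - n + d - 1 = m + (n + 1 : ℕ) * d - (n + 1 : ℕ) by push_cast; ring]
        at this
  refine ⟨k + k' + 1, ?_⟩
  rw [mem_charIdeal, cotAction_eq_zero_iff hG (hP.pow _)]
  intro m u hu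
  exact hG.mono (le_of_eq (by push_cast; ring)) (hk _ (key (k + k' + 1) _ u (hk' m hu)))

/-- The annihilator of the associated graded module is homogeneous in the fibre coordinates. -/
lemma weightedHomogeneousComponent_mem_charIdeal {F : ℤ → Submodule (OX N) M}
    (hF : IsGoodFiltration F) {p : CotPoly N} (hp : p ∈ charIdeal hF) (d : ℕ) :
    weightedHomogeneousComponent (fibreWeight N) d p ∈ charIdeal hF := by
  choose P hP using fun d => exists_isSymbol (M := M)
    (weightedHomogeneousComponent_isWeightedHomogeneous (w := fibreWeight N) d p)
  rw [mem_charIdeal, cotAction_eq_zero_iff hF (hP d)]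
  intro m u hu
  choose h1 h2 using fun d => hP d F hF m ⟨u, hu⟩
  have hfin := weightedHomogeneousComponent_finsupp (w := fibreWeight N) p
  have h3 : ∑ d ∈ hfin.toFinset, grClass F (m + d) ⟨P d • u, h1 d⟩ = 0 := by
    have h4 := LinearMap.congr_fun (mem_charIdeal.1 hp) (grClass F m ⟨u, hu⟩)
    rw [← sum_weightedHomogeneousComponent (fibreWeight N) p, finsum_eq_sum _ hfin, map_sum,
      LinearMap.sum_apply, LinearMap.zero_apply] at h4
    rw [← h4]
    exact Finset.sum_congr rfl fun d _ => (h2 d).symm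
  by_cases hd : weightedHomogeneousComponent (fibreWeight N) d p = 0
  · have := h2 d
    rw [hd, map_zero, LinearMap.zero_apply] at this
    exact grClass_eq_zero_iff.1 this.symm
  have h5 := congrArg (DirectSum.component (OX N) ℤ (GrPiece F) (m + d)) h3
  rw [map_sum, map_zero, Finset.sum_eq_single d] at h5
  · rw [grClass, LinearMap.comp_apply, DirectSum.component.lof_self, ← LinearMap.mem_ker,
      Submodule.ker_mkQ] at h5
    exact h5
  · intro d' _ hd'
    rw [grClass, LinearMap.comp_apply, DirectSum.component.of, dif_neg]
    omega
  · intro h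
    exact absurd (hfin.mem_toFinset.2 hd) h

lemma mem_radical_charIdeal {F G : ℤ → Submodule (OX N) M}
    (hF : IsGoodFiltration F) (hG : IsGoodFiltration G) {p : CotPoly N} (hp : p ∈ charIdeal hF) :
    p ∈ (charIdeal hG).radical := by
  have hfin := weightedHomogeneousComponent_finsupp (w := fibreWeight N) p
  rw [← sum_weightedHomogeneousComponent (fibreWeight N) p, finsum_eq_sum _ hfin]
  exact Ideal.sum_mem _ fun d _ => exists_pow_mem_charIdeal_of_homogeneous hF hG
    (weightedHomogeneousComponent_isWeightedHomogeneous (w := fibreWeight N) d p)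
    (weightedHomogeneousComponent_mem_charIdeal hF hp d)

/-- The characteristic variety does not depend on the good filtration. -/
theorem charVariety_eq {F G : ℤ → Submodule (OX N) M} (hF : IsGoodFiltration F)
    (hG : IsGoodFiltration G) : charVariety hF = charVariety hG := by
  have key : ∀ {F G : ℤ → Submodule (OX N) M} (hF : IsGoodFiltration F)
      (hG : IsGoodFiltration G), charVariety hG ⊆ charVariety hF := by
    intro F G hF hG z hz p hp
    obtain ⟨n, hn⟩ := mem_radical_charIdeal hF hG hp
    have := hz _ hn
    rw [map_pow] at this
    exact eq_zero_of_pow_eq_zero this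
  exact Set.Subset.antisymm (key hG hF) (key hF hG)

end Independence

end QuiverDMod

namespace QuiverDMod

open MvPolynomial

/-! ### Conormal bundles of flats -/

namespace Frame

variable {N : ℕ} (fr : Frame N)

/-- The conormal bundle of the flat of a frame, as the set of common zeros of the symbols of the
operators `b`. -/
def conormal : Set (Cot N) := {z | ∀ i, aeval z (fr.bSymbol i) = 0}

lemma aeval_rename_affinePoly (z : Cot N) (f : (Fin N → ℂ) →ᵃ[ℂ] ℂ) :
    aeval z (rename Sum.inl (affinePoly f) : CotPoly N) = f fun i => z (Sum.inl i) := by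
  rw [aeval_rename, ← eval_affinePoly]
  rfl

lemma aeval_bSymbol (z : Cot N) (i : Fin N) : aeval z (fr.bSymbol i) =
    if i ∈ fr.S then fr.y i (fun k => z (Sum.inl k)) else ∑ k, z (Sum.inr k) * fr.η i k := by
  unfold bSymbol
  split_ifs with hi
  · exact aeval_rename_affinePoly z _
  · simp [mul_comm]

lemma coord_single_sum (i j : Fin N) :
    ∑ k, fr.η.coord k (Pi.single i 1) * fr.η k j = if i = j then 1 else 0 := by
  have h := congrFun (fr.η.sum_repr (Pi.single i 1)) j
  rw [Finset.sum_apply] at h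
  simpa [Pi.single_apply, eq_comm] using h

lemma sum_coord_single (j : Fin N) (v : Fin N → ℂ) :
    ∑ k, v k * fr.η.coord j (Pi.single k 1) = fr.η.coord j v := by
  conv_rhs => rw [pi_eq_sum_univ' v]
  simp [map_sum]

/-- The coordinates of a point of the conormal bundle. -/
def conormalCoord (z : Cot N) (j : Fin N) : ℂ :=
  if j ∈ fr.S then ∑ k, z (Sum.inr k) * fr.η j k else fr.y j (fun k => z (Sum.inl k))

/-- A function takes at a point of the conormal bundle the value of its restriction. -/
lemma aeval_eq_of_mem_conormal {z : Cot N} (hz : z ∈ fr.conormal) (p : CotPoly N) :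
    aeval z p = aeval (fr.conormalCoord z) (fr.res p) := by
  rw [← AlgHom.comp_apply]
  congr 1
  refine algHom_ext fun s => ?_
  rw [AlgHom.comp_apply, aeval_X]
  rcases s with i | i
  · rw [res_X_inl, resX, map_add, map_sum, aeval_C, Algebra.algebraMap_self_apply]
    have h := congrArg (aeval fun k => z (Sum.inl k)) (fr.affine_eq (coordFun i))
    rw [affinePoly_coordFun, aeval_X] at h
    rw [h, map_add, map_sum, aeval_C, Algebra.algebraMap_self_apply]
    congr 1
    refine Finset.sum_congr rfl fun j _ => ?_
    have h1 : aeval (fun k => z (Sum.inl k)) (affinePoly (fr.y j)) = fr.y j fun k => z (Sum.inl k) :=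
      eval_affinePoly _ _
    rw [map_mul, h1, aeval_C, Algebra.algebraMap_self_apply]
    split_ifs with hj
    · have := hz j
      rw [aeval_bSymbol, if_pos hj] at this
      rw [this, mul_zero, map_zero]
    · rw [map_mul, aeval_C, aeval_X, conormalCoord, if_neg hj]
      rfl
  · rw [res_X_inr, resΞ, map_sum]
    have h : z (Sum.inr i) = ∑ j, fr.η.coord j (Pi.single i 1) *
        ∑ k, z (Sum.inr k) * fr.η j k := by
      simp_rw [Finset.mul_sum]
      rw [Finset.sum_comm, Finset.sum_eq_single i]
      · have := fr.coord_single_sum i i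
        rw [if_pos rfl] at this
        simp_rw [mul_left_comm _ (z (Sum.inr i))]
        rw [← Finset.mul_sum, this, mul_one]
      · intro k _ hk
        have := fr.coord_single_sum i k
        rw [if_neg (Ne.symm hk)] at this
        simp_rw [mul_left_comm _ (z (Sum.inr k))]
        rw [← Finset.mul_sum, this, mul_zero]
      · simp
    rw [h]
    refine Finset.sum_congr rfl fun j _ => ?_
    split_ifs with hj
    · rw [map_mul, aeval_C, aeval_X, conormalCoord, if_pos hj, Algebra.algebraMap_self_apply]
    · have := hz j
      rw [aeval_bSymbol, if_neg hj] at this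
      rw [this, mul_zero, map_zero]

lemma res_rename_affinePoly (f : (Fin N → ℂ) →ᵃ[ℂ] ℂ) :
    fr.res (rename Sum.inl (affinePoly f))
      = C (f fr.o) + ∑ j, if j ∈ fr.S then 0 else C (f.linear (fr.η j)) * X j := by
  have h1 : f fr.o = f.linear fr.o + f 0 := by simpa using f.map_vadd 0 fr.o
  have h2 : ∀ v, f.linear v = ∑ i, f.linear (Pi.single i 1) * v i := fun v => by
    conv_lhs => rw [pi_eq_sum_univ' v]
    simp [map_sum, mul_comm]
  simp only [affinePoly, map_add, map_sum, map_mul, rename_C, rename_X, res_X_inl, resX]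
  have h3 : ∀ c : ℂ, fr.res (C c) = C c := fun c => by
    rw [← algebraMap_eq, AlgHom.commutes]; rfl
  simp only [h3, mul_add, Finset.sum_add_distrib, Finset.mul_sum]
  rw [Finset.sum_comm, h1, map_add, add_comm (C (f.linear fr.o)), add_assoc, h2 fr.o, map_sum]
  simp only [map_mul]
  congr 2
  refine Finset.sum_congr rfl fun j _ => ?_
  split_ifs with hj
  · simp
  · rw [h2, map_sum, Finset.sum_mul]
    refine Finset.sum_congr rfl fun i _ => ?_
    rw [map_mul, mul_assoc]

lemma y_o (j : Fin N) : fr.y j fr.o = 0 := by simp [y_apply]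

lemma res_rename_y (i : Fin N) :
    fr.res (rename Sum.inl (affinePoly (fr.y i))) = if i ∈ fr.S then 0 else X i := by
  rw [res_rename_affinePoly, y_o, map_zero, zero_add, Finset.sum_eq_single i]
  · simp [y_linear]
  · intro j _ hj
    simp [y_linear, hj]
  · simp

lemma res_vectorSymbol (i : Fin N) :
    fr.res (∑ k, C (fr.η i k) * X (Sum.inr k)) = if i ∈ fr.S then X i else 0 := by
  have h3 : ∀ c : ℂ, fr.res (C c) = C c := fun c => by
    rw [← algebraMap_eq, AlgHom.commutes]; rfl
  simp only [map_sum, map_mul, h3, res_X_inr, resΞ, Finset.mul_sum]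
  rw [Finset.sum_comm, Finset.sum_eq_single i]
  · split_ifs with hi
    · simp_rw [← mul_assoc, ← map_mul]
      rw [← Finset.sum_mul, ← map_sum, sum_coord_single]
      simp
    · simp
  · intro j _ hj
    split_ifs with hj'
    · simp_rw [← mul_assoc, ← map_mul]
      rw [← Finset.sum_mul, ← map_sum, sum_coord_single]
      simp [Ne.symm hj]
    · simp
  · simp

lemma res_bSymbol (i : Fin N) : fr.res (fr.bSymbol i) = 0 := by
  unfold bSymbol
  split_ifs with hi
  · rw [res_rename_y, if_pos hi]
  · rw [res_vectorSymbol, if_neg hi]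

lemma res_surjective : Function.Surjective fr.res := by
  rw [← AlgHom.range_eq_top, eq_top_iff, ← adjoin_range_X, Algebra.adjoin_le_iff]
  rintro _ ⟨i, rfl⟩
  by_cases hi : i ∈ fr.S
  · exact ⟨_, (fr.res_vectorSymbol i).trans (if_pos hi)⟩
  · exact ⟨_, (fr.res_rename_y i).trans (if_neg hi)⟩

/-- The ideal of the conormal bundle is the kernel of the restriction. -/
lemma vanishingIdeal_conormal : vanishingIdeal ℂ fr.conormal = RingHom.ker fr.res := by
  ext p
  rw [mem_vanishingIdeal_iff, RingHom.mem_ker]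
  constructor
  · intro hp
    refine MvPolynomial.funext fun t => ?_
    have key : ∀ q : CotPoly N, aeval (fun s => aeval t (fr.res (X s))) q
        = aeval t (fr.res q) := by
      intro q
      rw [← AlgHom.comp_apply]
      congr 1
      refine algHom_ext fun s => ?_
      rw [aeval_X, AlgHom.comp_apply]
    have h1 := hp (fun s => aeval t (fr.res (X s))) fun i => by
      rw [key, res_bSymbol, map_zero]
    rw [key] at h1
    rw [map_zero]
    exact h1
  · intro hp z hz
    rw [fr.aeval_eq_of_mem_conormal hz, hp, map_zero]

/-- The chain rule for the restriction to the conormal bundle. -/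
lemma pderiv_res (k : Fin N) (p : CotPoly N) :
    pderiv k (fr.res p) = ∑ s, fr.res (pderiv s p) * pderiv k (fr.res (X s)) := by
  classical
  induction p using MvPolynomial.induction_on with
  | C c => rw [← algebraMap_eq, AlgHom.commutes]; simp
  | add p q hp hq => simp only [map_add, hp, hq, add_mul, Finset.sum_add_distrib]
  | mul_X p s hp =>
    simp only [map_mul, Derivation.leibniz, smul_eq_mul, hp, map_add, add_mul,
      Finset.sum_add_distrib, pderiv_X, Pi.single_apply]
    congr 1
    · rw [Finset.sum_eq_single s] <;> simp +contextual [eq_comm]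
    · rw [Finset.mul_sum]
      exact Finset.sum_congr rfl fun s' _ => by ring

lemma pderiv_resX (i k : Fin N) :
    pderiv k (fr.resX i) = if k ∈ fr.S then 0 else C (fr.η k i) := by
  classical
  rw [resX, map_add, pderiv_C, zero_add, map_sum, Finset.sum_eq_single k]
  · split_ifs <;> simp
  · intro j _ hj
    split_ifs
    · simp
    · simp [pderiv_X_of_ne hj]
  · simp

lemma pderiv_resΞ (i k : Fin N) :
    pderiv k (fr.resΞ i) = if k ∈ fr.S then C (fr.η.coord k (Pi.single i 1)) else 0 := by
  classical
  rw [resΞ, map_sum, Finset.sum_eq_single k]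
  · split_ifs <;> simp
  · intro j _ hj
    split_ifs
    · simp [pderiv_X_of_ne hj]
    · simp
  · simp

/-- The conormal bundle is isotropic for the Poisson structure: of the differential of a function
vanishing on it, one half of the components in the frame vanishes on the bundle, and the Poisson
bracket pairs them with the complementary half. -/
lemma res_poisson_eq_zero {p q : CotPoly N} (hp : fr.res p = 0) (hq : fr.res q = 0) :
    fr.res (poisson p q) = 0 := by
  have hX : ∀ p : CotPoly N, fr.res p = 0 → ∀ k ∉ fr.S,
      ∑ i, fr.res (pderiv (Sum.inl i) p) * C (fr.η k i) = 0 := by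
    intro p hp k hk
    have h := fr.pderiv_res k p
    rw [hp, map_zero, Fintype.sum_sum_type] at h
    simpa [res_X_inl, res_X_inr, pderiv_resX, pderiv_resΞ, hk] using h.symm
  have hΞ : ∀ p : CotPoly N, fr.res p = 0 → ∀ k ∈ fr.S,
      ∑ i, fr.res (pderiv (Sum.inr i) p) * C (fr.η.coord k (Pi.single i 1)) = 0 := by
    intro p hp k hk
    have h := fr.pderiv_res k p
    rw [hp, map_zero, Fintype.sum_sum_type] at h
    simpa [res_X_inl, res_X_inr, pderiv_resX, pderiv_resΞ, hk] using h.symm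
  have key : ∀ p q : CotPoly N, fr.res p = 0 → fr.res q = 0 →
      ∑ i, fr.res (pderiv (Sum.inr i) p) * fr.res (pderiv (Sum.inl i) q) = 0 := by
    intro p q hp hq
    have h1 : ∑ i, fr.res (pderiv (Sum.inr i) p) * fr.res (pderiv (Sum.inl i) q)
        = ∑ k, (∑ i, fr.res (pderiv (Sum.inr i) p) * C (fr.η.coord k (Pi.single i 1))) *
          (∑ j, fr.res (pderiv (Sum.inl j) q) * C (fr.η k j)) := by
      simp_rw [Finset.sum_mul_sum]
      rw [Finset.sum_comm]
      refine Finset.sum_congr rfl fun i _ => ?_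
      rw [Finset.sum_comm]
      have h2 : ∀ j, ∑ k, fr.res (pderiv (Sum.inr i) p) * C (fr.η.coord k (Pi.single i 1)) *
          (fr.res (pderiv (Sum.inl j) q) * C (fr.η k j))
          = fr.res (pderiv (Sum.inr i) p) * fr.res (pderiv (Sum.inl j) q) *
            C (if i = j then 1 else 0) := by
        intro j
        rw [← coord_single_sum, map_sum, Finset.mul_sum]
        refine Finset.sum_congr rfl fun k _ => ?_
        rw [map_mul]; ring
      simp_rw [h2]
      simp
    rw [h1]
    refine Finset.sum_eq_zero fun k _ => ?_
    by_cases hk : k ∈ fr.S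
    · rw [hΞ p hp k hk, zero_mul]
    · rw [hX q hq k hk, mul_zero]
  rw [poisson, map_sum]
  simp only [map_sub, map_mul, Finset.sum_sub_distrib]
  rw [key p q hp hq]
  have := key q p hq hp
  simp only [mul_comm (fr.res (pderiv (Sum.inr _) q))] at this
  rw [this, sub_zero]

end Frame

/-- A finite union of conormal bundles of flats is Lagrangian. -/
theorem isLagrangian_iUnion_conormal {N : ℕ} {ι : Type*} [Fintype ι] (fr : ι → Frame N)
    (hclosed : ∃ I : Ideal (CotPoly N), zeroLocus ℂ I = ⋃ e, (fr e).conormal) :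
    IsLagrangian (⋃ e, (fr e).conormal) := by
  have hmem : ∀ p, p ∈ vanishingIdeal ℂ (⋃ e, (fr e).conormal) ↔ ∀ e, (fr e).res p = 0 := by
    intro p
    simp_rw [← RingHom.mem_ker, ← Frame.vanishingIdeal_conormal, mem_vanishingIdeal_iff,
      Set.mem_iUnion]
    exact ⟨fun h e z hz => h z ⟨e, hz⟩, fun h z ⟨e, hz⟩ => h e z hz⟩
  have hinf : vanishingIdeal ℂ (⋃ e, (fr e).conormal)
      = Finset.univ.inf fun e => RingHom.ker (fr e).res := by
    ext p
    simp [hmem, Submodule.mem_finsetInf, RingHom.mem_ker]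
  refine ⟨?_, fun p hp q hq => ?_, fun I hI => ?_⟩
  · obtain ⟨I, hI⟩ := hclosed
    rw [← hI]
    refine Set.Subset.antisymm ?_ (zeroLocus_vanishingIdeal_le _)
    exact zeroLocus_anti_mono (le_vanishingIdeal_zeroLocus I)
  · rw [hmem] at hp hq ⊢
    exact fun e => (fr e).res_poisson_eq_zero (hp e) (hq e)
  · obtain ⟨⟨hprime, hle⟩, hmin⟩ := hI
    rw [hinf] at hle hmin
    obtain ⟨e, -, he⟩ := (Ideal.IsPrime.inf_le' hprime).1 hle
    have h1 : RingHom.ker (fr e).res = I :=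
      le_antisymm he (hmin ⟨RingHom.ker_isPrime _, Finset.inf_le (Finset.mem_univ e)⟩ he)
    rw [← h1]
    refine (ringKrullDim_eq_of_ringEquiv
      (Ideal.quotientKerAlgEquivOfSurjective (fr e).res_surjective).toRingEquiv).trans ?_
    rw [MvPolynomial.ringKrullDim_of_isNoetherianRing]
    simp

section CharVariety

variable {N : ℕ} {ι M : Type*} [Fintype ι] [AddCommGroup M] [Module (DX N) M] [Module (OX N) M]
  [IsScalarTower (OX N) (DX N) M] [Module ℂ M] [IsScalarTower ℂ (DX N) M]
  {fr : ι → Frame N} {lv : ι → ℕ} {g : ι → M}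

/-- The characteristic variety of a module with normal forms is the union of the conormal bundles of
the flats of its generators. -/
theorem HasNormalForms.charVariety_eq (h : HasNormalForms fr lv g)
    {F : ℤ → Submodule (OX N) M} (hF : IsGoodFiltration F) :
    charVariety hF = ⋃ e, (fr e).conormal := by
  rw [QuiverDMod.charVariety_eq hF h.isGoodFiltration]
  refine Set.Subset.antisymm (fun z hz => ?_) (Set.iUnion_subset fun e z hz p hp => ?_)
  · by_contra hz'
    simp only [Set.mem_iUnion, Frame.conormal, Set.mem_ofPred_eq, not_exists, not_forall] at hz'
    choose c hc using hz'
    obtain ⟨n, hn⟩ := h.prod_bSymbol_pow_mem_charIdeal c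
    have h1 := hz _ hn
    rw [map_pow, map_prod] at h1
    exact Finset.prod_ne_zero_iff.2 (fun e _ => hc e) (eq_zero_of_pow_eq_zero h1)
  · rw [Frame.aeval_eq_of_mem_conormal _ hz, h.res_eq_zero_of_mem_charIdeal e hp, map_zero]

theorem HasNormalForms.isLagrangian (h : HasNormalForms fr lv g)
    {F : ℤ → Submodule (OX N) M} (hF : IsGoodFiltration F) : IsLagrangian (charVariety hF) := by
  rw [h.charVariety_eq hF]
  exact isLagrangian_iUnion_conormal fr ⟨charIdeal hF, h.charVariety_eq hF⟩

end CharVariety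

end QuiverDMod

namespace QuiverDMod

open MvPolynomial

/-! ### The associated graded module over the functions on the base -/

section Transversal

/-- The monomial with a given exponent in the variables of index in `S`. -/
def monomialOn {σ : Type*} (S : Finset σ) (J : {j // j ∈ S} →₀ ℕ) : MvPolynomial σ ℂ :=
  monomial (J.embDomain (Function.Embedding.subtype _)) 1

variable {σ : Type*} {S : Finset σ}

/-- A monomial in the variables of index in `S` picks out its coefficient over the polynomials in the
other variables. -/
lemma coeff_mul_monomialOn {r : MvPolynomial σ ℂ} (hr : r ∈ supported ℂ {j | j ∉ S})
    (J J₀ : {j // j ∈ S} →₀ ℕ) {K : σ →₀ ℕ} (hK : ∀ j ∈ S, K j = 0) :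
    coeff (K + J₀.embDomain (Function.Embedding.subtype _)) (r * monomialOn S J)
      = if J = J₀ then coeff K r else 0 := by
  classical
  rw [monomialOn, coeff_mul_monomial', mul_one]
  by_cases hJ : J = J₀
  · subst hJ
    rw [if_pos rfl, if_pos (Finsupp.le_def.2 fun j => by simp), add_tsub_cancel_right]
  · rw [if_neg hJ]
    split_ifs with hle
    · by_contra h0
      refine hJ (Finsupp.ext fun j => ?_)
      have h1 := mem_supported.1 hr
      have h2 : (K + J₀.embDomain (Function.Embedding.subtype _)
          - J.embDomain (Function.Embedding.subtype _)) (j : σ) = 0 := by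
        by_contra h3
        have h4 := h1 ((mem_vars_iff_mem_support _).2 ⟨_, mem_support_iff.2 h0, Finsupp.mem_support_iff.2 h3⟩)
        exact h4 j.2
      have h3 := hle (j : σ)
      have e1 : ∀ J : {j // j ∈ S} →₀ ℕ,
          J.embDomain (Function.Embedding.subtype _) (j : σ) = J j := fun J =>
        Finsupp.embDomain_apply_self (Function.Embedding.subtype _) J j
      rw [Finsupp.tsub_apply, Finsupp.add_apply, hK _ j.2, e1, e1] at h2
      rw [Finsupp.add_apply, hK _ j.2, e1, e1] at h3
      omega
    · rfl

lemma eq_zero_of_forall_coeff {r : MvPolynomial σ ℂ} (hr : r ∈ supported ℂ {j | j ∉ S})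
    (h : ∀ K : σ →₀ ℕ, (∀ j ∈ S, K j = 0) → coeff K r = 0) : r = 0 := by
  ext K
  rw [coeff_zero]
  by_contra h0
  refine h0 (h K fun j hj => ?_)
  by_contra h3
  exact mem_supported.1 hr ((mem_vars_iff_mem_support _).2 ⟨_, mem_support_iff.2 h0,
    Finsupp.mem_support_iff.2 h3⟩) hj

end Transversal

namespace Frame

variable {N : ℕ} (fr : Frame N)

lemma res_rename_mem_supported (f : OX N) :
    fr.res (rename Sum.inl f) ∈ supported ℂ {j | j ∉ fr.S} := by
  induction f using MvPolynomial.induction_on with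
  | C c =>
    rw [rename_C, ← algebraMap_eq, AlgHom.commutes]
    exact Subalgebra.algebraMap_mem _ _
  | add p q hp hq => rw [map_add, map_add]; exact Subalgebra.add_mem _ hp hq
  | mul_X p i hp =>
    rw [map_mul, map_mul, rename_X, res_X_inl]
    refine Subalgebra.mul_mem _ hp (Subalgebra.add_mem _ (Subalgebra.algebraMap_mem _ _)
      (Subalgebra.sum_mem _ fun j _ => ?_))
    split_ifs with hj
    · exact Subalgebra.zero_mem _
    · exact Subalgebra.mul_mem _ (Subalgebra.algebraMap_mem _ _) (X_mem_supported.2 hj)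

lemma weight_embDomain (J : {j // j ∈ fr.S} →₀ ℕ) :
    Finsupp.weight fr.ordA (J.embDomain (Function.Embedding.subtype _)) = J.degree := by
  rw [Finsupp.embDomain_eq_mapDomain, Finsupp.weight_apply,
    Finsupp.sum_mapDomain_index (by simp) (by intros; simp [add_mul]), Finsupp.degree_eq_sum,
    Finsupp.sum_fintype _ _ (by simp)]
  refine Finset.sum_congr rfl fun j _ => ?_
  have : fr.ordA (j : Fin N) = 1 := if_pos j.2
  simp [this]

end Frame

section Transversal

variable {N : ℕ} {ι M : Type*} [Fintype ι] [AddCommGroup M] [Module (DX N) M] [Module (OX N) M]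
  [IsScalarTower (OX N) (DX N) M] [Module ℂ M] [IsScalarTower ℂ (DX N) M]
  {fr : ι → Frame N} {lv : ι → ℕ} {g : ι → M}

lemma monomialOn_weight (e : ι) (J : {j // j ∈ (fr e).S} →₀ ℕ) (μ : Fin N →₀ ℕ)
    (hμ : coeff μ (monomialOn (fr e).S J) ≠ 0) :
    (Finsupp.weight (fr e).ordA μ : ℤ) ≤ (lv e + J.degree : ℕ) - lv e := by
  classical
  rw [monomialOn, coeff_monomial] at hμ
  have : J.embDomain (Function.Embedding.subtype _) = μ := by by_contra h0; exact hμ (if_neg h0)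
  rw [← this, Frame.weight_embDomain]
  omega

variable (fr lv g) in
/-- The class of a product of derivatives transversal to the flat of a generator, applied to that
generator. -/
def transversalClass (e : ι) (J : {j // j ∈ (fr e).S} →₀ ℕ) :
    GrPiece (baseFiltration N lv g) (lv e + J.degree : ℕ) :=
  Submodule.Quotient.mk ⟨(fr e).A (monomialOn (fr e).S J) • g e,
    HasNormalForms.smul_mem_baseFiltration (monomialOn_weight e J)⟩

namespace HasNormalForms

variable (h : HasNormalForms fr lv g)

lemma mem_of_forall_leading_eq_zero (h : HasNormalForms fr lv g) {m : ℤ} {u : M}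
    (hu : u ∈ baseFiltration N lv g m)
    (h0 : ∀ e, h.leading e m u = 0) : u ∈ baseFiltration N lv g (m - 1) := by
  rw [← h.nf_nfEquiv_symm u]
  refine nf_mem_levelFiltration fun e μ hμ => ?_
  have h1 := h.nfEquiv_symm_mem hu e μ hμ
  rw [orderBound_zero] at h1 ⊢
  have h2 := congrArg (coeff μ) (h0 e)
  rw [leading_apply, coeff_homPart, coeff_zero] at h2
  have h3 : ¬ (Finsupp.weight (fr e).ordA μ : ℤ) = m - lv e := fun h3 => hμ (by rwa [if_pos h3] at h2)
  omega

lemma leading_monomialOn [DecidableEq ι] (e e' : ι) (J : {j // j ∈ (fr e).S} →₀ ℕ) :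
    h.leading e' (lv e + J.degree : ℕ) ((fr e).A (monomialOn (fr e).S J) • g e)
      = (Pi.single e (monomialOn (fr e).S J) : ι → MvPolynomial (Fin N) ℂ) e' := by
  rw [leading_apply, nfEquiv_symm_A_smul]
  rcases eq_or_ne e' e with rfl | he
  · rw [Pi.single_eq_same]
    ext μ
    rw [coeff_homPart, monomialOn, coeff_monomial]
    split_ifs with h1 h2 h2
    · rfl
    · rfl
    · rw [← h2, Frame.weight_embDomain] at h1
      exact absurd (by push_cast; ring) h1
    · rfl
  · rw [Pi.single_eq_of_ne he, map_zero]

/-- The functions vanishing on the flat of a generator annihilate the classes of its transversal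
derivatives. -/
lemma smul_transversalClass_eq_zero (h : HasNormalForms fr lv g) (e : ι)
    (J : {j // j ∈ (fr e).S} →₀ ℕ) {f : OX N}
    (hf : (fr e).res (rename Sum.inl f) = 0) : f • transversalClass fr lv g e J = 0 := by
  classical
  refine (Submodule.Quotient.mk_eq_zero _).2 ?_
  refine h.mem_of_forall_leading_eq_zero (Submodule.smul_mem _ f (Subtype.prop _)) fun e' => ?_
  have h1 := h.leading_smul e' f (HasNormalForms.smul_mem_baseFiltration (fr := fr) (lv := lv)
    (g := g) (monomialOn_weight e J))
  refine h1.trans ?_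
  rw [leading_monomialOn]
  rcases eq_or_ne e' e with rfl | he
  · rw [hf, zero_mul]
  · rw [Pi.single_eq_of_ne he, mul_zero]

lemma grLeading_lof_transversalClass [DecidableEq ι] (e e' : ι) (J : {j // j ∈ (fr e).S} →₀ ℕ) :
    h.grLeading e' (DirectSum.lof (OX N) ℤ (GrPiece (baseFiltration N lv g)) _
      (transversalClass fr lv g e J))
      = (Pi.single e (monomialOn (fr e).S J) : ι → MvPolynomial (Fin N) ℂ) e' := by
  rw [← h.leading_monomialOn]
  exact h.grLeading_grClass e' _ ⟨_, smul_mem_baseFiltration (monomialOn_weight e J)⟩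

/-- The classes of the products of transversal derivatives generate the associated graded module
over the functions on the base. -/
lemma eq_top_of_transversalClass_mem (h : HasNormalForms fr lv g)
    (V : Submodule (OX N) (Gr (baseFiltration N lv g)))
    (hV : ∀ e J, DirectSum.lof (OX N) ℤ (GrPiece (baseFiltration N lv g)) _
      (transversalClass fr lv g e J) ∈ V) : V = ⊤ := by
  classical
  have mono : ∀ (e : ι) (m : ℤ) (n : ℕ) (μ : Fin N →₀ ℕ), μ.degree = n →
      ∀ hu : (fr e).A (monomial μ 1) • g e ∈ baseFiltration N lv g m,
      (Finsupp.weight (fr e).ordA μ : ℤ) ≤ m - lv e →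
      grClass _ m ⟨(fr e).A (monomial μ 1) • g e, hu⟩ ∈ V := by
    intro e m n
    induction n with
    | zero =>
      intro μ hμ hu hw
      rw [Finsupp.degree_eq_zero_iff] at hμ
      subst hμ
      rcases hw.lt_or_eq with hw | hw
      · rw [grClass_eq_zero]
        · exact V.zero_mem
        · refine smul_mem_levelFiltration ((fr e).A_mem_ordLE_int fun μ hμ => ?_)
          rw [coeff_monomial] at hμ
          have : 0 = μ := by by_contra h0; exact hμ (if_neg h0)
          rw [← this, orderBound_zero]
          omega
      · have h1 := hV e 0
        have h2 : (fr e).A (monomial 0 1) • g e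
            ∈ baseFiltration N lv g (lv e + (0 : {j // j ∈ (fr e).S} →₀ ℕ).degree : ℕ) := by
          refine HasNormalForms.smul_mem_baseFiltration fun μ hμ => ?_
          refine monomialOn_weight e 0 μ ?_
          rwa [monomialOn, Finsupp.embDomain_zero]
        have h3 : m = (lv e + (0 : {j // j ∈ (fr e).S} →₀ ℕ).degree : ℕ) := by
          simp only [map_zero] at hw ⊢
          push_cast at hw ⊢
          omega
        rw [grClass_heq h3 _ hu h2]
        convert h1 using 1
        unfold transversalClass
        simp only [monomialOn, Finsupp.embDomain_zero]
        rfl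
    | succ n ih =>
      intro μ hμ hu hw
      by_cases hb : ∃ j ∉ (fr e).S, μ j ≠ 0
      · obtain ⟨j, hj, hμj⟩ := hb
        obtain ⟨ν, rfl⟩ := Frame.exists_eq_single_add hμj
        rw [map_add, Finsupp.degree_single] at hμ
        have hwν : (Finsupp.weight (fr e).ordA ν : ℤ) ≤ m - lv e := by
          rw [map_add, Finsupp.weight_single] at hw
          push_cast at hw
          have : (0 : ℤ) ≤ 1 • ((fr e).ordA j : ℤ) := by positivity
          omega
        have huν : (fr e).A (monomial ν 1) • g e ∈ baseFiltration N lv g m := by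
          refine HasNormalForms.smul_mem_baseFiltration fun μ' hμ' => ?_
          rw [coeff_monomial] at hμ'
          have : ν = μ' := by by_contra h0; exact hμ' (if_neg h0)
          rwa [← this]
        have h1 := V.smul_mem (affinePoly ((fr e).y j)) (ih ν (by omega) huν hwν)
        rw [← map_smul] at h1
        convert h1 using 2
        ext
        change (fr e).A (monomial (Finsupp.single j 1 + ν) 1) • g e
          = affinePoly ((fr e).y j) • ((fr e).A (monomial ν 1) • g e)
        rw [← mulOp_smul, Frame.monomial_single_add, map_mul, Frame.A_X,
          Frame.a, if_neg hj, mul_smul]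
      · push Not at hb
        obtain ⟨J, rfl⟩ : ∃ J : {j // j ∈ (fr e).S} →₀ ℕ,
            μ = J.embDomain (Function.Embedding.subtype _) := by
          refine ⟨μ.comapDomain _ (Function.Embedding.subtype _).injective.injOn, ?_⟩
          refine (Finsupp.embDomain_comapDomain ?_).symm
          intro j hj
          by_contra hj'
          exact Finsupp.mem_support_iff.1 hj (hb j (by simpa using hj'))
        rcases hw.lt_or_eq with hw | hw
        · rw [grClass_eq_zero]
          · exact V.zero_mem
          · refine smul_mem_levelFiltration ((fr e).A_mem_ordLE_int fun μ' hμ' => ?_)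
            rw [coeff_monomial] at hμ'
            have : J.embDomain (Function.Embedding.subtype _) = μ' := by
              by_contra h0; exact hμ' (if_neg h0)
            rw [← this, orderBound_zero]
            omega
        · have h3 : m = (lv e + J.degree : ℕ) := by
            rw [Frame.weight_embDomain] at hw
            push_cast
            omega
          rw [grClass_heq h3 _ hu (HasNormalForms.smul_mem_baseFiltration (monomialOn_weight e J))]
          exact hV e J
  refine eq_top_iff.2 fun z _ => ?_
  refine h.grLevel_le 0 V.toAddSubmonoid ?_ z (by rw [grLevel_zero]; exact Submodule.mem_top)
  intro e m q _ hq
  have h1 : ∀ μ ∈ q.support, (fr e).A (monomial μ 1) • g e ∈ baseFiltration N lv g m := by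
    intro μ hμ
    refine HasNormalForms.smul_mem_baseFiltration fun μ' hμ' => ?_
    rw [coeff_monomial] at hμ'
    have : μ = μ' := by by_contra h0; exact hμ' (if_neg h0)
    rw [← this]
    exact hq μ (mem_support_iff.1 hμ)
  have h2 : (⟨(fr e).A q • g e, smul_mem_baseFiltration hq⟩ : baseFiltration N lv g m)
      = ∑ μ : {μ // μ ∈ q.support}, (C (coeff μ.1 q) : OX N) •
        ⟨(fr e).A (monomial μ.1 1) • g e, h1 μ.1 μ.2⟩ := by
    ext
    rw [AddSubmonoidClass.coe_finsetSum]
    simp only [Submodule.coe_smul]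
    have h3 : ∀ μ, (C (coeff μ q) : OX N) • (fr e).A (monomial μ 1) • g e
        = (fr e).A (monomial μ (coeff μ q)) • g e := by
      intro μ
      rw [← mulOp_smul, mulOp_C, algebraMap_smul, ← smul_assoc, ← map_smul, smul_monomial,
        smul_eq_mul, mul_one]
    simp only [h3]
    rw [Finset.sum_coe_sort q.support fun μ => (fr e).A (monomial μ (coeff μ q)) • g e,
      ← Finset.sum_smul, ← map_sum, support_sum_monomial_coeff]
  rw [h2, map_sum]
  refine Submodule.sum_mem V fun μ _ => ?_
  rw [map_smul]
  exact V.smul_mem _ (mono e m _ μ.1 rfl _ (hq _ (mem_support_iff.1 μ.2)))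

end HasNormalForms

end Transversal

end QuiverDMod

namespace QuiverDMod

namespace Arrangement

open MvPolynomial

/-! ### The quiver `D`-module -/

section

variable {N : ℕ} {𝒜 : Arrangement N} (Φ : 𝒜.EdgeFraming) (Q : 𝒜.Quiver)

lemma qGen_hasNormalForms : HasNormalForms (fun e : BasisIdx Q => e.1.frame) (fun e => e.1.l)
    (qGen Q Φ) where
  b_smul := b_smul_qGen Q Φ
  injective := qGen_injective Q Φ
  span_eq_top := qGen_span Q Φ

variable {Φ Q} in
lemma mk_gen_mem_Vbar (α : 𝒜.Vertex) (w : α.Omega ⊗[ℂ] Q.V α) :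
    (Submodule.Quotient.mk (gen Q 1 α w) : QuiverDModule Φ Q) ∈ Vbar Φ Q α.l := by
  induction w using TensorProduct.induction_on with
  | zero => rw [map_zero, Submodule.Quotient.mk_zero]; exact Submodule.zero_mem _
  | add w w' hw hw' => rw [map_add, Submodule.Quotient.mk_add]; exact Submodule.add_mem _ hw hw'
  | tmul ω v => exact Submodule.subset_span ⟨α, rfl, ω, v, rfl⟩

lemma qGen_mem_Vbar (e : BasisIdx Q) : qGen Q Φ e ∈ Vbar Φ Q e.1.l := by
  rw [qGen, freeBasis_apply]
  exact mk_gen_mem_Vbar _ _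

lemma Vbar_le (k : ℕ) :
    Vbar Φ Q k ≤ Submodule.span ℂ {x | ∃ e : BasisIdx Q, e.1.l = k ∧ x = qGen Q Φ e} := by
  refine Submodule.span_le.2 ?_
  rintro _ ⟨α, rfl, ω, v, rfl⟩
  have h := Submodule.mem_map_of_mem (f := (relations Φ Q).mkQ.restrictScalars ℂ)
    (gen_one_mem_span (Q := Q) α (ω ⊗ₜ v))
  rw [Submodule.map_span] at h
  refine Submodule.span_mono ?_ h
  rintro _ ⟨_, ⟨e, he, rfl⟩, rfl⟩
  exact ⟨e, by rw [he], rfl⟩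

lemma principalFiltration_eq :
    principalFiltration Φ Q = baseFiltration N (fun e : BasisIdx Q => e.1.l) (qGen Q Φ) := by
  funext m
  refine le_antisymm (iSup₂_le fun k _ => Submodule.span_le.2 ?_) ?_
  · rintro _ ⟨P, hP, u, hu, rfl⟩
    refine smul_mem_of_mem_span (restrictComplex (baseFiltration N _ (qGen Q Φ) m))
      (Vbar_le Φ Q k hu) ?_
    rintro _ ⟨e, he, rfl⟩
    refine smul_mem_levelFiltration ?_
    rwa [orderBound_zero, he]
  · rintro _ ⟨P, hP, rfl⟩
    refine Submodule.sum_mem _ fun e _ => ?_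
    have hN : e.1.l ∈ Finset.range (N + 1) := by
      have := e.1.finrank_T_add_l
      rw [Finset.mem_range]
      omega
    refine Submodule.mem_iSup_of_mem _ (Submodule.mem_iSup_of_mem hN
      (Submodule.subset_span ⟨P e, ?_, _, qGen_mem_Vbar Φ Q e, rfl⟩))
    have := hP e
    rwa [orderBound_zero] at this

/-- The conormal bundle of a closed stratum is contained in the union of the conormal bundles of the
strata it contains. -/
lemma frame_conormal_subset (α : 𝒜.Vertex) : α.frame.conormal ⊆ ⋃ β : 𝒜.Vertex, β.conormal := by
  intro z hz
  set x : Fin N → ℂ := fun i => z (Sum.inl i) with hx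
  have hxα : x ∈ α.closedStratum := by
    have h1 : x - α.frame.o ∈ α.T := by
      rw [← α.frame.η.sum_repr (x - α.frame.o)]
      refine Submodule.sum_mem _ fun j _ => ?_
      by_cases hj : j ∈ α.frame.S
      · have h2 := hz j
        rw [Frame.aeval_bSymbol, if_pos hj, Frame.y_apply, Module.Basis.coord_apply] at h2
        rw [hx, h2, zero_smul]
        exact Submodule.zero_mem _
      · exact Submodule.smul_mem _ _ (α.isAdapted.η_mem j hj)
    have h2 := AffineSubspace.vadd_mem_of_mem_direction h1 α.isAdapted.o_mem
    simpa using h2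
  -- the smallest closed stratum through the point
  obtain ⟨β, ⟨hxβ, hβα⟩, hmin⟩ := (Set.toFinite {β : 𝒜.Vertex | x ∈ β.closedStratum ∧
    β.closedStratum ≤ α.closedStratum}).exists_minimalFor Vertex.closedStratum _ ⟨α, hxα, le_rfl⟩
  refine Set.mem_iUnion.2 ⟨β, ⟨hxβ, ?_⟩, fun v hv => ?_⟩
  · simp only [Set.mem_iUnion, not_exists]
    rintro ⟨γ, hγ⟩ hxγ
    exact hγ.not_ge (hmin ⟨hxγ, hγ.le.trans hβα⟩ hγ.le)
  · rw [eq_sum_of_mem_T (AffineSubspace.direction_le hβα hv)]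
    simp only [Finset.sum_apply, Pi.smul_apply, smul_eq_mul, Finset.mul_sum]
    rw [Finset.sum_comm]
    refine Finset.sum_eq_zero fun j _ => ?_
    split_ifs with hj
    · simp
    · have h2 := hz j
      rw [Frame.aeval_bSymbol, if_neg hj] at h2
      simp_rw [mul_left_comm _ (α.frame.η.coord j v)]
      rw [← Finset.mul_sum, h2, mul_zero]

lemma finitePresentation_quiverDModule :
    Module.FinitePresentation (DX N) (QuiverDModule Φ Q) := by
  have : Module.Finite (DX N) (FreeModule Q) := Module.Finite.of_basis (freeBasis Q)
  refine Module.finitePresentation_of_free_of_surjective (relations Φ Q).mkQ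
    (Submodule.mkQ_surjective _) ?_
  rw [Submodule.ker_mkQ, relations_eq]
  exact Submodule.fg_span (Set.finite_range _)

lemma isHolonomic_quiverDModule : IsHolonomic N (QuiverDModule Φ Q) where
  coherent := finitePresentation_quiverDModule Φ Q
  lagrangian _ hF := (qGen_hasNormalForms Φ Q).isLagrangian hF

lemma isSmoothAlong_quiverDModule : IsSmoothAlong 𝒜 (QuiverDModule Φ Q) where
  holonomic := isHolonomic_quiverDModule Φ Q
  charVariety_subset _ hF := by
    rw [(qGen_hasNormalForms Φ Q).charVariety_eq hF]
    exact Set.iUnion_subset fun e => frame_conormal_subset e.1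

/-! ### The associated graded module of the principal filtration -/

/-- The restriction in frame coordinates has the functions vanishing on the closed stratum as its
kernel. -/
lemma mem_ideal_iff (α : 𝒜.Vertex) (f : OX N) :
    f ∈ α.ideal ↔ α.frame.res (rename Sum.inl f) = 0 := by
  constructor
  · intro hf
    refine MvPolynomial.funext fun t => ?_
    have key : ∀ q : OX N, aeval t (α.frame.res (rename Sum.inl q))
        = aeval (fun i => aeval t (α.frame.resX i)) q := by
      intro q
      change ((aeval t).comp (α.frame.res.comp (rename Sum.inl))) q = _
      congr 1
      refine algHom_ext fun s => ?_
      rw [aeval_X, AlgHom.comp_apply, AlgHom.comp_apply, rename_X, Frame.res_X_inl]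
    have h1 : (fun i => aeval t (α.frame.resX i)) ∈ α.closedStratum := by
      have h2 : (∑ j, if j ∈ α.frame.S then 0 else t j • α.frame.η j) ∈ α.T :=
        Submodule.sum_mem _ fun j _ => by
          split_ifs with hj
          · exact Submodule.zero_mem _
          · exact Submodule.smul_mem _ _ (α.isAdapted.η_mem j hj)
      convert AffineSubspace.vadd_mem_of_mem_direction h2 α.isAdapted.o_mem using 1
      funext i
      rw [Frame.resX, map_add, map_sum, aeval_C, vadd_eq_add, Pi.add_apply, Finset.sum_apply,
        add_comm]
      congr 1
      refine Finset.sum_congr rfl fun j _ => ?_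
      split_ifs
      · simp
      · simp [mul_comm]
    have h2 := hf _ h1
    rw [map_zero]
    exact (key f).trans h2
  · intro hf x hx
    have hz : (Sum.elim x 0 : Cot N) ∈ α.frame.conormal := by
      intro i
      rw [Frame.aeval_bSymbol]
      split_ifs with hi
      · exact α.isAdapted.y_memF i hi x hx
      · simp
    have h1 := α.frame.aeval_eq_of_mem_conormal hz (rename Sum.inl f)
    rw [hf, map_zero, aeval_rename] at h1
    exact h1

variable (B : LinearMap.BilinForm ℂ (Fin N → ℂ))

lemma finrank_T' (hB : B.Nondegenerate) (α : 𝒜.Vertex) :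
    Module.finrank ℂ (α.T' B) = Fintype.card {j // j ∈ α.frame.S} := by
  rw [LinearMap.BilinForm.finrank_orthogonal hB, Fintype.card_coe, α.isAdapted.card_S,
    Module.finrank_fin_fun]
  have := α.finrank_T_add_l
  omega

/-- A basis of `T'_α` indexed by the transversal directions of the frame. -/
def orthogonalBasis (hB : B.Nondegenerate) (α : 𝒜.Vertex) :
    Module.Basis {j // j ∈ α.frame.S} ℂ (α.T' B) :=
  (Module.finBasisOfFinrankEq ℂ _ (finrank_T' B hB α)).reindex (Fintype.equivFin _).symm

/-- The index set of a basis of `S(T'_α) ⊗ Ω̄_α ⊗ V_α`. -/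
abbrev FibreIdx (α : 𝒜.Vertex) : Type :=
  ({j // j ∈ α.frame.S} →₀ ℕ) × Fin (Module.finrank ℂ (α.Omega ⊗[ℂ] Q.V α))

/-- The coordinates of an element of `(𝒪(X) / I) ⊗ W` with respect to a basis of `W`. -/
def quotientTensorEquiv {κ W : Type*} [AddCommGroup W] [Module ℂ W] (I : Ideal (OX N))
    (b : Module.Basis κ ℂ W) : (OX N ⧸ I) ⊗[ℂ] W ≃ₗ[OX N] (κ →₀ OX N ⧸ I) :=
  { (b.baseChange (OX N ⧸ I)).repr with
    map_smul' := fun f x => by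
      have h : f • x = (Ideal.Quotient.mk I f) • x := by
        rw [← Ideal.Quotient.algebraMap_eq, algebraMap_smul]
      change (b.baseChange (OX N ⧸ I)).repr (f • x) = f • (b.baseChange (OX N ⧸ I)).repr x
      rw [h, map_smul]
      ext k
      rw [Finsupp.smul_apply, Finsupp.smul_apply, ← Ideal.Quotient.algebraMap_eq, algebraMap_smul] }

/-- The coordinates of `𝒪(X̄_α) ⊗ S(T'_α) ⊗ Ω̄_α ⊗ V_α` over `𝒪(X̄_α)`. -/
def fibreEquiv (hB : B.Nondegenerate) (α : 𝒜.Vertex) :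
    (OX N ⧸ α.ideal) ⊗[ℂ] (SymmetricAlgebra ℂ (α.T' B) ⊗[ℂ] (α.Omega ⊗[ℂ] Q.V α)) ≃ₗ[OX N]
      (FibreIdx Q α →₀ OX N ⧸ α.ideal) :=
  quotientTensorEquiv α.ideal
    ((orthogonalBasis B hB α).symmetricAlgebra.tensorProduct (wBasis Q α))

/-- The map `𝒪(X̄_α) → Gr` given by a class of transversal derivatives of a generator. -/
def fibreMap (α : 𝒜.Vertex) (k : FibreIdx Q α) :
    (OX N ⧸ α.ideal) →ₗ[OX N] Gr (baseFiltration N (fun e : BasisIdx Q => e.1.l) (qGen Q Φ)) :=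
  (DirectSum.lof (OX N) ℤ (GrPiece (baseFiltration N (fun e : BasisIdx Q => e.1.l) (qGen Q Φ)))
    _).comp (Submodule.liftQ α.ideal (LinearMap.toSpanSingleton (OX N) _
      (transversalClass (fun e : BasisIdx Q => e.1.frame) (fun e => e.1.l) (qGen Q Φ)
        ⟨α, k.2⟩ k.1)) fun f hf =>
      (qGen_hasNormalForms Φ Q).smul_transversalClass_eq_zero ⟨α, k.2⟩ k.1
        ((mem_ideal_iff α f).1 hf))

lemma fibreMap_mk (α : 𝒜.Vertex) (k : FibreIdx Q α) (f : OX N) :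
    fibreMap Φ Q α k (Ideal.Quotient.mk _ f) = f • DirectSum.lof (OX N) ℤ
      (GrPiece (baseFiltration N (fun e : BasisIdx Q => e.1.l) (qGen Q Φ))) _
      (transversalClass (fun e : BasisIdx Q => e.1.frame) (fun e => e.1.l) (qGen Q Φ)
        ⟨α, k.2⟩ k.1) := by
  rw [← map_smul]
  rfl

/-- The map from the sum of the `𝒪(X̄_α) ⊗ S(T'_α) ⊗ Ω̄_α ⊗ V_α`, in coordinates, to the associated
graded module. -/
def totalMap : ((α : 𝒜.Vertex) → (FibreIdx Q α →₀ OX N ⧸ α.ideal)) →ₗ[OX N]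
    Gr (baseFiltration N (fun e : BasisIdx Q => e.1.l) (qGen Q Φ)) :=
  ∑ α, (Finsupp.lsum (OX N) (fibreMap Φ Q α)).comp (LinearMap.proj α)

lemma totalMap_apply (t : (α : 𝒜.Vertex) → (FibreIdx Q α →₀ OX N ⧸ α.ideal)) :
    totalMap Φ Q t = ∑ α, ∑ k ∈ (t α).support, fibreMap Φ Q α k (t α k) := by
  rw [totalMap, LinearMap.sum_apply]
  rfl

lemma totalMap_surjective : Function.Surjective (totalMap Φ Q) := by
  classical
  rw [← LinearMap.range_eq_top]
  refine (qGen_hasNormalForms Φ Q).eq_top_of_transversalClass_mem _ ?_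
  rintro ⟨α, i⟩ J
  have h1 := fibreMap_mk Φ Q α (J, i) 1
  rw [one_smul] at h1
  rw [LinearMap.mem_range]
  refine ⟨Pi.single α (Finsupp.single (J, i) (Ideal.Quotient.mk _ 1)), Eq.trans ?_ h1⟩
  rw [totalMap, LinearMap.sum_apply, Finset.sum_eq_single α]
  · rw [LinearMap.comp_apply, LinearMap.proj_apply, Pi.single_eq_same, Finsupp.lsum_single]
  · intro β _ hβ
    rw [LinearMap.comp_apply, LinearMap.proj_apply, Pi.single_eq_of_ne hβ, map_zero]
  · simp

lemma totalMap_injective : Function.Injective (totalMap Φ Q) := by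
  classical
  rw [injective_iff_map_eq_zero]
  intro t ht
  -- representatives of the coefficients
  choose c hc using fun α k => Ideal.Quotient.mk_surjective (I := α.ideal) (t α k)
  funext α
  ext ⟨J, j⟩
  rw [Pi.zero_apply, Finsupp.zero_apply, ← hc, Ideal.Quotient.eq_zero_iff_mem, mem_ideal_iff]
  refine eq_zero_of_forall_coeff (α.frame.res_rename_mem_supported _) fun K hK => ?_
  have h1 := congrArg ((qGen_hasNormalForms Φ Q).grLeading ⟨α, j⟩) ht
  rw [totalMap_apply, map_sum, map_zero, Finset.sum_eq_single α] at h1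
  · rw [map_sum] at h1
    have h2 : ∀ k ∈ (t α).support, (qGen_hasNormalForms Φ Q).grLeading ⟨α, j⟩
        (fibreMap Φ Q α k (t α k)) = if k.2 = j then
          α.frame.res (rename Sum.inl (c α k)) * monomialOn α.frame.S k.1 else 0 := by
      intro k _
      rw [← hc, fibreMap_mk, HasNormalForms.grLeading_smul,
        HasNormalForms.grLeading_lof_transversalClass]
      split_ifs with hk
      · subst hk
        rw [Pi.single_eq_same]
      · rw [Pi.single_eq_of_ne, mul_zero]
        intro h
        exact hk (by simpa using h.symm)
    rw [Finset.sum_congr rfl h2] at h1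
    have h3 := congrArg (coeff (K + J.embDomain (Function.Embedding.subtype _))) h1
    rw [coeff_sum, coeff_zero] at h3
    have h4 : ∀ k : FibreIdx Q α, coeff (K + J.embDomain (Function.Embedding.subtype _))
        (if k.2 = j then α.frame.res (rename Sum.inl (c α k)) * monomialOn α.frame.S k.1 else 0)
        = if k = (J, j) then coeff K (α.frame.res (rename Sum.inl (c α (J, j)))) else 0 := by
      rintro ⟨J', j'⟩
      by_cases hj : j' = j
      · subst hj
        rw [if_pos rfl, coeff_mul_monomialOn (α.frame.res_rename_mem_supported _) _ _ hK]
        by_cases hJ : J' = J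
        · subst hJ; simp
        · simp [hJ]
      · simp [hj]
    simp only [h4] at h3
    rw [Finset.sum_ite_eq'] at h3
    split_ifs at h3 with hk
    · exact h3
    · have h5 : c α (J, j) ∈ α.ideal := by
        rw [← Ideal.Quotient.eq_zero_iff_mem, hc]
        exact Finsupp.notMem_support_iff.1 hk
      rw [(mem_ideal_iff _ _).1 h5, coeff_zero]
  · intro α' _ hα
    rw [map_sum]
    refine Finset.sum_eq_zero fun k _ => ?_
    rw [← hc, fibreMap_mk, HasNormalForms.grLeading_smul,
      HasNormalForms.grLeading_lof_transversalClass, Pi.single_eq_of_ne, mul_zero]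
    rintro h
    exact hα (congrArg Sigma.fst h).symm
  · simp

/-- The associated graded module of the principal filtration. -/
def grEquiv (hB : B.Nondegenerate) :
    Gr (baseFiltration N (fun e : BasisIdx Q => e.1.l) (qGen Q Φ)) ≃ₗ[OX N]
      ⨁ α : 𝒜.Vertex, (OX N ⧸ α.ideal) ⊗[ℂ]
        (SymmetricAlgebra ℂ (α.T' B) ⊗[ℂ] (α.Omega ⊗[ℂ] Q.V α)) :=
  (((DirectSum.linearEquivFunOnFintype (OX N) 𝒜.Vertex _).trans
    (LinearEquiv.piCongrRight (fibreEquiv Q B hB))).trans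
      (LinearEquiv.ofBijective (totalMap Φ Q)
        ⟨totalMap_injective Φ Q, totalMap_surjective Φ Q⟩)).symm

end

end Arrangement

end QuiverDMod

end

theorem proposition4p2 {N : ℕ} (𝒜 : Arrangement N) (Φ : 𝒜.EdgeFraming) (Q : 𝒜.Quiver)
    (B : LinearMap.BilinForm ℂ (Fin N → ℂ)) (hB : B.Nondegenerate) :
    IsGoodFiltration (principalFiltration Φ Q) ∧
    Nonempty (Gr (principalFiltration Φ Q) ≃ₗ[OX N]
      ⨁ α : 𝒜.Vertex, (OX N ⧸ α.ideal) ⊗[ℂ]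
        (SymmetricAlgebra ℂ (α.T' B) ⊗[ℂ] (α.Omega ⊗[ℂ] Q.V α))) ∧
    IsHolonomic N (QuiverDModule Φ Q) ∧
    IsSmoothAlong 𝒜 (QuiverDModule Φ Q) := by
  refine ⟨?_, ?_, isHolonomic_quiverDModule Φ Q, isSmoothAlong_quiverDModule Φ Q⟩
  · rw [principalFiltration_eq]
    exact (qGen_hasNormalForms Φ Q).isGoodFiltration
  · rw [principalFiltration_eq]
    exact ⟨grEquiv Φ Q B hB⟩
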